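/- **Setting.** Let $m,n\ge 1$ and write $B_s$ for the open ball of radius $s$ about $0$ in $\mathbb R^{m+n}=\mathbb R^m\times\mathbb R^n$ and $\mathrm b_s$ for the one in $\mathbb R^m$. Planes are identified with the orthogonal projections onto them; $A:B=\operatorname{tr}(A^tB)$ and $\|\pi-\sigma\|$ is the Hilbert–Schmidt norm of the difference of the projections. *Boundary.* $\Gamma\subset\mathbb R^{m+n}$ is a closed $(m-1)$-dimensional submanifold of class $C^{1,\alpha}$, $\alpha\in(0,1]$, with $0\in\Gamma$; $r_0>0$ is such that $\Gamma\cap B_{r_0}$ is the graph of a $C^{1,\alpha}$ function over (an open subset of) $T_0\Gamma$; and $\kappa\ge 0$ satisfies, for all $x,y\in\Gamma\cap B_{r_0}$, $$|\mathbf p_{N_x\Gamma}(x-y)|\le\kappa|x-y|^{1+\alpha},\qquad \|\mathbf p_{N_x\Gamma}-\mathbf p_{N_y\Gamma}\|\le\kappa|x-y|^{\alpha},\qquad 2\kappa r_0^\alpha<\tfrac12 .$$ *Integrand.* $\mathcal F=\mathcal F(x,\pi)>0$ is of class $C^2$ on the bundle of $m$-planes over $B_{r_0}$, with $\|\mathcal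 F\|_{C^2}\le\Lambda$. The matrix $B_{\mathcal F}(x,\pi)$ is defined by $$B_{\mathcal F}(x,\pi):L=\mathcal F(x,\pi)\,(\pi:L)+\langle D_\pi\mathcal F(x,\pi),\ \pi^\perp L\pi+(\pi^\perp L\pi)^*\rangle ,$$ and $\mathcal F^*(x,\sigma)=\mathcal F(x,\sigma^\perp)$ on $n$-planes $\sigma$. $\mathcal F$ satisfies the uniformly scalar atomic condition with constant $K>0$: $B_{\mathcal F}(x,\pi_0):B_{\mathcal F^*}(x,\pi_1^\perp)\ge K\|\pi_0-\pi_1\|^2$ for all $x\in B_{r_0}$ and all $m$-planes $\pi_0,\pi_1$. Let $\lambda\ge 0$ be a Lipschitz constant on $B_{r_0}$ of $x\mapsto B_{\mathcal F}(x,\pi)$, for every $m$-plane $\pi$; if $\mathcal F$ does not depend on $x$, take $\lambda=0$. *Graph.* $\Omega\subset \mathrm b_{r_0}$ is open and $u:\Omega\to\mathbb R^n$ is Lipschitz with constant $\ell$. $V[u]$ is the multiplicity-one $m$-varifold of $\operatorname{graph}(u)$ in $B_{r_0}$, its support contains $0$, and the graph has no boundary in $B_{r_0}$ outside $\Gamma$,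 i.e. $\big(\overline{\operatorname{graph}(u)}\setminus\operatorname{graph}(u)\big)\cap B_{r_0}\subset\Gamma$. For $g\in C^1_c(B_{r_0},\mathbb R^{m+n})$ let $\delta_{\mathcal F}V[u](g)$ be the derivative at $t=0$ of the $\mathcal F$-energy of the push-forward of $V[u]$ under $x\mapsto x+tg(x)$. There is $\mathcal H_{\mathcal F}\in L^2(B_{r_0},\|V[u]\|;\mathbb R^{m+n})$ such that $$\delta_{\mathcal F}V[u](g)=-\int_{B_{r_0}\setminus\Gamma}\langle\mathcal H_{\mathcal F},g\rangle\,d\|V[u]\|\qquad\text{for all } g\in C^1_c(B_{r_0},\mathbb R^{m+n})\text{ with } g|_\Gamma\equiv 0 .$$ Put $\mathcal H[u](y)=\mathcal H_{\mathcal F}(y,u(y))$ (and $\mathcal H[u](y)=0$ if $(y,u(y))\notin B_{r_0}$). For a linear map $L:\mathbb R^m\to\mathbb R^n$ let $M(L)=\binom{\mathrm{id}_m}{L}$ and $h(L)=M(L)[M(L)^tM(L)]^{-1}M(L)^t$, and put $C_u=2+2\ell$. **Statement.** There is a constant $C_c>0$ depending only on $m,n,\Lambda,K,\ell$ and the boundary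 data $(\Gamma,\alpha,r_0,\kappa)$ such that, for all $\mathcal F,\lambda,\Omega,u,\mathcal H_{\mathcal F}$ as above, all linear $L:\mathbb R^m\to\mathbb R^n$ with $T_0\Gamma\subset\operatorname{im}h(L)$ and $\|L\|\le 2\ell$, and all $r>0$ with $4C_ur<r_0$, $$C_c\,\frac{1}{|\mathrm b_r\cap\Omega|}\int_{\mathrm b_r\cap\Omega}\|Du(y)-L\|^2\,dy\ \le\ \frac1{r^2}\,\frac{1}{|\mathrm b_{C_ur}\cap\Omega|}\int_{\mathrm b_{C_ur}\cap\Omega}|u(y)-L(y)|^2\,dy+r^2\,\frac{1}{|\mathrm b_{C_ur}\cap\Omega|}\int_{\mathrm b_{C_ur}\cap\Omega}|\mathcal H[u](y)|^2\,dy+\kappa^2r^{2\alpha}+\lambda^2r^2 ,$$ where $|A|$ is the Lebesgue measure of $A$. In particular the last term is absent when $\mathcal F$ is autonomous (independent of $x$). -/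

import Mathlib

open MeasureTheory Set Metric
open scoped Topology

noncomputable section

namespace AnisoGraph

/-- The ambient space `ℝ^m × ℝ^n` with its Euclidean norm. -/
abbrev Amb (m n : ℕ) : Type := EuclideanSpace ℝ (Fin m ⊕ Fin n)

variable {m n : ℕ}

/-! ### Planes -/

/-- The point `(x, y)` of `ℝ^m × ℝ^n`. -/
def pair (x : EuclideanSpace ℝ (Fin m)) (y : EuclideanSpace ℝ (Fin n)) : Amb m n :=
  WithLp.toLp 2 (Sum.elim x y)

/-- The base component `x` of `(x, y)`. -/
def base (z : Amb m n) : EuclideanSpace ℝ (Fin m) :=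
  WithLp.toLp 2 (fun i => z (Sum.inl i))

/-- The square of the distance of two planes `π`, `σ`: the squared Hilbert–Schmidt norm of
the difference of the two orthogonal projections. -/
def planeDistSq (π σ : Submodule ℝ (Amb m n)) : ℝ :=
  ∑ i, ∑ j, (inner ℝ (EuclideanSpace.single i (1 : ℝ))
    ((π.starProjection - σ.starProjection) (EuclideanSpace.single j (1 : ℝ)))) ^ 2

/-- The distance `‖π - σ‖` of two planes. -/
def planeDist (π σ : Submodule ℝ (Amb m n)) : ℝ := √(planeDistSq π σ)

/-- `M(L) : x ↦ (x, L x)`, the block matrix with blocks `id` and `L`. -/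
def graphMap (L : EuclideanSpace ℝ (Fin m) →L[ℝ] EuclideanSpace ℝ (Fin n)) :
    EuclideanSpace ℝ (Fin m) →L[ℝ] Amb m n :=
  LinearMap.toContinuousLinearMap
    { toFun := fun x => pair x (L x)
      map_add' := by
        intro x y
        ext i
        cases i <;> simp [pair]
      map_smul' := by
        intro c x
        ext i
        cases i <;> simp [pair] }

/-- `h(L) = M(L) (M(L)ᵗ M(L))⁻¹ M(L)ᵗ`. -/
def graphProj (L : EuclideanSpace ℝ (Fin m) →L[ℝ] EuclideanSpace ℝ (Fin n)) :
    Amb m n →L[ℝ] Amb m n :=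
  graphMap L ∘L Ring.inverse ((graphMap L).adjoint ∘L graphMap L) ∘L (graphMap L).adjoint

/-! ### Anisotropic integrands

An integrand is a function `F x π` of a point `x` and a plane `π`; only its values at points
of the ball and at planes of dimension `m` matter. -/

/-- `F` near the plane `π` in terms of a point and an endomorphism `X` near `0`: since
`X ↦ (id + X) π` is a smooth submersion of a neighbourhood of `0` onto a neighbourhood of `π`
in the Grassmannian, `F` is `C^k` near `(x, π)` iff this function is `C^k` near `(x, 0)`. -/
def bundleChart (F : Amb m n → Submodule ℝ (Amb m n) → ℝ) (π : Submodule ℝ (Amb m n)) :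
    Amb m n × (Amb m n →L[ℝ] Amb m n) → ℝ :=
  fun q => F q.1 (π.map (ContinuousLinearMap.id ℝ (Amb m n) + q.2).toLinearMap)

/-- `F` is a positive integrand of class `C²` on the bundle of `m`-planes over the open ball of
radius `r₀`, and all its derivatives of order `0, 1, 2` are bounded by `Λ`. -/
def IsC2Integrand (F : Amb m n → Submodule ℝ (Amb m n) → ℝ) (r₀ Λ : ℝ) : Prop :=
  ∀ x ∈ ball (0 : Amb m n) r₀, ∀ π : Submodule ℝ (Amb m n), Module.finrank ℝ π = m →
    0 < F x π ∧ ContDiffAt ℝ 2 (bundleChart F π) (x, 0) ∧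
      ∀ k ≤ 2, ‖iteratedFDeriv ℝ k (bundleChart F π) (x, 0)‖ ≤ Λ

/-- The linear form `L ↦ B_F(x, π) : L`, that is
`F(x, π) (π : L) + ⟨D_π F(x, π), π^⊥ ∘ L ∘ π + (π^⊥ ∘ L ∘ π)^*⟩`. The tangent vector
`π^⊥ ∘ L ∘ π + (π^⊥ ∘ L ∘ π)^*` of the Grassmannian (as a set of orthogonal projections) is the
velocity at `t = 0` of the curve of planes `(id + t π^⊥ ∘ L ∘ π) π`. -/
def bForm (F : Amb m n → Submodule ℝ (Amb m n) → ℝ) (x : Amb m n) (π : Submodule ℝ (Amb m n))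
    (L : Amb m n →L[ℝ] Amb m n) : ℝ :=
  F x π * LinearMap.trace ℝ (Amb m n) (π.starProjection ∘L L).toLinearMap +
    fderiv ℝ (fun X : Amb m n →L[ℝ] Amb m n => bundleChart F π (x, X)) 0
      (πᗮ.starProjection ∘L L ∘L π.starProjection)

/-- The endomorphism `z ↦ z_j e_i`. -/
def matUnit (i j : Fin m ⊕ Fin n) : Amb m n →L[ℝ] Amb m n :=
  (EuclideanSpace.proj j : Amb m n →L[ℝ] ℝ).smulRight (EuclideanSpace.single i (1 : ℝ))

/-- The matrix `B_F(x, π)`. -/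
def bMatrix (F : Amb m n → Submodule ℝ (Amb m n) → ℝ) (x : Amb m n)
    (π : Submodule ℝ (Amb m n)) : Matrix (Fin m ⊕ Fin n) (Fin m ⊕ Fin n) ℝ :=
  Matrix.of fun i j => bForm F x π (matUnit i j)

/-- `A : B = tr (Aᵗ B)`. -/
def frob (A B : Matrix (Fin m ⊕ Fin n) (Fin m ⊕ Fin n) ℝ) : ℝ :=
  (A.transpose * B).trace

/-- The dual integrand `F^*(x, σ) = F(x, σ^⊥)` on `n`-planes. -/
def dualIntegrand (F : Amb m n → Submodule ℝ (Amb m n) → ℝ) :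
    Amb m n → Submodule ℝ (Amb m n) → ℝ :=
  fun x σ => F x σᗮ

/-- The uniformly scalar atomic condition over the ball of radius `r₀`, with constant `K`. -/
def USAC (F : Amb m n → Submodule ℝ (Amb m n) → ℝ) (r₀ K : ℝ) : Prop :=
  ∀ x ∈ ball (0 : Amb m n) r₀, ∀ π₀ π₁ : Submodule ℝ (Amb m n),
    Module.finrank ℝ π₀ = m → Module.finrank ℝ π₁ = m →
      K * planeDistSq π₀ π₁ ≤ frob (bMatrix F x π₀) (bMatrix (dualIntegrand F) x π₁ᗮ)

/-- `lam` is a Lipschitz constant of `x ↦ B_F(x, π)` on the ball of radius `r₀`, for every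
`m`-plane `π`. For an autonomous integrand this holds with `lam = 0`. -/
def VariationBound (F : Amb m n → Submodule ℝ (Amb m n) → ℝ) (r₀ lam : ℝ) : Prop :=
  ∀ x ∈ ball (0 : Amb m n) r₀, ∀ y ∈ ball (0 : Amb m n) r₀,
    ∀ π : Submodule ℝ (Amb m n), Module.finrank ℝ π = m →
      √(frob (bMatrix F x π - bMatrix F y π) (bMatrix F x π - bMatrix F y π)) ≤ lam * ‖x - y‖

/-! ### The boundary -/

/-- The tangent space of `Γ` at `x`. -/
def tangentSpace (Γ : Set (Amb m n)) (x : Amb m n) : Submodule ℝ (Amb m n) :=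
  Submodule.span ℝ (tangentConeAt ℝ Γ x)

/-- The normal space of `Γ` at `x`. -/
def normalSpace (Γ : Set (Amb m n)) (x : Amb m n) : Submodule ℝ (Amb m n) :=
  (tangentSpace Γ x)ᗮ

/-- `S` is the graph `{p + t + γ(t) : t ∈ D}` of a `C^{1,α}` function `γ : D → W^⊥` on an open
subset `D` of the linear space `W`. -/
def IsC1HolderGraph (α : ℝ) (p : Amb m n) (W : Submodule ℝ (Amb m n)) (S : Set (Amb m n)) :
    Prop :=
  ∃ (D : Set W) (γ : W → Wᗮ) (C : ℝ), IsOpen D ∧ ContDiffOn ℝ 1 γ D ∧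
    (∀ s ∈ D, ∀ t ∈ D, ‖fderiv ℝ γ s - fderiv ℝ γ t‖ ≤ C * ‖s - t‖ ^ α) ∧
    S = {z | ∃ t ∈ D, z = p + (t : Amb m n) + (γ t : Amb m n)}

/-- `Γ` is a closed `(m-1)`-dimensional submanifold of class `C^{1,α}` (without boundary):
near each of its points it is a `C^{1,α}` graph over its tangent space, of dimension `m-1`. -/
def IsC1HolderSubmanifold (α : ℝ) (Γ : Set (Amb m n)) : Prop :=
  IsClosed Γ ∧ ∀ p ∈ Γ, Module.finrank ℝ (tangentSpace Γ p) + 1 = m ∧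
    ∃ δ > 0, IsC1HolderGraph α p (tangentSpace Γ p) (Γ ∩ ball p δ)

/-- The assumptions on the boundary `Γ` in the ball of radius `r₀`. -/
structure BoundaryAssumption (Γ : Set (Amb m n)) (α r₀ κ : ℝ) : Prop where
  α_pos : 0 < α
  α_le : α ≤ 1
  r₀_pos : 0 < r₀
  κ_nonneg : 0 ≤ κ
  submanifold : IsC1HolderSubmanifold α Γ
  zero_mem : (0 : Amb m n) ∈ Γ
  graph : IsC1HolderGraph α 0 (tangentSpace Γ 0) (Γ ∩ ball 0 r₀)
  secant : ∀ x ∈ Γ ∩ ball 0 r₀, ∀ y ∈ Γ ∩ ball 0 r₀,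
    ‖(normalSpace Γ x).starProjection (x - y)‖ ≤ κ * ‖x - y‖ ^ (1 + α)
  tilt : ∀ x ∈ Γ ∩ ball 0 r₀, ∀ y ∈ Γ ∩ ball 0 r₀,
    planeDist (normalSpace Γ x) (normalSpace Γ y) ≤ κ * ‖x - y‖ ^ α
  small : 2 * κ * r₀ ^ α < 1 / 2

/-! ### The varifold of a Lipschitz graph and its anisotropic first variation -/

/-- The graph of `u` over `Ω`. -/
def graphSet (Ω : Set (EuclideanSpace ℝ (Fin m)))
    (u : EuclideanSpace ℝ (Fin m) → EuclideanSpace ℝ (Fin n)) : Set (Amb m n) :=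
  (fun x => pair x (u x)) '' Ω

/-- The weight measure of the varifold `V[u]`, the graph of `u` with multiplicity one, in the
open ball of radius `r₀`. -/
def graphWeight (Ω : Set (EuclideanSpace ℝ (Fin m)))
    (u : EuclideanSpace ℝ (Fin m) → EuclideanSpace ℝ (Fin n)) (r₀ : ℝ) : Measure (Amb m n) :=
  (μHE[m] : Measure (Amb m n)).restrict (graphSet Ω u ∩ ball 0 r₀)

/-- The tangent plane of the graph of `u` at its point `z` (for almost every `z`). -/
def graphTangent (u : EuclideanSpace ℝ (Fin m) → EuclideanSpace ℝ (Fin n)) (z : Amb m n) :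
    Submodule ℝ (Amb m n) :=
  LinearMap.range (graphMap (fderiv ℝ u (base z))).toLinearMap

/-- The Jacobian determinant `√det ((A|_π)^* ∘ A|_π)` of `A` on `π`. -/
def jacobian (A : Amb m n →L[ℝ] Amb m n) (π : Submodule ℝ (Amb m n)) : ℝ :=
  √(LinearMap.det (LinearMap.adjoint (A.toLinearMap ∘ₗ π.subtype) ∘ₗ
    (A.toLinearMap ∘ₗ π.subtype)))

/-- The anisotropic energy of the push-forward `φ^# V` of the rectifiable varifold `V` with weight
`μ` and tangent planes `T`. -/
def pushEnergy (F : Amb m n → Submodule ℝ (Amb m n) → ℝ) (μ : Measure (Amb m n))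
    (T : Amb m n → Submodule ℝ (Amb m n)) (φ : Amb m n → Amb m n) : ℝ :=
  ∫ z, F (φ z) ((T z).map (fderiv ℝ φ z).toLinearMap) * jacobian (fderiv ℝ φ z) (T z) ∂μ

/-- The anisotropic first variation `δ_F V(g)`, the derivative at `t = 0` of the energy of
`(φ_t)^# V` with `φ_t(z) = z + t g(z)`, exists and equals `d`. -/
def HasFirstVariation (F : Amb m n → Submodule ℝ (Amb m n) → ℝ) (μ : Measure (Amb m n))
    (T : Amb m n → Submodule ℝ (Amb m n)) (g : Amb m n → Amb m n) (d : ℝ) : Prop :=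
  HasDerivAt (fun t : ℝ => pushEnergy F μ T (fun z => z + t • g z)) d 0

/-- Away from `Γ`, in the open ball of radius `r₀`, the first variation of the varifold with
weight `μ` and tangent planes `T` is represented by the mean curvature vector `H`:
`δ_F V(g) = - ∫ ⟨H, g⟩ d‖V‖` for the `C¹` fields `g` with compact support in the ball that
vanish on `Γ`. -/
def IsMeanCurvature (F : Amb m n → Submodule ℝ (Amb m n) → ℝ) (μ : Measure (Amb m n))
    (T : Amb m n → Submodule ℝ (Amb m n)) (Γ : Set (Amb m n)) (r₀ : ℝ)
    (H : Amb m n → Amb m n) : Prop :=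
  ∀ g : Amb m n → Amb m n, ContDiff ℝ 1 g → HasCompactSupport g → tsupport g ⊆ ball 0 r₀ →
    (∀ z ∈ Γ, g z = 0) →
      HasFirstVariation F μ T g (-∫ z in ball 0 r₀ \ Γ, inner ℝ (H z) (g z) ∂μ)

/-- `H[u](y) = H(y, u(y))`, where `H` lives on the open ball of radius `r₀` (extended by zero). -/
def curvatureAlong (u : EuclideanSpace ℝ (Fin m) → EuclideanSpace ℝ (Fin n)) (r₀ : ℝ)
    (H : Amb m n → Amb m n) (y : EuclideanSpace ℝ (Fin m)) : Amb m n :=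
  (ball (0 : Amb m n) r₀).indicator H (pair y (u y))

/-- The assumptions on the graph of `u : Ω → ℝ^n`: `Ω` is an open subset of the ball of radius
`r₀`, `u` is Lipschitz with constant `ℓ`, the origin is in the support of `V[u]`, the graph has no
boundary points in the ball outside `Γ`, and `V[u]` has the anisotropic mean curvature `H` in `L²`
away from `Γ`. -/
structure GraphAssumption (F : Amb m n → Submodule ℝ (Amb m n) → ℝ) (Γ : Set (Amb m n)) (r₀ : ℝ)
    (ℓ : NNReal) (Ω : Set (EuclideanSpace ℝ (Fin m)))
    (u : EuclideanSpace ℝ (Fin m) → EuclideanSpace ℝ (Fin n)) (H : Amb m n → Amb m n) :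
    Prop where
  isOpen : IsOpen Ω
  subset_ball : Ω ⊆ ball 0 r₀
  lipschitz : LipschitzOnWith ℓ u Ω
  zero_mem_support : (0 : Amb m n) ∈ (graphWeight Ω u r₀).support
  boundary : (closure (graphSet Ω u) \ graphSet Ω u) ∩ ball 0 r₀ ⊆ Γ
  memLp : MemLp H 2 (graphWeight Ω u r₀)
  meanCurvature : IsMeanCurvature F (graphWeight Ω u r₀) (graphTangent u) Γ r₀ H

end AnisoGraph

end

/-! The inequality comes from testing the first variation with a single vector field. Let π be the
graph plane of L and let D(z) be the endomorphism with matrix B_{F*}(z, π^⊥) (`dualOp`). The field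
is g(z) = φ(z)² D(z) π^⊥(z - f(z)) (`testField`). Here φ is a cutoff at scale r, and f(z) is the
height of Γ over T_0Γ above the projection of z to T_0Γ. For z in Γ near 0 the point z - f(z) lies
in T_0Γ ⊆ π, so g vanishes on Γ and is admissible. By `BoundaryAssumption.exists_deviation`, |f| is
of order κ r^{1+α} and |Df| of order κ r^α; this is the source of the term κ² r^{2α}.

By `hasFirstVariation`, the first variation at g is the integral of D_x F · g + B_F(z, T) : Dg,
where T is the tangent plane. Since D π^⊥ = D, the leading part of Dg is φ² D, and the scalar atomic
condition bounds B_F(z, T) : D below by K ‖T - π‖². Apart from one term containing the z-derivative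
of D, the rest of Dg consists of multiples of D ∘ R, with R = Df or R = Dφ ⊗ π^⊥(z - f(z)). The
identity B_F(z, π) : (D ∘ R) = 0 (`bForm_dualOp_comp`) and the Lipschitz dependence of B_F on the
plane (`abs_bForm_graphPlane_sub_le`) show that such a term costs at most a constant times ‖A - L‖
‖R‖, where A is the slope of T. Since ‖A - L‖ is comparable to ‖T - π‖ for bounded slopes, Young's
inequality absorbs it (`tilt_absorption`).

The terms with a derivative in z are controlled by λ alone: B_F : id = m F, and the entries of D are
linear expressions in F and B_F, so F and D inherit the Lipschitz bound. These terms and the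
curvature integral carry no tilt factor; they are split into the squares of |π^⊥ z| / r, κ r^α, λ r
and r |H|. The result is `integral_tilt_le`.

It is transported to the base by comparing the Hausdorff measure of the graph with Lebesgue measure
through two Lipschitz maps. Averages over the two different domains are compared by
`exists_volume_ratio`: boundary points of Ω near 0 lift to Γ, which is almost flat, so some cone
with vertex in Ω meets no boundary point of Ω inside a small ball, and Ω contains a ball of radius
comparable to the scale. -/

noncomputable section

namespace AnisoGraph

variable {m n : ℕ}

/-! ### Determinants and Jacobians -/

/-- The determinant of a matrix as a function of its entries. -/
lemma contDiff_det {ι : Type*} [Fintype ι] [DecidableEq ι] {k : WithTop ℕ∞} :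
    ContDiff ℝ k (fun M : ι → ι → ℝ => (Matrix.of M).det) := by
  simp only [Matrix.det_apply, Matrix.of_apply]
  refine ContDiff.sum fun σ _ => ContDiff.const_smul _ (contDiff_prod fun i _ => ?_)
  exact (contDiff_apply ℝ ℝ i).comp (contDiff_apply ℝ (ι → ℝ) (σ i))

lemma hasDerivAt_det_one_add_smul {ι : Type*} [Fintype ι] [DecidableEq ι] (M : Matrix ι ι ℝ) :
    HasDerivAt (fun t : ℝ => (1 + t • M).det) M.trace 0 := by
  have hfun : (fun t : ℝ => (1 + t • M).det) = fun t => _ :=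
    funext fun t => Matrix.det_one_add_smul t M
  rw [hfun]
  -- The expansion reads det (1 + t M) = 1 + t tr M + t² p(t); only the linear term survives at t =
  -- 0.
  set p := (Matrix.det (1 + (Polynomial.X : Polynomial ℝ) • M.map Polynomial.C)).divX.divX
  have h := (((hasDerivAt_id (0 : ℝ)).const_mul M.trace).const_add 1).add
    ((p.hasDerivAt 0).mul ((hasDerivAt_id (0 : ℝ)).pow 2))
  exact h.congr_deriv (by simp)

/-- By the chain rule only the velocity of the curve matters, so the curve may be replaced by the
straight line through the identity with the same velocity. -/
lemma hasDerivAt_det_of_eq_one {ι : Type*} [Fintype ι] [DecidableEq ι] {c : ℝ → ι → ι → ℝ}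
    {c' : ι → ι → ℝ} (hc : HasDerivAt c c' 0) (h0 : c 0 = (1 : Matrix ι ι ℝ)) :
    HasDerivAt (fun t => (Matrix.of (c t)).det) (Matrix.of c').trace 0 := by
  have hd : DifferentiableAt ℝ (fun M : ι → ι → ℝ => (Matrix.of M).det) (c 0) :=
    (contDiff_det (k := 1)).differentiable (by simp) _
  have h1 := hd.hasFDerivAt.comp_hasDerivAt (0 : ℝ) hc
  have hl : HasDerivAt (fun t : ℝ => c 0 + t • c') c' 0 := by
    simpa using ((hasDerivAt_id (0 : ℝ)).smul_const c').const_add (c 0)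
  have h2 := (hd.hasFDerivAt.congr_fderiv rfl).comp_hasDerivAt_of_eq (0 : ℝ) hl (by simp)
  have h3 : HasDerivAt (fun t : ℝ => (Matrix.of (c 0 + t • c')).det) (Matrix.of c').trace 0 := by
    rw [h0]
    exact hasDerivAt_det_one_add_smul (Matrix.of c')
  rw [h3.unique h2]
  exact h1

lemma jacobian_eq_normDet (A : Amb m n →L[ℝ] Amb m n) (π : Submodule ℝ (Amb m n)) :
    jacobian A π = (A.toLinearMap ∘ₗ π.subtype).normDet := by
  have h := LinearMap.normDet_sq (A.toLinearMap ∘ₗ π.subtype)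
  simp only [RCLike.ofReal_real_eq_id, id] at h
  rw [jacobian, ← h, Real.sqrt_sq (LinearMap.normDet_nonneg _)]

lemma jacobian_range_mul (A : Amb m n →L[ℝ] Amb m n)
    (M : EuclideanSpace ℝ (Fin m) →L[ℝ] Amb m n) :
    jacobian A (LinearMap.range M.toLinearMap) * M.toLinearMap.normDet =
      (A ∘L M).toLinearMap.normDet := by
  rw [jacobian_eq_normDet]
  exact (LinearMap.normDet_comp M.toLinearMap A.toLinearMap).symm

lemma sum_inner_eq_trace_starProjection (π : Submodule ℝ (Amb m n)) {ι : Type*} [Fintype ι]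
    (b : OrthonormalBasis ι ℝ π) (A : Amb m n →L[ℝ] Amb m n) :
    ∑ i, inner ℝ (b i : Amb m n) (A (b i)) =
      LinearMap.trace ℝ (Amb m n) (π.starProjection ∘L A).toLinearMap := by
  have h1 : (π.starProjection ∘L A).toLinearMap =
      π.subtype ∘ₗ (π.orthogonalProjectionOnto.toLinearMap ∘ₗ A.toLinearMap) := rfl
  rw [h1, LinearMap.trace_comp_comm', LinearMap.trace_eq_sum_inner _ b]
  refine Finset.sum_congr rfl fun i _ => ?_
  simp

/-- The Jacobian is the square root of the Gram determinant of the vectors b_i + t A b_i. The Gram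
matrix is the identity at t = 0 and its derivative is the symmetrized matrix of A on π, with trace
twice that of π A; the square root halves it. -/
lemma hasDerivAt_jacobian (π : Submodule ℝ (Amb m n)) (A : Amb m n →L[ℝ] Amb m n) :
    HasDerivAt (fun t : ℝ => jacobian (ContinuousLinearMap.id ℝ (Amb m n) + t • A) π)
      (LinearMap.trace ℝ (Amb m n) (π.starProjection ∘L A).toLinearMap) 0 := by
  classical
  let b := stdOrthonormalBasis ℝ π
  let c : ℝ → Fin (Module.finrank ℝ π) → Fin (Module.finrank ℝ π) → ℝ := fun t i j =>
    inner ℝ ((b i : Amb m n) + t • A (b i)) ((b j : Amb m n) + t • A (b j))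
  have hj : ∀ t : ℝ, jacobian (ContinuousLinearMap.id ℝ (Amb m n) + t • A) π =
      √((Matrix.of (c t)).det) := by
    intro t
    rw [jacobian_eq_normDet]
    have h := LinearMap.normDet_sq_eq_det_gram
      ((ContinuousLinearMap.id ℝ (Amb m n) + t • A).toLinearMap ∘ₗ π.subtype) b
    simp only [RCLike.ofReal_real_eq_id, id] at h
    rw [← Real.sqrt_sq (LinearMap.normDet_nonneg _), h]
    rfl
  have h0 : c 0 = (1 : Matrix _ _ ℝ) := by
    ext i j
    simp only [c, zero_smul, add_zero, Matrix.one_apply]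
    exact (orthonormal_iff_ite.mp b.orthonormal) i j
  have hc : HasDerivAt c (fun i j => inner ℝ (b i : Amb m n) (A (b j)) +
      inner ℝ (A (b i)) (b j : Amb m n)) 0 := by
    refine hasDerivAt_pi.mpr fun i => hasDerivAt_pi.mpr fun j => ?_
    have hl : ∀ i, HasDerivAt (fun t : ℝ => (b i : Amb m n) + t • A (b i)) (A (b i)) 0 := by
      intro i
      simpa using ((hasDerivAt_id (0 : ℝ)).smul_const (A (b i))).const_add (b i : Amb m n)
    simpa using (hl i).inner ℝ (hl j)
  have hd := (hasDerivAt_det_of_eq_one hc h0)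
  have h1 : (Matrix.of (c 0)).det = 1 := by
    rw [h0]; exact Matrix.det_one
  have hs := hd.sqrt (by rw [h1]; norm_num)
  simp_rw [hj]
  convert hs using 1
  rw [h1, ← sum_inner_eq_trace_starProjection π b]
  simp only [Matrix.trace, Matrix.diag, Matrix.of_apply, Real.sqrt_one, mul_one,
    Finset.sum_add_distrib]
  rw [Finset.sum_congr rfl fun i _ => real_inner_comm (b i : Amb m n) (A (b i))]
  ring

lemma contDiffAt_normDet {k : WithTop ℕ∞} {M : EuclideanSpace ℝ (Fin m) →L[ℝ] Amb m n}
    (hM : Function.Injective M) :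
    ContDiffAt ℝ k (fun M : EuclideanSpace ℝ (Fin m) →L[ℝ] Amb m n =>
      M.toLinearMap.normDet) M := by
  classical
  let b := EuclideanSpace.basisFun (Fin m) ℝ
  have h : ∀ M : EuclideanSpace ℝ (Fin m) →L[ℝ] Amb m n, M.toLinearMap.normDet =
      √((Matrix.of fun i j => inner ℝ (M (b i)) (M (b j))).det) := by
    intro M
    have h := LinearMap.normDet_sq_eq_det_gram M.toLinearMap b
    simp only [RCLike.ofReal_real_eq_id, id] at h
    rw [← Real.sqrt_sq (LinearMap.normDet_nonneg _), h]
    rfl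
  have hne : (Matrix.of fun i j => inner ℝ (M (b i)) (M (b j))).det ≠ 0 := by
    intro h0
    have h1 := h M
    rw [h0, Real.sqrt_zero] at h1
    have h2 : M.toLinearMap.normDet ≠ 0 ↔ Function.Injective M.toLinearMap :=
      (LinearMap.normDet_ne_zero_tfae M.toLinearMap).out 0 4
    exact h2.mpr hM h1
  simp_rw [h]
  refine ContDiffAt.sqrt ?_ hne
  refine (contDiff_det (k := k)).contDiffAt.comp M (f := fun M : EuclideanSpace ℝ (Fin m) →L[ℝ] Amb m n =>
    fun i j => inner ℝ (M (b i)) (M (b j))) ?_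
  refine contDiffAt_pi.mpr fun i => contDiffAt_pi.mpr fun j => ?_
  exact (ContDiffAt.inner ℝ (contDiffAt_id.clm_apply contDiffAt_const)
    (contDiffAt_id.clm_apply contDiffAt_const))

/-! ### Graph planes and the charts of the Grassmannian -/

/-- The projection onto the base. -/
def baseL : Amb m n →L[ℝ] EuclideanSpace ℝ (Fin m) :=
  LinearMap.toContinuousLinearMap
    { toFun := base
      map_add' := fun x y => by ext i; simp [base]
      map_smul' := fun c x => by ext i; simp [base] }

/-- The inclusion of the vertical factor. -/
def inrL : EuclideanSpace ℝ (Fin n) →L[ℝ] Amb m n :=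
  LinearMap.toContinuousLinearMap
    { toFun := fun y => pair 0 y
      map_add' := by
        intro x y
        ext i
        cases i <;> simp [pair]
      map_smul' := by
        intro c x
        ext i
        cases i <;> simp [pair] }

@[simp] lemma baseL_apply (z : Amb m n) : baseL z = base z := rfl

@[simp] lemma inrL_apply (y : EuclideanSpace ℝ (Fin n)) :
    (inrL y : Amb m n) = pair 0 y := rfl

@[simp] lemma graphMap_apply (L : EuclideanSpace ℝ (Fin m) →L[ℝ] EuclideanSpace ℝ (Fin n))
    (x : EuclideanSpace ℝ (Fin m)) : graphMap L x = pair x (L x) := rfl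

@[simp] lemma base_pair (x : EuclideanSpace ℝ (Fin m)) (y : EuclideanSpace ℝ (Fin n)) :
    base (pair x y) = x := by
  ext i; simp [base, pair]

lemma norm_pair_sq (x : EuclideanSpace ℝ (Fin m)) (y : EuclideanSpace ℝ (Fin n)) :
    ‖pair x y‖ ^ 2 = ‖x‖ ^ 2 + ‖y‖ ^ 2 := by
  simp [EuclideanSpace.norm_sq_eq, pair]

lemma pair_sub_pair (x x' : EuclideanSpace ℝ (Fin m)) (y y' : EuclideanSpace ℝ (Fin n)) :
    pair x y - pair x' y' = pair (x - x') (y - y') := by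
  ext i; cases i <;> simp [pair]

lemma norm_base_le (z : Amb m n) : ‖base z‖ ≤ ‖z‖ := by
  have : ‖base z‖ ^ 2 ≤ ‖z‖ ^ 2 := by
    simp only [EuclideanSpace.norm_sq_eq, Fintype.sum_sum_type, base]
    exact le_add_of_nonneg_right (Finset.sum_nonneg fun i _ => sq_nonneg _)
  exact (sq_le_sq₀ (norm_nonneg _) (norm_nonneg _)).mp this

lemma norm_le_norm_pair_left (x : EuclideanSpace ℝ (Fin m)) (y : EuclideanSpace ℝ (Fin n)) :
    ‖x‖ ≤ ‖pair x y‖ := by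
  simpa using norm_base_le (pair x y)

lemma norm_pair_le (x : EuclideanSpace ℝ (Fin m)) (y : EuclideanSpace ℝ (Fin n)) :
    ‖pair x y‖ ≤ ‖x‖ + ‖y‖ := by
  refine (sq_le_sq₀ (norm_nonneg _) (by positivity)).mp ?_
  rw [norm_pair_sq]
  nlinarith [norm_nonneg x, norm_nonneg y]

lemma norm_pair_zero (y : EuclideanSpace ℝ (Fin n)) :
    ‖(pair 0 y : Amb m n)‖ = ‖y‖ := by
  refine (pow_left_inj₀ (norm_nonneg _) (norm_nonneg _) two_ne_zero).mp ?_
  rw [norm_pair_sq]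
  simp

lemma graphMap_eq (L : EuclideanSpace ℝ (Fin m) →L[ℝ] EuclideanSpace ℝ (Fin n)) :
    graphMap L = graphMap 0 + inrL ∘L L := by
  ext x i
  cases i <;> simp [pair]

lemma graphMap_injective (L : EuclideanSpace ℝ (Fin m) →L[ℝ] EuclideanSpace ℝ (Fin n)) :
    Function.Injective (graphMap L) := fun x y h => by
  have := congrArg base h
  simpa using this

lemma finrank_range {M : EuclideanSpace ℝ (Fin m) →L[ℝ] Amb m n} (hM : Function.Injective M) :
    Module.finrank ℝ (LinearMap.range M.toLinearMap) = m := by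
  rw [LinearMap.finrank_range_of_inj (f := M.toLinearMap) hM]
  simp

/-- The graph plane of `L`. -/
def graphPlane (L : EuclideanSpace ℝ (Fin m) →L[ℝ] EuclideanSpace ℝ (Fin n)) :
    Submodule ℝ (Amb m n) := LinearMap.range (graphMap L).toLinearMap

lemma finrank_graphPlane (L : EuclideanSpace ℝ (Fin m) →L[ℝ] EuclideanSpace ℝ (Fin n)) :
    Module.finrank ℝ (graphPlane L) = m := finrank_range (graphMap_injective L)

/-- The map id + (M - M₀) P agrees with M after composition with M₀, hence carries the range of M₀
onto that of M. This expresses a function of the range of M as the chart composed with an affine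
map, so smoothness in the plane becomes smoothness in a parametrization of it. -/
lemma bundleChart_range (F : Amb m n → Submodule ℝ (Amb m n) → ℝ)
    {M₀ : EuclideanSpace ℝ (Fin m) →L[ℝ] Amb m n} {P : Amb m n →L[ℝ] EuclideanSpace ℝ (Fin m)}
    (hP : P ∘L M₀ = ContinuousLinearMap.id ℝ _) (y : Amb m n)
    (M : EuclideanSpace ℝ (Fin m) →L[ℝ] Amb m n) :
    F y (LinearMap.range M.toLinearMap) =
      bundleChart F (LinearMap.range M₀.toLinearMap) (y, (M - M₀) ∘L P) := by
  have h : (ContinuousLinearMap.id ℝ (Amb m n) + (M - M₀) ∘L P) ∘L M₀ = M := by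
    ext1 x
    have := congrArg (fun f => f x) hP
    simp only [ContinuousLinearMap.comp_apply, ContinuousLinearMap.id_apply] at this
    simp [this]
  simp only [bundleChart]
  rw [← LinearMap.range_comp, ← ContinuousLinearMap.toLinearMap_comp, h]

lemma contDiffAt_range {F : Amb m n → Submodule ℝ (Amb m n) → ℝ} {r₀ Λ : ℝ}
    (hF : IsC2Integrand F r₀ Λ) {x : Amb m n} (hx : x ∈ ball (0 : Amb m n) r₀)
    {M₀ : EuclideanSpace ℝ (Fin m) →L[ℝ] Amb m n} (hM : Function.Injective M₀) :
    ContDiffAt ℝ 2 (fun q : Amb m n × (EuclideanSpace ℝ (Fin m) →L[ℝ] Amb m n) =>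
      F q.1 (LinearMap.range q.2.toLinearMap)) (x, M₀) := by
  obtain ⟨P, hP⟩ := LinearMap.exists_leftInverse_of_injective M₀.toLinearMap
    (LinearMap.ker_eq_bot.mpr hM)
  have hP' : LinearMap.toContinuousLinearMap P ∘L M₀ = ContinuousLinearMap.id ℝ _ := by
    ext1 x
    exact congrArg (fun f => f x) hP
  simp_rw [fun q : Amb m n × (EuclideanSpace ℝ (Fin m) →L[ℝ] Amb m n) =>
    bundleChart_range F hP' q.1 q.2]
  have h := (hF x hx _ (finrank_range hM)).2.1
  refine ContDiffAt.comp (x, M₀) (f := fun q : Amb m n × (EuclideanSpace ℝ (Fin m) →L[ℝ] Amb m n) =>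
    (q.1, (q.2 - M₀) ∘L LinearMap.toContinuousLinearMap P)) (by simpa using h) ?_
  exact contDiffAt_fst.prodMk ((contDiffAt_snd.sub contDiffAt_const).clm_comp contDiffAt_const)

/-- The derivative of an integrand in the bundle chart at `(x, π)`. -/
def planeDeriv (F : Amb m n → Submodule ℝ (Amb m n) → ℝ) (x : Amb m n)
    (π : Submodule ℝ (Amb m n)) : Amb m n × (Amb m n →L[ℝ] Amb m n) →L[ℝ] ℝ :=
  fderiv ℝ (bundleChart F π) (x, 0)

section planeDeriv

variable {F : Amb m n → Submodule ℝ (Amb m n) → ℝ} {r₀ Λ : ℝ}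

lemma bundleChart_zero (F : Amb m n → Submodule ℝ (Amb m n) → ℝ) (x : Amb m n)
    (π : Submodule ℝ (Amb m n)) : bundleChart F π (x, 0) = F x π := by
  simp [bundleChart]

lemma hasFDerivAt_bundleChart (hF : IsC2Integrand F r₀ Λ) {x : Amb m n}
    (hx : x ∈ ball (0 : Amb m n) r₀) {π : Submodule ℝ (Amb m n)} (hπ : Module.finrank ℝ π = m) :
    HasFDerivAt (bundleChart F π) (planeDeriv F x π) (x, 0) :=
  ((hF x hx π hπ).2.1.differentiableAt (by simp)).hasFDerivAt

lemma injective_id_add_smul {V : Type*} [NormedAddCommGroup V] [NormedSpace ℝ V] {X : V →L[ℝ] V}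
    {t : ℝ} (h : |t| * ‖X‖ < 1) : Function.Injective (ContinuousLinearMap.id ℝ V + t • X) := by
  refine (injective_iff_map_eq_zero _).mpr fun v hv => ?_
  have h1 : v = -(t • X v) := by
    simpa using eq_neg_of_add_eq_zero_left hv
  have h2 : ‖v‖ ≤ |t| * ‖X‖ * ‖v‖ := by
    calc ‖v‖ = ‖t • X v‖ := by rw [h1, norm_neg, ← h1]
      _ ≤ |t| * (‖X‖ * ‖v‖) := by
        rw [norm_smul, Real.norm_eq_abs]
        exact mul_le_mul_of_nonneg_left (X.le_opNorm v) (abs_nonneg t)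
      _ = _ := by ring
  by_contra hne
  have := norm_pos_iff.mpr hne
  nlinarith

/-- If X preserves π then (id + t X) π = π for small t, by injectivity and dimension, so F is
constant along this direction of the chart. -/
lemma planeDeriv_inr_eq_zero (hF : IsC2Integrand F r₀ Λ) {x : Amb m n}
    (hx : x ∈ ball (0 : Amb m n) r₀) {π : Submodule ℝ (Amb m n)} (hπ : Module.finrank ℝ π = m)
    {X : Amb m n →L[ℝ] Amb m n} (hX : ∀ v ∈ π, X v ∈ π) : planeDeriv F x π (0, X) = 0 := by
  have hl : HasDerivAt (fun t : ℝ => ((x, t • X) : Amb m n × (Amb m n →L[ℝ] Amb m n))) (0, X) 0 := by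
    refine (hasDerivAt_const _ _).prodMk ?_
    simpa using (hasDerivAt_id (0 : ℝ)).smul_const X
  have h1 := (hasFDerivAt_bundleChart hF hx hπ).comp_hasDerivAt_of_eq (0 : ℝ) hl
    (Prod.ext rfl (zero_smul ℝ X).symm)
  refine h1.unique (HasDerivAt.congr_of_eventuallyEq (hasDerivAt_const (0 : ℝ) (F x π)) ?_)
  have hsmall : ∀ᶠ t : ℝ in 𝓝 0, |t| * ‖X‖ < 1 := by
    have : Continuous fun t : ℝ => |t| * ‖X‖ := by fun_prop
    exact this.continuousAt.eventually_lt continuousAt_const (by simp)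
  filter_upwards [hsmall] with t ht
  have hinj := injective_id_add_smul ht
  simp only [Function.comp, bundleChart]
  congr 1
  refine Submodule.eq_of_le_of_finrank_eq ?_ ?_
  · rintro _ ⟨v, hv, rfl⟩
    simpa using π.add_mem hv (π.smul_mem t (hX v hv))
  · exact (LinearEquiv.finrank_eq (Submodule.equivMapOfInjective _ hinj π)).symm

/-- X and π^⊥ X π differ on π by π X, which preserves π, so the projections inside the derivative of
F can be dropped. -/
lemma bForm_eq (hF : IsC2Integrand F r₀ Λ) {x : Amb m n}
    (hx : x ∈ ball (0 : Amb m n) r₀) {π : Submodule ℝ (Amb m n)} (hπ : Module.finrank ℝ π = m)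
    (X : Amb m n →L[ℝ] Amb m n) :
    bForm F x π X = F x π * LinearMap.trace ℝ (Amb m n) (π.starProjection ∘L X).toLinearMap +
      planeDeriv F x π (0, X) := by
  have h1 : HasFDerivAt (fun X : Amb m n →L[ℝ] Amb m n => bundleChart F π (x, X))
      (planeDeriv F x π ∘L ContinuousLinearMap.inr ℝ _ _) 0 :=
    (hasFDerivAt_bundleChart hF hx hπ).comp (0 : Amb m n →L[ℝ] Amb m n)
      (hasFDerivAt_prodMk_right x 0)
  have h2 : planeDeriv F x π (0, X - πᗮ.starProjection ∘L X ∘L π.starProjection) = 0 := by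
    refine planeDeriv_inr_eq_zero hF hx hπ fun v hv => ?_
    have : π.starProjection v = v := Submodule.starProjection_eq_self_iff.mpr hv
    simp only [sub_apply, ContinuousLinearMap.comp_apply, this,
      Submodule.starProjection_orthogonal_val, sub_sub_cancel]
    exact Submodule.starProjection_apply_mem π _
  have h3 : planeDeriv F x π (0, X) =
      planeDeriv F x π (0, πᗮ.starProjection ∘L X ∘L π.starProjection) := by
    rw [← sub_eq_zero, ← map_sub, Prod.mk_sub_mk, sub_zero, h2]
  rw [h3, bForm, h1.fderiv]
  simp

end planeDeriv

/-! ### The anisotropic first variation -/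

lemma aestronglyMeasurable_comp_of_continuousOn {X Y : Type*} [MeasurableSpace X]
    [TopologicalSpace Y] [MeasurableSpace Y] [BorelSpace Y] {μ : Measure X} {f : Y → ℝ} {U : Set Y}
    (hU : IsOpen U) (hf : ContinuousOn f U) {q : X → Y} (hq : AEMeasurable q μ)
    (hqU : ∀ᵐ x ∂μ, q x ∈ U) : AEStronglyMeasurable (fun x => f (q x)) μ := by
  classical
  have h1 : Measurable (U.piecewise f fun _ => 0) :=
    hf.measurable_piecewise continuousOn_const hU.measurableSet
  refine (h1.comp_aemeasurable hq).aestronglyMeasurable.congr ?_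
  filter_upwards [hqU] with x hx
  simp [hx]

/-- Parameters of the integrand of the energy of a push-forward: a point, a velocity, its
derivative, and the slope of a graph plane. -/
abbrev Param (m n : ℕ) : Type :=
  Amb m n × Amb m n × (Amb m n →L[ℝ] Amb m n) ×
    (EuclideanSpace ℝ (Fin m) →L[ℝ] EuclideanSpace ℝ (Fin n))

/-- The map `(id + t X) ∘ M(A)`. -/
def pushMap (q : ℝ × Param m n) : EuclideanSpace ℝ (Fin m) →L[ℝ] Amb m n :=
  (ContinuousLinearMap.id ℝ (Amb m n) + q.1 • q.2.2.2.1) ∘L graphMap q.2.2.2.2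

/-- The integrand of the energy of a push-forward. -/
def pushDensity (F : Amb m n → Submodule ℝ (Amb m n) → ℝ) (q : ℝ × Param m n) : ℝ :=
  F (q.2.1 + q.1 • q.2.2.1) (LinearMap.range (pushMap q).toLinearMap) *
    ((pushMap q).toLinearMap.normDet / (graphMap q.2.2.2.2).toLinearMap.normDet)

/-- The set of admissible parameters. -/
def pushDomain (m n : ℕ) (r₀ : ℝ) : Set (ℝ × Param m n) :=
  {q | q.2.1 + q.1 • q.2.2.1 ∈ ball (0 : Amb m n) r₀ ∧ Function.Injective (pushMap q)}

lemma contDiff_graphMap {k : WithTop ℕ∞} : ContDiff ℝ k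
    (graphMap : (EuclideanSpace ℝ (Fin m) →L[ℝ] EuclideanSpace ℝ (Fin n)) → _) := by
  have : (graphMap : (EuclideanSpace ℝ (Fin m) →L[ℝ] EuclideanSpace ℝ (Fin n)) → _) =
      fun L => graphMap 0 + inrL ∘L L := funext graphMap_eq
  rw [this]
  exact contDiff_const.add (contDiff_const.clm_comp contDiff_id)

lemma contDiff_pushMap {k : WithTop ℕ∞} : ContDiff ℝ k (pushMap (m := m) (n := n)) := by
  unfold pushMap
  have h : ContDiff ℝ k (fun q : ℝ × Param m n => q.1 • q.2.2.2.1) :=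
    contDiff_fst.smul (contDiff_fst.comp (contDiff_snd.comp (contDiff_snd.comp contDiff_snd)))
  exact (contDiff_const.add h).clm_comp (contDiff_graphMap.comp
    (contDiff_snd.comp (contDiff_snd.comp (contDiff_snd.comp contDiff_snd))))

lemma isOpen_pushDomain (r₀ : ℝ) : IsOpen (pushDomain m n r₀) := by
  refine IsOpen.inter (isOpen_ball.preimage (by fun_prop)) ?_
  exact (ContinuousLinearMap.isOpen_injective (𝕜 := ℝ) (E := EuclideanSpace ℝ (Fin m))
    (F := Amb m n)).preimage (contDiff_pushMap (k := 0)).continuous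

lemma normDet_graphMap_ne_zero (A : EuclideanSpace ℝ (Fin m) →L[ℝ] EuclideanSpace ℝ (Fin n)) :
    (graphMap A).toLinearMap.normDet ≠ 0 := by
  have h2 : (graphMap A).toLinearMap.normDet ≠ 0 ↔ Function.Injective (graphMap A).toLinearMap :=
      (LinearMap.normDet_ne_zero_tfae (graphMap A).toLinearMap).out 0 4
  exact h2.mpr (graphMap_injective A)

section

variable {F : Amb m n → Submodule ℝ (Amb m n) → ℝ} {r₀ Λ : ℝ}

lemma contDiffOn_pushDensity (hF : IsC2Integrand F r₀ Λ) :
    ContDiffOn ℝ 2 (pushDensity F) (pushDomain m n r₀) := by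
  intro q hq
  refine ContDiffAt.contDiffWithinAt ?_
  refine ContDiffAt.mul ?_ (ContDiffAt.div ?_ ?_ (normDet_graphMap_ne_zero _))
  · exact (contDiffAt_range hF hq.1 hq.2).comp q
      (f := fun q : ℝ × Param m n => (q.2.1 + q.1 • q.2.2.1, pushMap q))
      (ContDiffAt.prodMk (by fun_prop) contDiff_pushMap.contDiffAt)
  · exact (contDiffAt_normDet hq.2).comp q contDiff_pushMap.contDiffAt
  · refine (contDiffAt_normDet (graphMap_injective q.2.2.2.2)).comp q
      (f := fun q : ℝ × Param m n => graphMap q.2.2.2.2) ?_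
    exact (contDiff_graphMap.comp (by fun_prop)).contDiffAt

/-- Multiplicativity of `normDet` turns the quotient of the two determinants into the Jacobian on
the graph plane. The quotient form depends visibly smoothly on all parameters; this form is the
integrand of the energy. -/
lemma pushDensity_eq (F : Amb m n → Submodule ℝ (Amb m n) → ℝ) (t : ℝ) (x v : Amb m n)
    (X : Amb m n →L[ℝ] Amb m n) (A : EuclideanSpace ℝ (Fin m) →L[ℝ] EuclideanSpace ℝ (Fin n)) :
    pushDensity F (t, x, v, X, A) =
      bundleChart F (graphPlane A) (x + t • v, t • X) *
        jacobian (ContinuousLinearMap.id ℝ (Amb m n) + t • X) (graphPlane A) := by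
  have h1 := jacobian_range_mul (ContinuousLinearMap.id ℝ (Amb m n) + t • X) (graphMap A)
  have h2 := normDet_graphMap_ne_zero A
  simp only [pushDensity, pushMap, ← h1, mul_div_cancel_right₀ _ h2, bundleChart]
  rw [ContinuousLinearMap.toLinearMap_comp, LinearMap.range_comp]
  rfl

lemma jacobian_id (π : Submodule ℝ (Amb m n)) :
    jacobian (ContinuousLinearMap.id ℝ (Amb m n)) π = 1 := by
  rw [jacobian_eq_normDet]
  exact LinearMap.normDet_subtype _

lemma pushDensity_zero (F : Amb m n → Submodule ℝ (Amb m n) → ℝ) (x v : Amb m n)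
    (X : Amb m n →L[ℝ] Amb m n) (A : EuclideanSpace ℝ (Fin m) →L[ℝ] EuclideanSpace ℝ (Fin n)) :
    pushDensity F (0, x, v, X, A) = F x (graphPlane A) := by
  have hz : (0 : ℝ) • X = 0 := zero_smul ℝ X
  rw [pushDensity_eq, hz, zero_smul, add_zero, add_zero, jacobian_id, bundleChart_zero, mul_one]

/-- The integrand of the anisotropic first variation. -/
def variationDensity (F : Amb m n → Submodule ℝ (Amb m n) → ℝ) (x : Amb m n)
    (π : Submodule ℝ (Amb m n)) (v : Amb m n) (X : Amb m n →L[ℝ] Amb m n) : ℝ :=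
  planeDeriv F x π (v, 0) + bForm F x π X

lemma hasDerivAt_pushDensity (hF : IsC2Integrand F r₀ Λ) {x : Amb m n}
    (hx : x ∈ ball (0 : Amb m n) r₀) (v : Amb m n) (X : Amb m n →L[ℝ] Amb m n)
    (A : EuclideanSpace ℝ (Fin m) →L[ℝ] EuclideanSpace ℝ (Fin n)) :
    HasDerivAt (fun t : ℝ => pushDensity F (t, x, v, X, A))
      (variationDensity F x (graphPlane A) v X) 0 := by
  simp_rw [pushDensity_eq]
  have hl : HasDerivAt (fun t : ℝ => ((x + t • v, t • X) : Amb m n × (Amb m n →L[ℝ] Amb m n)))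
      (v, X) 0 := by
    refine HasDerivAt.prodMk ?_ ?_
    · simpa using ((hasDerivAt_id (0 : ℝ)).smul_const v).const_add x
    · simpa using (hasDerivAt_id (0 : ℝ)).smul_const X
  have h1 := (hasFDerivAt_bundleChart hF hx (finrank_graphPlane A)).comp_hasDerivAt_of_eq
    (0 : ℝ) hl (Prod.ext (by simp) (zero_smul ℝ X).symm)
  have h2 := h1.mul (hasDerivAt_jacobian (graphPlane A) X)
  refine h2.congr_deriv ?_
  have hs : planeDeriv F x (graphPlane A) (v, X) =
      planeDeriv F x (graphPlane A) (v, 0) + planeDeriv F x (graphPlane A) (0, X) := by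
    rw [← map_add]; simp
  have hz : (0 : ℝ) • X = 0 := zero_smul ℝ X
  simp only [Function.comp, hz, zero_smul, add_zero, jacobian_id, mul_one, bundleChart_zero,
    variationDensity, bForm_eq hF hx (finrank_graphPlane A), hs]
  ring

/-- Differentiation under the integral sign. Over the support of g the parameters (z, g, Dg, A) stay
in a compact set, where the t-derivative of the density is bounded for small t; off the support the
density does not depend on t. -/
theorem hasFirstVariation (hF : IsC2Integrand F r₀ Λ) {μ : Measure (Amb m n)} [IsFiniteMeasure μ]
    (hμ : ∀ᵐ z ∂μ, z ∈ ball (0 : Amb m n) r₀)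
    {A : Amb m n → (EuclideanSpace ℝ (Fin m) →L[ℝ] EuclideanSpace ℝ (Fin n))}
    (hA : Measurable A) {ℓ : ℝ} (hAℓ : ∀ᵐ z ∂μ, ‖A z‖ ≤ ℓ) {g : Amb m n → Amb m n}
    (hg : ContDiff ℝ 1 g) (hgc : HasCompactSupport g) (hgs : tsupport g ⊆ ball 0 r₀) :
    Integrable (fun z => variationDensity F z (graphPlane (A z)) (g z) (fderiv ℝ g z)) μ ∧
      HasFirstVariation F μ (fun z => graphPlane (A z)) g
        (∫ z, variationDensity F z (graphPlane (A z)) (g z) (fderiv ℝ g z) ∂μ) := by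
  have hg' : Continuous (fderiv ℝ g) := hg.continuous_fderiv (by simp)
  obtain ⟨C₁, hC₁⟩ := hgc.isCompact.exists_bound_of_continuousOn hg.continuous.continuousOn
  obtain ⟨C₂, hC₂⟩ := hgc.isCompact.exists_bound_of_continuousOn hg'.continuousOn
  let Q : Set (Param m n) :=
    tsupport g ×ˢ closedBall 0 C₁ ×ˢ closedBall 0 C₂ ×ˢ closedBall 0 ℓ
  have hQ : IsCompact Q := hgc.isCompact.prod ((isCompact_closedBall 0 C₁).prod
    ((isCompact_closedBall 0 C₂).prod (isCompact_closedBall 0 ℓ)))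
  have h0Q : ({0} : Set ℝ) ×ˢ Q ⊆ pushDomain m n r₀ := by
    rintro ⟨t, x, v, X, A⟩ ⟨ht, hx, -⟩
    obtain rfl : t = 0 := ht
    refine ⟨by simpa using hgs hx, ?_⟩
    have hz : (0 : ℝ) • X = 0 := zero_smul ℝ X
    simpa [pushMap, hz] using graphMap_injective A
  -- The tube lemma gives one interval of times t that is admissible for all parameters in the
  -- compact set Q at once.
  obtain ⟨u, v, hu, -, h0u, hQv, huv⟩ :=
    generalized_tube_lemma isCompact_singleton hQ (isOpen_pushDomain r₀) h0Q
  obtain ⟨δ, hδ, hδu⟩ := Metric.isOpen_iff.mp hu 0 (h0u rfl)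
  set s : Set ℝ := closedBall 0 (δ / 2)
  have hsu : s ⊆ u := (closedBall_subset_ball (by linarith)).trans hδu
  have hsQ : s ×ˢ Q ⊆ pushDomain m n r₀ := (prod_mono hsu hQv).trans huv
  have hW : ContDiffOn ℝ 2 (pushDensity F) (pushDomain m n r₀) := contDiffOn_pushDensity hF
  have hWat : ∀ q ∈ pushDomain m n r₀, ContDiffAt ℝ 2 (pushDensity F) q := fun q hq =>
    hW.contDiffAt ((isOpen_pushDomain r₀).mem_nhds hq)
  have hDW : ContinuousOn (fun q => fderiv ℝ (pushDensity F) q (1, 0)) (pushDomain m n r₀) := by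
    have := hW.continuousOn_fderiv_of_isOpen (isOpen_pushDomain r₀) (by norm_num)
    exact this.clm_apply continuousOn_const
  obtain ⟨B, hB⟩ := ((isCompact_closedBall (0 : ℝ) (δ / 2)).prod hQ).exists_bound_of_continuousOn
    (hDW.mono hsQ)
  let q : Amb m n → Param m n := fun z => (z, g z, fderiv ℝ g z, A z)
  have hq : Measurable q := measurable_id.prodMk (hg.continuous.measurable.prodMk
    (hg'.measurable.prodMk hA))
  have hzero : ∀ z ∉ tsupport g, g z = 0 ∧ fderiv ℝ g z = 0 := fun z hz =>
    ⟨image_eq_zero_of_notMem_tsupport hz,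
      image_eq_zero_of_notMem_tsupport fun h => hz (tsupport_fderiv_subset ℝ h)⟩
  have hqQ : ∀ z, z ∈ tsupport g → ‖A z‖ ≤ ℓ → q z ∈ Q := fun z hz hAz =>
    ⟨hz, by simpa using hC₁ z hz, by simpa using hC₂ z hz, by simpa using hAz⟩
  have hqU : ∀ t ∈ s, ∀ᵐ z ∂μ, (t, q z) ∈ pushDomain m n r₀ := by
    intro t ht
    filter_upwards [hμ, hAℓ] with z hz hAz
    by_cases hzs : z ∈ tsupport g
    · exact hsQ ⟨ht, hqQ z hzs hAz⟩
    · obtain ⟨h1, h2⟩ := hzero z hzs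
      refine ⟨by simpa [q, h1] using hz, ?_⟩
      simpa [q, pushMap, h2] using graphMap_injective (A z)
  have : BorelSpace (ℝ × Param m n) := Prod.borelSpace
  have hmeas : ∀ f : ℝ × Param m n → ℝ, ContinuousOn f (pushDomain m n r₀) → ∀ t ∈ s,
      AEStronglyMeasurable (fun z => f (t, q z)) μ := fun f hf t ht =>
    aestronglyMeasurable_comp_of_continuousOn (isOpen_pushDomain r₀) hf
      (measurable_const.prodMk hq).aemeasurable (hqU t ht)
  have h0s : (0 : ℝ) ∈ s := mem_closedBall_self (by positivity)
  have hderiv : ∀ t z, (t, q z) ∈ pushDomain m n r₀ →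
      HasDerivAt (fun t => pushDensity F (t, q z)) (fderiv ℝ (pushDensity F) (t, q z) (1, 0)) t := by
    intro t z htz
    have h1 := ((hWat _ htz).differentiableAt (by simp)).hasFDerivAt
    exact h1.comp_hasDerivAt t ((hasDerivAt_id t).prodMk (hasDerivAt_const t (q z)))
  have hfd : ∀ (t : ℝ) (z : Amb m n), fderiv ℝ (fun z => z + t • g z) z =
      ContinuousLinearMap.id ℝ (Amb m n) + t • fderiv ℝ g z := by
    intro t z
    have hgd : DifferentiableAt ℝ g z := hg.differentiable (by simp) z
    exact ((hasFDerivAt_id z).add (hgd.hasFDerivAt.const_smul t)).fderiv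
  have hpe : ∀ t : ℝ, pushEnergy F μ (fun z => graphPlane (A z)) (fun z => z + t • g z) =
      ∫ z, pushDensity F (t, q z) ∂μ := by
    intro t
    refine integral_congr_ae (Filter.Eventually.of_forall fun z => ?_)
    simp only [hfd, q, pushDensity_eq]
    rfl
  have hval : ∀ᵐ z ∂μ, fderiv ℝ (pushDensity F) (0, q z) (1, 0) =
      variationDensity F z (graphPlane (A z)) (g z) (fderiv ℝ g z) := by
    filter_upwards [hμ, hqU 0 h0s] with z hz hz2
    exact (hderiv 0 z hz2).unique (hasDerivAt_pushDensity hF hz (g z) (fderiv ℝ g z) (A z))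
  have hmain := hasDerivAt_integral_of_dominated_loc_of_deriv_le (μ := μ)
    (F := fun t z => pushDensity F (t, q z))
    (F' := fun t z => fderiv ℝ (pushDensity F) (t, q z) (1, 0)) (bound := fun _ => |B|)
    (closedBall_mem_nhds (0 : ℝ) (half_pos hδ))
    (Filter.eventually_of_mem (closedBall_mem_nhds (0 : ℝ) (half_pos hδ))
      (hmeas _ hW.continuousOn)) ?_ (hmeas _ hDW 0 h0s) ?_ (integrable_const _) ?_
  · refine ⟨hmain.1.congr hval, ?_⟩
    have := hmain.2
    rw [integral_congr_ae hval] at this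
    unfold HasFirstVariation
    simp_rw [hpe]
    exact this
  · refine Integrable.mono' (integrable_const Λ) (hmeas _ hW.continuousOn 0 h0s) ?_
    filter_upwards [hμ] with z hz
    have h2 := (hF z hz _ (finrank_graphPlane (A z))).2.2 0 (by norm_num)
    rw [norm_iteratedFDeriv_zero, bundleChart_zero] at h2
    simpa only [q, pushDensity_zero] using h2
  · filter_upwards [hμ, hAℓ] with z hz hAz t ht
    by_cases hzs : z ∈ tsupport g
    · exact (hB _ ⟨ht, hqQ z hzs hAz⟩).trans (le_abs_self B)
    · obtain ⟨h1, h2⟩ := hzero z hzs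
      have h3 : (t, q z) ∈ pushDomain m n r₀ := by
        refine ⟨by simpa [q, h1] using hz, ?_⟩
        simpa [q, pushMap, h2] using graphMap_injective (A z)
      have h4 : ∀ t, pushDensity F (t, q z) = pushDensity F (0, q z) := by
        intro t
        simp [pushDensity, pushMap, q, h1, h2]
      have h5 := hderiv t z h3
      simp_rw [h4] at h5
      rw [h5.unique (hasDerivAt_const _ _), norm_zero]
      exact abs_nonneg B
  · filter_upwards [hμ, hAℓ] with z hz hAz t ht
    refine hderiv t z ?_
    by_cases hzs : z ∈ tsupport g
    · exact hsQ ⟨ht, hqQ z hzs hAz⟩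
    · obtain ⟨h1, h2⟩ := hzero z hzs
      refine ⟨by simpa [q, h1] using hz, ?_⟩
      simpa [q, pushMap, h2] using graphMap_injective (A z)

end

/-! ### The geometry of graph planes -/

section Projection

variable {V : Type*} [NormedAddCommGroup V] [InnerProductSpace ℝ V] [FiniteDimensional ℝ V]

lemma norm_starProjection_apply_le' (U : Submodule ℝ V) (x : V) : ‖U.starProjection x‖ ≤ ‖x‖ := by
  simpa using (U.starProjection.le_opNorm x).trans
    (mul_le_mul_of_nonneg_right U.starProjection_norm_le (norm_nonneg x))

lemma norm_starProjection_orthogonal_le {U : Submodule ℝ V} {w : V} (hw : w ∈ U) (x : V) :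
    ‖Uᗮ.starProjection x‖ ≤ ‖x - w‖ := by
  have h : Uᗮ.starProjection x = Uᗮ.starProjection (x - w) := by
    have : U.starProjection w = w := Submodule.starProjection_eq_self_iff.mpr hw
    simp [Submodule.starProjection_orthogonal_val, this]
  rw [h]
  exact norm_starProjection_apply_le' _ _

/-- The difference of the projections is U W^⊥ - U^⊥ W. The second hypothesis bounds U^⊥ W, and the
first bounds W^⊥ U, whose adjoint is U W^⊥. -/
lemma norm_starProjection_sub_le {U W : Submodule ℝ V} {τ : ℝ} (hτ : 0 ≤ τ)
    (hU : ∀ x ∈ U, ‖Wᗮ.starProjection x‖ ≤ τ * ‖x‖)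
    (hW : ∀ x ∈ W, ‖Uᗮ.starProjection x‖ ≤ τ * ‖x‖) :
    ‖U.starProjection - W.starProjection‖ ≤ 2 * τ := by
  refine ContinuousLinearMap.opNorm_le_bound _ (by positivity) fun x => ?_
  have h1 : (U.starProjection - W.starProjection) x =
      U.starProjection (Wᗮ.starProjection x) - Uᗮ.starProjection (W.starProjection x) := by
    simp [Submodule.starProjection_orthogonal_val]
  have h2 : ‖Uᗮ.starProjection (W.starProjection x)‖ ≤ τ * ‖x‖ :=
    (hW _ (W.starProjection_apply_mem x)).trans
      (mul_le_mul_of_nonneg_left (norm_starProjection_apply_le' W x) hτ)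
  have h3 : ‖U.starProjection (Wᗮ.starProjection x)‖ ≤ τ * ‖x‖ := by
    set y := U.starProjection (Wᗮ.starProjection x) with hy
    have hyU : y ∈ U := U.starProjection_apply_mem _
    have e1 : ‖y‖ ^ 2 = inner ℝ (Wᗮ.starProjection y) x := by
      rw [← real_inner_self_eq_norm_sq]
      nth_rewrite 2 [hy]
      rw [← Submodule.inner_starProjection_left_eq_right,
        Submodule.starProjection_eq_self_iff.mpr hyU, ← Submodule.inner_starProjection_left_eq_right]
    have e2 : ‖y‖ ^ 2 ≤ τ * ‖y‖ * ‖x‖ := by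
      rw [e1]
      exact (real_inner_le_norm _ _).trans
        (mul_le_mul_of_nonneg_right (hU y hyU) (norm_nonneg _))
    by_contra hlt
    push Not at hlt
    have : 0 < ‖y‖ := lt_of_le_of_lt (by positivity) hlt
    nlinarith
  rw [h1]
  refine (norm_sub_le _ _).trans ?_
  linarith

lemma abs_trace_le (X : V →L[ℝ] V) :
    |LinearMap.trace ℝ V X.toLinearMap| ≤ Module.finrank ℝ V * ‖X‖ := by
  rw [LinearMap.trace_eq_sum_inner _ (stdOrthonormalBasis ℝ V)]
  refine (Finset.abs_sum_le_sum_abs _ _).trans ?_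
  refine (Finset.sum_le_card_nsmul _ _ ‖X‖ fun i _ => ?_).trans (by simp)
  refine (abs_real_inner_le_norm _ _).trans ?_
  simpa using X.le_opNorm (stdOrthonormalBasis ℝ V i)

end Projection

lemma opNorm_sq_le_planeDistSq (π σ : Submodule ℝ (Amb m n)) :
    ‖π.starProjection - σ.starProjection‖ ^ 2 ≤ planeDistSq π σ := by
  have h0 : 0 ≤ planeDistSq π σ :=
    Finset.sum_nonneg fun i _ => Finset.sum_nonneg fun j _ => sq_nonneg _
  rw [← Real.sq_sqrt h0]
  refine pow_le_pow_left₀ (norm_nonneg _) ?_ 2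
  refine ContinuousLinearMap.opNorm_le_bound _ (Real.sqrt_nonneg _) fun v => ?_
  refine (sq_le_sq₀ (norm_nonneg _) (by positivity)).mp ?_
  rw [mul_pow, Real.sq_sqrt h0]
  set X := π.starProjection - σ.starProjection
  have hv : v = ∑ j, v j • EuclideanSpace.single j (1 : ℝ) := by
    have := (EuclideanSpace.basisFun (Fin m ⊕ Fin n) ℝ).sum_repr v
    simpa using this.symm
  have hcoord : ∀ i, (X v) i = ∑ j, v j *
      inner ℝ (EuclideanSpace.single i (1 : ℝ)) (X (EuclideanSpace.single j (1 : ℝ))) := by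
    intro i
    have : (X v) i = inner ℝ (EuclideanSpace.single i (1 : ℝ)) (X v) := by
      simp [EuclideanSpace.inner_single_left]
    rw [this]
    conv_lhs => rw [hv]
    rw [map_sum, inner_sum]
    simp [inner_smul_right]
  rw [EuclideanSpace.norm_sq_eq (X v), planeDistSq, Finset.sum_mul]
  refine Finset.sum_le_sum fun i _ => ?_
  rw [Real.norm_eq_abs, sq_abs, hcoord, EuclideanSpace.norm_sq_eq v, mul_comm]
  refine (Finset.sum_mul_sq_le_sq_mul_sq _ _ _).trans (le_of_eq ?_)
  simp only [Real.norm_eq_abs, sq_abs]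
  rfl

lemma norm_starProjection_sub_apply_le (π σ : Submodule ℝ (Amb m n)) (x : Amb m n) :
    ‖π.starProjection x - σ.starProjection x‖ ≤ planeDist π σ * ‖x‖ := by
  have h : ‖π.starProjection - σ.starProjection‖ ≤ planeDist π σ :=
    Real.le_sqrt_of_sq_le (opNorm_sq_le_planeDistSq π σ)
  exact ((π.starProjection - σ.starProjection).le_opNorm x).trans
    (mul_le_mul_of_nonneg_right h (norm_nonneg x))

section Chart

variable {X : Type*} [NormedAddCommGroup X] [NormedSpace ℝ X]

lemma abs_fderiv_fderiv_apply_le (c : X → ℝ) (q a b : X) :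
    |fderiv ℝ (fderiv ℝ c) q a b| ≤ ‖iteratedFDeriv ℝ 2 c q‖ * ‖a‖ * ‖b‖ := by
  rw [show (2 : ℕ) = 1 + 1 from rfl, ← norm_iteratedFDeriv_fderiv, norm_iteratedFDeriv_one]
  exact ContinuousLinearMap.le_opNorm₂ (fderiv ℝ (fderiv ℝ c) q) a b

/-- This differentiates the gradient of a chart under a change of chart. Because T p = 0, the
gradient is evaluated at p + h w and composed with id + h T: the moving point produces the second
derivative of c, the inner map the term with T. -/
lemma hasDerivAt_fderiv_comp_shift {c : X → ℝ} {p : X} (hc : ContDiffAt ℝ 2 c p)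
    {T : X →L[ℝ] X} (hT : T p = 0) (w y : X) :
    HasDerivAt (fun h : ℝ => fderiv ℝ (fun q => c (q + h • T q + h • w)) p y)
      (fderiv ℝ (fderiv ℝ c) p w y + fderiv ℝ c p (T y)) 0 := by
  have hl : HasDerivAt (fun h : ℝ => p + h • w) w 0 := by
    simpa using ((hasDerivAt_id (0 : ℝ)).smul_const w).const_add p
  have hr : HasDerivAt (fun h : ℝ => y + h • T y) (T y) 0 := by
    simpa using ((hasDerivAt_id (0 : ℝ)).smul_const (T y)).const_add y
  have hdd : HasFDerivAt (fderiv ℝ c) (fderiv ℝ (fderiv ℝ c) p) p :=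
    ((hc.fderiv_right (m := 1) (by norm_num)).differentiableAt (by simp)).hasFDerivAt
  have h1 := (hdd.comp_hasDerivAt_of_eq (0 : ℝ) hl (by simp)).clm_apply hr
  simp only [Function.comp, zero_smul, add_zero] at h1
  refine h1.congr_of_eventuallyEq ?_
  have hdiff : ∀ᶠ h : ℝ in 𝓝 0, DifferentiableAt ℝ c (p + h • w) := by
    have h2 : ∀ᶠ q in 𝓝 p, DifferentiableAt ℝ c q :=
      (hc.eventually (by simp)).mono fun q hq => hq.differentiableAt (by simp)
    have h3 : Filter.Tendsto (fun h : ℝ => p + h • w) (𝓝 0) (𝓝 p) := by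
      simpa using hl.continuousAt.tendsto
    exact h3.eventually h2
  filter_upwards [hdiff] with h hh
  have hinner : HasFDerivAt (fun q : X => q + h • T q + h • w)
      (ContinuousLinearMap.id ℝ X + h • T) p :=
    ((hasFDerivAt_id p).add (T.hasFDerivAt.const_smul h)).add_const (h • w)
  have hh' : DifferentiableAt ℝ c (p + h • T p + h • w) := by simpa [hT] using hh
  have h4 := (hh'.hasFDerivAt.comp p hinner).fderiv
  simp only [Function.comp_def] at h4
  rw [h4, hT]
  simp

end Chart

/-! ### Distances of graph planes and differences of slopes -/

section graphPlane

variable (A L : EuclideanSpace ℝ (Fin m) →L[ℝ] EuclideanSpace ℝ (Fin n))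

lemma norm_orthogonal_graphPlane_le {x : Amb m n} (hx : x ∈ graphPlane A) :
    ‖(graphPlane L)ᗮ.starProjection x‖ ≤ ‖A - L‖ * ‖x‖ := by
  obtain ⟨v, rfl⟩ := hx
  refine (norm_starProjection_orthogonal_le (U := graphPlane L) (w := graphMap L v) ⟨v, rfl⟩ _).trans ?_
  have h : ‖(graphMap A).toLinearMap v - graphMap L v‖ = ‖(A - L) v‖ := by
    simp [pair_sub_pair, norm_pair_zero]
  rw [h]
  refine ((A - L).le_opNorm v).trans (mul_le_mul_of_nonneg_left ?_ (norm_nonneg _))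
  exact norm_le_norm_pair_left v (A v)

lemma norm_starProjection_graphPlane_sub_le :
    ‖(graphPlane A).starProjection - (graphPlane L).starProjection‖ ≤ 2 * ‖A - L‖ :=
  norm_starProjection_sub_le (norm_nonneg _) (fun _ hx => norm_orthogonal_graphPlane_le A L hx)
    fun _ hx => by rw [norm_sub_rev]; exact norm_orthogonal_graphPlane_le L A hx

/-- If M(L)x is the projection of (0, w) to the graph plane, its normal part is (-x, w - Lx); both
components are controlled by the norm of that part, and w = (w - Lx) + Lx. -/
lemma norm_le_norm_orthogonal_graphPlane (w : EuclideanSpace ℝ (Fin n)) :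
    ‖w‖ ≤ (1 + ‖L‖) * ‖(graphPlane L)ᗮ.starProjection (pair 0 w : Amb m n)‖ := by
  obtain ⟨x, hx⟩ := (graphPlane L).starProjection_apply_mem (pair 0 w : Amb m n)
  have h : (graphPlane L)ᗮ.starProjection (pair 0 w : Amb m n) = pair (0 - x) (w - L x) := by
    rw [Submodule.starProjection_orthogonal_val, ← hx, ← pair_sub_pair]
    rfl
  rw [h]
  set q := ‖(pair (0 - x) (w - L x) : Amb m n)‖ with hq
  have hs := norm_pair_sq (0 - x) (w - L x)
  rw [← hq] at hs
  have hq0 : 0 ≤ q := norm_nonneg _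
  have h1 : ‖x‖ ≤ q := by
    refine (sq_le_sq₀ (norm_nonneg _) hq0).mp ?_
    rw [hs, zero_sub, norm_neg]
    exact le_add_of_nonneg_right (sq_nonneg _)
  have h2 : ‖w - L x‖ ≤ q := by
    refine (sq_le_sq₀ (norm_nonneg _) hq0).mp ?_
    rw [hs]
    exact le_add_of_nonneg_left (sq_nonneg _)
  calc ‖w‖ = ‖(w - L x) + L x‖ := by rw [sub_add_cancel]
    _ ≤ ‖w - L x‖ + ‖L x‖ := norm_add_le _ _
    _ ≤ q + ‖L‖ * q := add_le_add h2
        ((L.le_opNorm x).trans (mul_le_mul_of_nonneg_left h1 (norm_nonneg _)))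
    _ = _ := by ring

lemma norm_graphMap_apply_le (v : EuclideanSpace ℝ (Fin m)) :
    ‖graphMap A v‖ ≤ (1 + ‖A‖) * ‖v‖ := by
  refine (norm_pair_le v (A v)).trans ?_
  linarith [A.le_opNorm v]

/-- The vertical vector (0, (A - L)v) is M(A)v - M(L)v. Its component normal to the plane of L is
the difference of the two projections applied to M(A)v, because each projection fixes its own graph.
-/
lemma norm_sub_le_planeDist :
    ‖A - L‖ ≤ (1 + ‖L‖) * (1 + ‖A‖) * planeDist (graphPlane A) (graphPlane L) := by
  have hd : 0 ≤ planeDist (graphPlane A) (graphPlane L) := Real.sqrt_nonneg _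
  refine ContinuousLinearMap.opNorm_le_bound _ (by positivity) fun v => ?_
  have h1 := norm_le_norm_orthogonal_graphPlane L ((A - L) v)
  have h2 : (graphPlane L)ᗮ.starProjection (pair 0 ((A - L) v) : Amb m n) =
      (graphPlane A).starProjection (graphMap A v) -
        (graphPlane L).starProjection (graphMap A v) := by
    have e1 : (graphPlane A).starProjection (graphMap A v) = graphMap A v :=
      Submodule.starProjection_eq_self_iff.mpr ⟨v, rfl⟩
    have e2 : (graphPlane L).starProjection (graphMap L v) = graphMap L v :=
      Submodule.starProjection_eq_self_iff.mpr ⟨v, rfl⟩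
    have e3 : (pair 0 ((A - L) v) : Amb m n) = graphMap A v - graphMap L v := by
      simp [pair_sub_pair]
    rw [e3, Submodule.starProjection_orthogonal_val, map_sub, e2, e1]
    abel
  rw [h2] at h1
  have h3 := norm_starProjection_sub_apply_le (graphPlane A) (graphPlane L) (graphMap A v)
  have h4 := norm_graphMap_apply_le A v
  calc ‖(A - L) v‖ ≤ (1 + ‖L‖) * (planeDist (graphPlane A) (graphPlane L) *
        ((1 + ‖A‖) * ‖v‖)) := h1.trans (mul_le_mul_of_nonneg_left
          (h3.trans (mul_le_mul_of_nonneg_left h4 hd)) (by positivity))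
    _ = _ := by ring

end graphPlane

/-! ### Dependence of the integrand on the plane -/

/-- The nilpotent endomorphism `(x, y) ↦ (0, D x)`. -/
def shear (D : EuclideanSpace ℝ (Fin m) →L[ℝ] EuclideanSpace ℝ (Fin n)) :
    Amb m n →L[ℝ] Amb m n := inrL ∘L D ∘L baseL

lemma norm_shear_le (D : EuclideanSpace ℝ (Fin m) →L[ℝ] EuclideanSpace ℝ (Fin n)) :
    ‖shear D‖ ≤ ‖D‖ := by
  refine ContinuousLinearMap.opNorm_le_bound _ (norm_nonneg _) fun z => ?_
  have : ‖shear D z‖ = ‖D (base z)‖ := by simp [shear, norm_pair_zero]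
  rw [this]
  exact (D.le_opNorm _).trans (mul_le_mul_of_nonneg_left (norm_base_le z) (norm_nonneg _))

lemma shear_smul (h : ℝ) (D : EuclideanSpace ℝ (Fin m) →L[ℝ] EuclideanSpace ℝ (Fin n)) :
    shear (h • D) = h • shear D := by
  ext z i
  cases i <;> simp [shear, pair]

/-- Derivatives of an integrand are known and bounded only at the centre of the chart of each plane.
Recentring at every slope of the segment makes the mean value inequality available. -/
lemma hasDerivAt_along_segment {f : (EuclideanSpace ℝ (Fin m) →L[ℝ] EuclideanSpace ℝ (Fin n)) → ℝ}
    {L D : EuclideanSpace ℝ (Fin m) →L[ℝ] EuclideanSpace ℝ (Fin n)} {s d : ℝ}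
    (h : HasDerivAt (fun h : ℝ => f (L + s • D + h • D)) d 0) :
    HasDerivAt (fun s : ℝ => f (L + s • D)) d s := by
  have h2 := HasDerivAt.comp_sub_const s s (by rwa [sub_self])
  refine h2.congr_of_eventuallyEq (Filter.Eventually.of_forall fun t => ?_)
  have : L + t • D = L + s • D + (t - s) • D := by
    ext v i
    simp
    ring
  simp only [this]

lemma segment_endpoints (A L : EuclideanSpace ℝ (Fin m) →L[ℝ] EuclideanSpace ℝ (Fin n)) :
    L + (1 : ℝ) • (A - L) = A ∧ L + (0 : ℝ) • (A - L) = L := by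
  constructor <;> ext v i <;> simp

/-- M(L + D) = (id + shear D) M(L), so moving the reference plane composes the chart with X ↦ (id +
X)(id + shear D) - id. -/
lemma bundleChart_graphPlane_add (F : Amb m n → Submodule ℝ (Amb m n) → ℝ) (y : Amb m n)
    (X : Amb m n →L[ℝ] Amb m n)
    (L D : EuclideanSpace ℝ (Fin m) →L[ℝ] EuclideanSpace ℝ (Fin n)) :
    bundleChart F (graphPlane (L + D)) (y, X) =
      bundleChart F (graphPlane L) (y, X + shear D + X ∘L shear D) := by
  have h : (ContinuousLinearMap.id ℝ (Amb m n) + X) ∘L graphMap (L + D) =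
      (ContinuousLinearMap.id ℝ (Amb m n) + (X + shear D + X ∘L shear D)) ∘L graphMap L := by
    have e : ∀ v, graphMap (L + D) v = graphMap L v + shear D (graphMap L v) := by
      intro v
      ext i
      cases i <;> simp [shear, base, pair]
    ext1 v
    simp only [ContinuousLinearMap.comp_apply, add_apply, ContinuousLinearMap.id_apply, e, map_add]
    abel
  simp only [bundleChart, graphPlane]
  rw [← LinearMap.range_comp, ← LinearMap.range_comp, ← ContinuousLinearMap.toLinearMap_comp,
    ← ContinuousLinearMap.toLinearMap_comp, h]

section

variable {F : Amb m n → Submodule ℝ (Amb m n) → ℝ} {r₀ Λ : ℝ}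

lemma abs_integrand_le (hF : IsC2Integrand F r₀ Λ) {x : Amb m n}
    (hx : x ∈ ball (0 : Amb m n) r₀) {π : Submodule ℝ (Amb m n)} (hπ : Module.finrank ℝ π = m) :
    |F x π| ≤ Λ := by
  have h := (hF x hx π hπ).2.2 0 (by norm_num)
  rwa [norm_iteratedFDeriv_zero, bundleChart_zero] at h

lemma norm_planeDeriv_le (hF : IsC2Integrand F r₀ Λ) {x : Amb m n}
    (hx : x ∈ ball (0 : Amb m n) r₀) {π : Submodule ℝ (Amb m n)} (hπ : Module.finrank ℝ π = m) :
    ‖planeDeriv F x π‖ ≤ Λ := by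
  have h := (hF x hx π hπ).2.2 1 (by norm_num)
  rwa [norm_iteratedFDeriv_one] at h

lemma norm_zero_pair (X : Amb m n →L[ℝ] Amb m n) :
    ‖((0, X) : Amb m n × (Amb m n →L[ℝ] Amb m n))‖ = ‖X‖ := by
  simp [Prod.norm_def]

lemma abs_planeDeriv_inr_le (hF : IsC2Integrand F r₀ Λ) {x : Amb m n}
    (hx : x ∈ ball (0 : Amb m n) r₀) {π : Submodule ℝ (Amb m n)} (hπ : Module.finrank ℝ π = m)
    (X : Amb m n →L[ℝ] Amb m n) : |planeDeriv F x π (0, X)| ≤ Λ * ‖X‖ := by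
  refine ((planeDeriv F x π).le_opNorm _).trans ?_
  rw [norm_zero_pair]
  exact mul_le_mul_of_nonneg_right (norm_planeDeriv_le hF hx hπ) (norm_nonneg _)

lemma hasDerivAt_integrand_graphPlane (hF : IsC2Integrand F r₀ Λ) {x : Amb m n}
    (hx : x ∈ ball (0 : Amb m n) r₀)
    (L D : EuclideanSpace ℝ (Fin m) →L[ℝ] EuclideanSpace ℝ (Fin n)) :
    HasDerivAt (fun h : ℝ => F x (graphPlane (L + h • D)))
      (planeDeriv F x (graphPlane L) (0, shear D)) 0 := by
  have he : ∀ h : ℝ, F x (graphPlane (L + h • D)) =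
      bundleChart F (graphPlane L) (x, h • shear D) := by
    intro h
    have h0 : (0 : Amb m n →L[ℝ] Amb m n) + shear (h • D) +
        (0 : Amb m n →L[ℝ] Amb m n) ∘L shear (h • D) = h • shear D := by
      rw [shear_smul]; ext z; simp
    rw [← bundleChart_zero F, bundleChart_graphPlane_add, h0]
  simp_rw [he]
  have hl : HasDerivAt (fun h : ℝ => ((x, h • shear D) : Amb m n × (Amb m n →L[ℝ] Amb m n)))
      (0, shear D) 0 := by
    refine (hasDerivAt_const _ _).prodMk ?_
    simpa using (hasDerivAt_id (0 : ℝ)).smul_const (shear D)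
  exact (hasFDerivAt_bundleChart hF hx (finrank_graphPlane L)).comp_hasDerivAt_of_eq
    (0 : ℝ) hl (Prod.ext rfl (zero_smul ℝ (shear D)).symm)

/-- The chart at slope L + h D is the chart at L precomposed with a shift by h shear D and the
linear perturbation X ↦ X + h X ∘ shear D. The first accounts for the second derivative, the second
for the first-order correction. -/
lemma hasDerivAt_planeDeriv_graphPlane (hF : IsC2Integrand F r₀ Λ) {x : Amb m n}
    (hx : x ∈ ball (0 : Amb m n) r₀)
    (L D : EuclideanSpace ℝ (Fin m) →L[ℝ] EuclideanSpace ℝ (Fin n))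
    (Y : Amb m n →L[ℝ] Amb m n) :
    HasDerivAt (fun h : ℝ => planeDeriv F x (graphPlane (L + h • D)) (0, Y))
      (fderiv ℝ (fderiv ℝ (bundleChart F (graphPlane L))) (x, 0) (0, shear D) (0, Y) +
        planeDeriv F x (graphPlane L) (0, Y ∘L shear D)) 0 := by
  have hc2 : ContDiffAt ℝ 2 (bundleChart F (graphPlane L)) (x, 0) :=
    (hF x hx _ (finrank_graphPlane L)).2.1
  let T : Amb m n × (Amb m n →L[ℝ] Amb m n) →L[ℝ] Amb m n × (Amb m n →L[ℝ] Amb m n) :=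
    ContinuousLinearMap.prod 0
      (((ContinuousLinearMap.compL ℝ (Amb m n) (Amb m n) (Amb m n)).flip (shear D)) ∘L
        ContinuousLinearMap.snd ℝ _ _)
  have hT : ∀ q, T q = (0, q.2 ∘L shear D) := fun q => rfl
  have hT0 : T (x, 0) = 0 := by
    rw [hT]
    exact Prod.ext rfl (ContinuousLinearMap.zero_comp _)
  have h := hasDerivAt_fderiv_comp_shift hc2 hT0 (0, shear D) (0, Y)
  refine h.congr_of_eventuallyEq (Filter.Eventually.of_forall fun h => ?_)
  have he : bundleChart F (graphPlane (L + h • D)) = fun q =>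
      bundleChart F (graphPlane L) (q + h • T q + h • (0, shear D)) := by
    funext q
    refine (bundleChart_graphPlane_add F q.1 q.2 L (h • D)).trans (congrArg _ (Prod.ext ?_ ?_))
    · simp [hT]
    · rw [shear_smul]
      ext z
      simp [hT]
      abel
  exact congrArg (fun f => fderiv ℝ f (x, 0) (0, Y)) he

lemma abs_integrand_graphPlane_sub_le (hF : IsC2Integrand F r₀ Λ) {x : Amb m n}
    (hx : x ∈ ball (0 : Amb m n) r₀)
    (A L : EuclideanSpace ℝ (Fin m) →L[ℝ] EuclideanSpace ℝ (Fin n)) :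
    |F x (graphPlane A) - F x (graphPlane L)| ≤ Λ * ‖A - L‖ := by
  have hd : ∀ s : ℝ, HasDerivAt (fun s : ℝ => F x (graphPlane (L + s • (A - L))))
      (planeDeriv F x (graphPlane (L + s • (A - L))) (0, shear (A - L))) s := by
    intro s
    exact hasDerivAt_along_segment (f := fun B => F x (graphPlane B))
      (hasDerivAt_integrand_graphPlane hF hx (L + s • (A - L)) (A - L))
  have h := norm_image_sub_le_of_norm_deriv_le_segment_01' (C := Λ * ‖A - L‖)
    (fun s _ => (hd s).hasDerivWithinAt) fun s _ =>
      (abs_planeDeriv_inr_le hF hx (finrank_graphPlane _) _).trans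
        (mul_le_mul_of_nonneg_left (norm_shear_le _)
          ((abs_nonneg _).trans (abs_integrand_le hF hx (finrank_graphPlane A))))
  rwa [(segment_endpoints A L).1, (segment_endpoints A L).2, Real.norm_eq_abs] at h

lemma abs_planeDeriv_graphPlane_sub_le (hF : IsC2Integrand F r₀ Λ) {x : Amb m n}
    (hx : x ∈ ball (0 : Amb m n) r₀)
    (A L : EuclideanSpace ℝ (Fin m) →L[ℝ] EuclideanSpace ℝ (Fin n))
    (Y : Amb m n →L[ℝ] Amb m n) :
    |planeDeriv F x (graphPlane A) (0, Y) - planeDeriv F x (graphPlane L) (0, Y)| ≤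
      2 * Λ * ‖A - L‖ * ‖Y‖ := by
  have hΛ : 0 ≤ Λ := (abs_nonneg _).trans (abs_integrand_le hF hx (finrank_graphPlane A))
  have hd : ∀ s : ℝ, HasDerivAt
      (fun s : ℝ => planeDeriv F x (graphPlane (L + s • (A - L))) (0, Y))
      (fderiv ℝ (fderiv ℝ (bundleChart F (graphPlane (L + s • (A - L))))) (x, 0)
        (0, shear (A - L)) (0, Y) +
        planeDeriv F x (graphPlane (L + s • (A - L))) (0, Y ∘L shear (A - L))) s := by
    intro s
    exact hasDerivAt_along_segment (f := fun B => planeDeriv F x (graphPlane B) (0, Y))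
      (hasDerivAt_planeDeriv_graphPlane hF hx (L + s • (A - L)) (A - L) Y)
  have h := norm_image_sub_le_of_norm_deriv_le_segment_01' (C := 2 * Λ * ‖A - L‖ * ‖Y‖)
    (fun s _ => (hd s).hasDerivWithinAt) fun s _ => ?_
  · rwa [(segment_endpoints A L).1, (segment_endpoints A L).2, Real.norm_eq_abs] at h
  set π := graphPlane (L + s • (A - L))
  have hπ : Module.finrank ℝ π = m := finrank_graphPlane _
  have h1 : ‖fderiv ℝ (fderiv ℝ (bundleChart F π)) (x, 0) (0, shear (A - L)) (0, Y)‖ ≤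
      Λ * ‖A - L‖ * ‖Y‖ := by
    refine (abs_fderiv_fderiv_apply_le _ _ _ _).trans ?_
    rw [norm_zero_pair, norm_zero_pair]
    exact mul_le_mul_of_nonneg_right (mul_le_mul ((hF x hx π hπ).2.2 2 le_rfl) (norm_shear_le _)
      (norm_nonneg _) hΛ) (norm_nonneg _)
  have h2 : |planeDeriv F x π (0, Y ∘L shear (A - L))| ≤ Λ * (‖Y‖ * ‖A - L‖) := by
    refine (abs_planeDeriv_inr_le hF hx hπ _).trans (mul_le_mul_of_nonneg_left ?_ hΛ)
    exact (ContinuousLinearMap.opNorm_comp_le _ _).trans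
      (mul_le_mul_of_nonneg_left (norm_shear_le _) (norm_nonneg _))
  refine (norm_add_le _ _).trans ((add_le_add h1 h2).trans (le_of_eq (by ring)))

lemma finrank_amb : Module.finrank ℝ (Amb m n) = m + n := by simp

lemma norm_starProjection_comp_le (π : Submodule ℝ (Amb m n)) (Y : Amb m n →L[ℝ] Amb m n) :
    ‖π.starProjection ∘L Y‖ ≤ ‖Y‖ :=
  ContinuousLinearMap.opNorm_le_bound _ (norm_nonneg _) fun v =>
    (norm_starProjection_apply_le' π (Y v)).trans (Y.le_opNorm v)

/-- In the factor 3 (m + n) + 2, the variation of F contributes m + n, that of the projection 2 (m +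
n), and that of the derivative of F contributes 2. -/
lemma abs_bForm_graphPlane_sub_le (hF : IsC2Integrand F r₀ Λ) {x : Amb m n}
    (hx : x ∈ ball (0 : Amb m n) r₀)
    (A L : EuclideanSpace ℝ (Fin m) →L[ℝ] EuclideanSpace ℝ (Fin n))
    (Y : Amb m n →L[ℝ] Amb m n) :
    |bForm F x (graphPlane A) Y - bForm F x (graphPlane L) Y| ≤
      (3 * (m + n) + 2) * Λ * ‖A - L‖ * ‖Y‖ := by
  have hΛ : 0 ≤ Λ := (abs_nonneg _).trans (abs_integrand_le hF hx (finrank_graphPlane A))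
  rw [bForm_eq hF hx (finrank_graphPlane A), bForm_eq hF hx (finrank_graphPlane L)]
  set tA := LinearMap.trace ℝ (Amb m n) ((graphPlane A).starProjection ∘L Y).toLinearMap
  set tL := LinearMap.trace ℝ (Amb m n) ((graphPlane L).starProjection ∘L Y).toLinearMap
  have h1 : |tA| ≤ (m + n) * ‖Y‖ := by
    refine (abs_trace_le _).trans ?_
    rw [finrank_amb]; push_cast
    exact mul_le_mul_of_nonneg_left (norm_starProjection_comp_le _ _) (by positivity)
  have h2 : |tA - tL| ≤ (m + n) * (2 * ‖A - L‖ * ‖Y‖) := by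
    have : tA - tL = LinearMap.trace ℝ (Amb m n) (((graphPlane A).starProjection -
        (graphPlane L).starProjection) ∘L Y).toLinearMap := by
      rw [← map_sub]; rfl
    rw [this]
    refine (abs_trace_le _).trans ?_
    rw [finrank_amb]; push_cast
    refine mul_le_mul_of_nonneg_left ?_ (by positivity)
    exact (ContinuousLinearMap.opNorm_comp_le _ _).trans
      (mul_le_mul_of_nonneg_right (norm_starProjection_graphPlane_sub_le A L) (norm_nonneg _))
  have h3 := abs_planeDeriv_graphPlane_sub_le hF hx A L Y
  have h4 := abs_integrand_graphPlane_sub_le hF hx A L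
  have h5 := abs_integrand_le hF hx (finrank_graphPlane L)
  set FA := F x (graphPlane A)
  set FL := F x (graphPlane L)
  set dA := planeDeriv F x (graphPlane A) (0, Y)
  set dL := planeDeriv F x (graphPlane L) (0, Y)
  have e : FA * tA + dA - (FL * tL + dL) = (FA - FL) * tA + FL * (tA - tL) + (dA - dL) := by ring
  rw [e]
  refine (abs_add_three _ _ _).trans ?_
  rw [abs_mul, abs_mul]
  have h6 := mul_le_mul h4 h1 (abs_nonneg _) (by positivity)
  have h7 := mul_le_mul h5 h2 (abs_nonneg _) hΛ
  refine (add_le_add_three h6 h7 h3).trans (le_of_eq (by ring))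

end

/-! ### The dual integrand -/

lemma hasFDerivAt_ringInverse_one_add_sub_one {R : Type*} [NormedRing R] [NormedAlgebra ℝ R]
    [CompleteSpace R] :
    HasFDerivAt (fun x : R => Ring.inverse (1 + x) - 1) (-ContinuousLinearMap.id ℝ R) 0 := by
  have h2 := hasFDerivAt_ringInverse (𝕜 := ℝ) (1 : Rˣ)
  rw [show (((1 : Rˣ) : R)) = 1 + id (0 : R) by simp] at h2
  have h3 := (h2.comp (0 : R) ((hasFDerivAt_id (0 : R)).const_add 1)).sub_const 1
  refine h3.congr_fderiv ?_
  ext v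
  simp

section Adjoint

variable {V : Type*} [NormedAddCommGroup V] [InnerProductSpace ℝ V] [FiniteDimensional ℝ V]

/-- Taking adjoints, as a real linear map. -/
def adjL : (V →L[ℝ] V) →L[ℝ] (V →L[ℝ] V) :=
  LinearMap.mkContinuous
    { toFun := fun X => X.adjoint
      map_add' := fun X Y => map_add _ X Y
      map_smul' := fun c X => by simp } 1 fun X => by simp

@[simp] lemma adjL_apply (X : V →L[ℝ] V) : adjL X = X.adjoint := rfl

/-- The orthogonal complement moves by the inverse adjoint B of A, since ⟨A z, B w⟩ = ⟨z, w⟩. This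
transfers charts between an integrand and its dual. -/
lemma orthogonal_map_eq (σ : Submodule ℝ V) {A B : V →L[ℝ] V} (h1 : A.adjoint * B = 1)
    (h2 : B * A.adjoint = 1) : (σ.map A.toLinearMap)ᗮ = σᗮ.map B.toLinearMap := by
  have e1 : ∀ v, A.adjoint (B v) = v := fun v => congrArg (fun f : V →L[ℝ] V => f v) h1
  have e2 : ∀ v, B (A.adjoint v) = v := fun v => congrArg (fun f : V →L[ℝ] V => f v) h2
  ext v
  simp only [Submodule.mem_orthogonal, Submodule.mem_map]
  constructor
  · intro h
    refine ⟨A.adjoint v, fun w hw => ?_, e2 v⟩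
    rw [ContinuousLinearMap.adjoint_inner_right]
    exact h _ ⟨w, hw, rfl⟩
  · rintro ⟨w, hw, rfl⟩ _ ⟨z, hz, rfl⟩
    have := hw z hz
    rw [← e1 w, ContinuousLinearMap.adjoint_inner_right] at this
    exact this

/-- The inverse of the adjoint near the identity. -/
def coadj (X : V →L[ℝ] V) : V →L[ℝ] V := Ring.inverse (1 + adjL X) - 1

lemma coadj_zero : coadj (0 : V →L[ℝ] V) = 0 := by simp [coadj]

lemma hasFDerivAt_coadj : HasFDerivAt (coadj (V := V)) (-adjL) 0 := by
  have : CompleteSpace V := FiniteDimensional.complete ℝ V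
  have h : HasFDerivAt (fun x : V →L[ℝ] V => Ring.inverse (1 + x) - 1)
      (-ContinuousLinearMap.id ℝ (V →L[ℝ] V)) (adjL 0) := by
    rw [map_zero]
    exact hasFDerivAt_ringInverse_one_add_sub_one
  have ha : HasFDerivAt (adjL : (V →L[ℝ] V) → (V →L[ℝ] V)) adjL 0 :=
    (adjL (V := V)).hasFDerivAt
  exact (h.comp (0 : V →L[ℝ] V) ha).congr_fderiv (by ext X v; simp)

lemma eventually_isUnit_one_add_adjL : ∀ᶠ X : V →L[ℝ] V in 𝓝 0, IsUnit (1 + adjL X) := by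
  have : CompleteSpace V := FiniteDimensional.complete ℝ V
  have h : Filter.Tendsto (fun X : V →L[ℝ] V => 1 + adjL X) (𝓝 0) (𝓝 1) := by
    have hc : Continuous fun X : V →L[ℝ] V => 1 + adjL X := by fun_prop
    simpa using hc.tendsto 0
  exact h.eventually (Units.isOpen.mem_nhds isUnit_one)

lemma trace_adjoint (X : V →L[ℝ] V) :
    LinearMap.trace ℝ V X.adjoint.toLinearMap = LinearMap.trace ℝ V X.toLinearMap := by
  rw [LinearMap.trace_eq_sum_inner _ (stdOrthonormalBasis ℝ V),
    LinearMap.trace_eq_sum_inner _ (stdOrthonormalBasis ℝ V)]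
  refine Finset.sum_congr rfl fun i _ => ?_
  rw [← real_inner_comm]
  exact ContinuousLinearMap.adjoint_inner_left _ _ _

lemma trace_comp_comm_clm (X Y : V →L[ℝ] V) :
    LinearMap.trace ℝ V (X ∘L Y).toLinearMap = LinearMap.trace ℝ V (Y ∘L X).toLinearMap :=
  LinearMap.trace_comp_comm' Y.toLinearMap X.toLinearMap

lemma adjoint_starProjection (U : Submodule ℝ V) : U.starProjection.adjoint = U.starProjection := by
  symm
  rw [ContinuousLinearMap.eq_adjoint_iff]
  intro x y
  exact Submodule.inner_starProjection_left_eq_right U x y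

end Adjoint

/-! ### Endomorphisms, their matrices and the trace pairing -/

section Matrices

@[simp] lemma matUnit_apply (i j : Fin m ⊕ Fin n) (z : Amb m n) :
    matUnit i j z = z j • EuclideanSpace.single i (1 : ℝ) := rfl

lemma norm_matUnit_le (i j : Fin m ⊕ Fin n) : ‖matUnit i j‖ ≤ 1 := by
  refine ContinuousLinearMap.opNorm_le_bound _ zero_le_one fun z => ?_
  rw [matUnit_apply, norm_smul, one_mul]
  simpa using PiLp.norm_apply_le z j

/-- The endomorphism with a given matrix. -/
def matOp (B : Matrix (Fin m ⊕ Fin n) (Fin m ⊕ Fin n) ℝ) : Amb m n →L[ℝ] Amb m n :=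
  ∑ i, ∑ j, B i j • matUnit i j

lemma matOp_apply (B : Matrix (Fin m ⊕ Fin n) (Fin m ⊕ Fin n) ℝ) (z : Amb m n)
    (i : Fin m ⊕ Fin n) : matOp B z i = ∑ j, B i j * z j := by
  classical
  have h1 : matOp B z = ∑ i, ∑ j, B i j • z j • EuclideanSpace.single i (1 : ℝ) := by
    simp only [matOp, sum_apply, smul_apply, matUnit_apply]
  rw [h1, WithLp.ofLp_sum, Finset.sum_apply, Finset.sum_eq_single i]
  · simp
  · intro k _ hk
    simp [Ne.symm hk]
  · simp

/-- The matrix of an endomorphism. -/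
def opMat (Y : Amb m n →L[ℝ] Amb m n) : Matrix (Fin m ⊕ Fin n) (Fin m ⊕ Fin n) ℝ :=
  Matrix.of fun i j => Y (EuclideanSpace.single j (1 : ℝ)) i

lemma matOp_opMat (Y : Amb m n →L[ℝ] Amb m n) : matOp (opMat Y) = Y := by
  ext z i
  rw [matOp_apply]
  have hz : z = ∑ j, z j • EuclideanSpace.single j (1 : ℝ) := by
    have := (EuclideanSpace.basisFun (Fin m ⊕ Fin n) ℝ).sum_repr z
    simpa using this.symm
  conv_rhs => rw [hz, map_sum]
  rw [WithLp.ofLp_sum, Finset.sum_apply]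
  refine Finset.sum_congr rfl fun j _ => ?_
  simp [opMat, mul_comm]

lemma abs_opMat_le (Y : Amb m n →L[ℝ] Amb m n) (i j : Fin m ⊕ Fin n) : |opMat Y i j| ≤ ‖Y‖ := by
  have h := PiLp.norm_apply_le (Y (EuclideanSpace.single j (1 : ℝ))) i
  have h2 := Y.le_opNorm (EuclideanSpace.single j (1 : ℝ))
  simp only [PiLp.norm_single, norm_one, mul_one] at h2
  exact h.trans h2

lemma norm_matOp_le {B : Matrix (Fin m ⊕ Fin n) (Fin m ⊕ Fin n) ℝ} {b : ℝ}
    (hB : ∀ i j, |B i j| ≤ b) : ‖matOp B‖ ≤ (m + n) ^ 2 * b := by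
  refine (norm_sum_le _ _).trans ?_
  have h : ∀ i ∈ Finset.univ, ‖∑ j, B i j • matUnit i j‖ ≤ (m + n) * b := by
    intro i _
    refine (norm_sum_le _ _).trans ?_
    refine (Finset.sum_le_card_nsmul _ _ b fun j _ => ?_).trans (by simp)
    rw [norm_smul]
    exact (mul_le_of_le_one_right (norm_nonneg _) (norm_matUnit_le i j)).trans (hB i j)
  refine (Finset.sum_le_card_nsmul _ _ _ h).trans (le_of_eq ?_)
  simp
  ring

lemma matOp_sub (A B : Matrix (Fin m ⊕ Fin n) (Fin m ⊕ Fin n) ℝ) :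
    matOp (A - B) = matOp A - matOp B := by
  ext z i
  simp [matOp_apply, sub_mul, Finset.sum_sub_distrib]

lemma frob_eq_sum (A B : Matrix (Fin m ⊕ Fin n) (Fin m ⊕ Fin n) ℝ) :
    frob A B = ∑ i, ∑ j, A i j * B i j := by
  rw [frob, Matrix.trace, Finset.sum_comm]
  simp only [Matrix.diag, Matrix.mul_apply, Matrix.transpose_apply]

lemma frob_sq_le (A B : Matrix (Fin m ⊕ Fin n) (Fin m ⊕ Fin n) ℝ) :
    frob A B ^ 2 ≤ frob A A * frob B B := by
  simp only [frob_eq_sum, ← Finset.sum_product']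
  refine (Finset.sum_mul_sq_le_sq_mul_sq _ _ _).trans (le_of_eq ?_)
  simp only [pow_two]

lemma abs_frob_opMat_le (A : Matrix (Fin m ⊕ Fin n) (Fin m ⊕ Fin n) ℝ)
    (Y : Amb m n →L[ℝ] Amb m n) : |frob A (opMat Y)| ≤ √(frob A A) * ((m + n) * ‖Y‖) := by
  have hA : 0 ≤ frob A A := by
    rw [frob_eq_sum]
    exact Finset.sum_nonneg fun i _ => Finset.sum_nonneg fun j _ => mul_self_nonneg _
  have hY : frob (opMat Y) (opMat Y) ≤ ((m + n) * ‖Y‖) ^ 2 := by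
    rw [frob_eq_sum]
    have h : ∀ i ∈ Finset.univ, ∑ j, opMat Y i j * opMat Y i j ≤ (m + n) * ‖Y‖ ^ 2 := by
      intro i _
      refine (Finset.sum_le_card_nsmul _ _ (‖Y‖ ^ 2) fun j _ => ?_).trans (by simp)
      rw [← pow_two, ← sq_abs]
      exact pow_le_pow_left₀ (abs_nonneg _) (abs_opMat_le Y i j) 2
    refine (Finset.sum_le_card_nsmul _ _ _ h).trans (le_of_eq ?_)
    simp
    ring
  refine abs_le_of_sq_le_sq ?_ (by positivity)
  rw [mul_pow, Real.sq_sqrt hA]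
  exact (frob_sq_le A (opMat Y)).trans (mul_le_mul_of_nonneg_left hY hA)

lemma bForm_add (F : Amb m n → Submodule ℝ (Amb m n) → ℝ) (x : Amb m n)
    (π : Submodule ℝ (Amb m n)) (X Y : Amb m n →L[ℝ] Amb m n) :
    bForm F x π (X + Y) = bForm F x π X + bForm F x π Y := by
  simp only [bForm, ContinuousLinearMap.comp_add, ContinuousLinearMap.add_comp,
    ContinuousLinearMap.toLinearMap_add, map_add]
  ring

lemma bForm_smul (F : Amb m n → Submodule ℝ (Amb m n) → ℝ) (x : Amb m n)
    (π : Submodule ℝ (Amb m n)) (c : ℝ) (X : Amb m n →L[ℝ] Amb m n) :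
    bForm F x π (c • X) = c * bForm F x π X := by
  simp only [bForm, ContinuousLinearMap.comp_smul, ContinuousLinearMap.smul_comp,
    ContinuousLinearMap.toLinearMap_smul, map_smul, smul_eq_mul]
  ring

lemma bForm_sum (F : Amb m n → Submodule ℝ (Amb m n) → ℝ) (x : Amb m n)
    (π : Submodule ℝ (Amb m n)) {ι : Type*} (s : Finset ι) (X : ι → Amb m n →L[ℝ] Amb m n) :
    bForm F x π (∑ i ∈ s, X i) = ∑ i ∈ s, bForm F x π (X i) :=
  map_sum (AddMonoidHom.mk' (bForm F x π) (bForm_add F x π)) X s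

lemma bForm_matOp (F : Amb m n → Submodule ℝ (Amb m n) → ℝ) (x : Amb m n)
    (π : Submodule ℝ (Amb m n)) (B : Matrix (Fin m ⊕ Fin n) (Fin m ⊕ Fin n) ℝ) :
    bForm F x π (matOp B) = frob (bMatrix F x π) B := by
  rw [frob_eq_sum, matOp, bForm_sum]
  refine Finset.sum_congr rfl fun i _ => ?_
  rw [bForm_sum]
  refine Finset.sum_congr rfl fun j _ => ?_
  rw [bForm_smul, mul_comm]
  rfl

lemma trace_comp_matUnit (Q : Amb m n →L[ℝ] Amb m n) (i j : Fin m ⊕ Fin n) :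
    LinearMap.trace ℝ (Amb m n) (Q ∘L matUnit i j).toLinearMap = opMat Q j i := by
  classical
  rw [LinearMap.trace_eq_sum_inner _ (EuclideanSpace.basisFun (Fin m ⊕ Fin n) ℝ),
    Finset.sum_eq_single j]
  · simp [opMat, EuclideanSpace.inner_single_left]
  · intro k _ hk
    simp [hk]
  · simp

lemma exists_trace_representation (φ : (Amb m n →L[ℝ] Amb m n) →ₗ[ℝ] ℝ) :
    ∃ S : Amb m n →L[ℝ] Amb m n, ∀ Y,
      φ Y = LinearMap.trace ℝ (Amb m n) (S ∘L Y).toLinearMap := by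
  refine ⟨matOp (Matrix.of fun i j => φ (matUnit j i)), fun Y => ?_⟩
  have h1 : ∀ i j, φ (matUnit i j) = LinearMap.trace ℝ (Amb m n)
      (matOp (Matrix.of fun i j => φ (matUnit j i)) ∘L matUnit i j).toLinearMap := by
    intro i j
    classical
    rw [trace_comp_matUnit, opMat, Matrix.of_apply, matOp_apply, Finset.sum_eq_single i]
    · simp
    · intro k _ hk
      simp [hk]
    · simp
  rw [← matOp_opMat Y]
  set S := matOp (Matrix.of fun i j => φ (matUnit j i))
  simp only [matOp, map_sum, map_smul, h1, ContinuousLinearMap.comp_finsetSum,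
    ContinuousLinearMap.comp_smul, ContinuousLinearMap.toLinearMap_sum,
    ContinuousLinearMap.toLinearMap_smul]

end Matrices

/-! ### The operator of the dual integrand -/

lemma starProjection_orthogonal_orthogonal (π : Submodule ℝ (Amb m n)) :
    πᗮᗮ.starProjection = π.starProjection := by
  ext1 v
  simp

/-- The endomorphism with matrix `B_{F^*}(x, π^⊥)`. -/
def dualOp (F : Amb m n → Submodule ℝ (Amb m n) → ℝ) (x : Amb m n) (π : Submodule ℝ (Amb m n)) :
    Amb m n →L[ℝ] Amb m n := matOp (bMatrix (dualIntegrand F) x πᗮ)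

lemma USAC.le_bForm {F : Amb m n → Submodule ℝ (Amb m n) → ℝ} {r₀ K : ℝ} (h : USAC F r₀ K)
    {x : Amb m n} (hx : x ∈ ball (0 : Amb m n) r₀) {π₀ π₁ : Submodule ℝ (Amb m n)}
    (h₀ : Module.finrank ℝ π₀ = m) (h₁ : Module.finrank ℝ π₁ = m) :
    K * planeDistSq π₀ π₁ ≤ bForm F x π₀ (dualOp F x π₁) := by
  rw [dualOp, bForm_matOp]
  exact h x hx π₀ π₁ h₀ h₁

section

variable {F : Amb m n → Submodule ℝ (Amb m n) → ℝ} {r₀ Λ : ℝ}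

/-- Near 0 the dual chart is the chart of F at π composed with X ↦ ((id + X)^*)⁻¹ - id, whose
derivative at 0 is minus the adjoint. This is the origin of the minus sign in `bForm_dual`. -/
lemma hasFDerivAt_dualChart (hF : IsC2Integrand F r₀ Λ) {x : Amb m n}
    (hx : x ∈ ball (0 : Amb m n) r₀) {π : Submodule ℝ (Amb m n)} (hπ : Module.finrank ℝ π = m) :
    HasFDerivAt (fun X : Amb m n →L[ℝ] Amb m n => bundleChart (dualIntegrand F) πᗮ (x, X))
      ((planeDeriv F x π ∘L ContinuousLinearMap.inr ℝ _ _) ∘L (-adjL)) 0 := by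
  have h1 : HasFDerivAt (fun X : Amb m n →L[ℝ] Amb m n => bundleChart F π (x, X))
      (planeDeriv F x π ∘L ContinuousLinearMap.inr ℝ _ _) (coadj 0) := by
    rw [coadj_zero]
    exact (hasFDerivAt_bundleChart hF hx hπ).comp (0 : Amb m n →L[ℝ] Amb m n)
      (hasFDerivAt_prodMk_right x 0)
  refine (h1.comp (0 : Amb m n →L[ℝ] Amb m n) hasFDerivAt_coadj).congr_of_eventuallyEq ?_
  filter_upwards [eventually_isUnit_one_add_adjL (V := Amb m n)] with X hX
  have hadj : (ContinuousLinearMap.id ℝ (Amb m n) + X).adjoint = 1 + adjL X := by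
    rw [map_add, ContinuousLinearMap.adjoint_id]
    rfl
  have e := orthogonal_map_eq πᗮ (A := ContinuousLinearMap.id ℝ (Amb m n) + X)
    (B := Ring.inverse (1 + adjL X)) (by rw [hadj]; exact Ring.mul_inverse_cancel _ hX)
    (by rw [hadj]; exact Ring.inverse_mul_cancel _ hX)
  have e2 : ContinuousLinearMap.id ℝ (Amb m n) + coadj X = Ring.inverse (1 + adjL X) := by
    rw [coadj]
    exact add_sub_cancel _ _
  simp only [Function.comp, bundleChart, dualIntegrand]
  rw [e, e2, Submodule.orthogonal_orthogonal]

lemma bForm_dual (hF : IsC2Integrand F r₀ Λ) {x : Amb m n}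
    (hx : x ∈ ball (0 : Amb m n) r₀) {π : Submodule ℝ (Amb m n)} (hπ : Module.finrank ℝ π = m)
    (Y : Amb m n →L[ℝ] Amb m n) :
    bForm (dualIntegrand F) x πᗮ Y =
      F x π * LinearMap.trace ℝ (Amb m n) (πᗮ.starProjection ∘L Y).toLinearMap -
        planeDeriv F x π (0, πᗮ.starProjection ∘L Y.adjoint ∘L π.starProjection) := by
  have e : (π.starProjection ∘L Y ∘L πᗮ.starProjection).adjoint =
      πᗮ.starProjection ∘L Y.adjoint ∘L π.starProjection := by
    rw [ContinuousLinearMap.adjoint_comp, ContinuousLinearMap.adjoint_comp,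
      adjoint_starProjection, adjoint_starProjection]
    rfl
  rw [bForm, (hasFDerivAt_dualChart hF hx hπ).fderiv, starProjection_orthogonal_orthogonal,
    dualIntegrand, Submodule.orthogonal_orthogonal, sub_eq_add_neg]
  congr 1
  rw [ContinuousLinearMap.comp_apply, neg_apply, adjL_apply, e, map_neg]
  rfl

lemma planeDeriv_inr_normal_tangent (hF : IsC2Integrand F r₀ Λ) {x : Amb m n}
    (hx : x ∈ ball (0 : Amb m n) r₀) {π : Submodule ℝ (Amb m n)} (hπ : Module.finrank ℝ π = m)
    (Y : Amb m n →L[ℝ] Amb m n) :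
    planeDeriv F x π (0, πᗮ.starProjection ∘L Y ∘L π.starProjection) = planeDeriv F x π (0, Y) := by
  have h2 : planeDeriv F x π (0, Y - πᗮ.starProjection ∘L Y ∘L π.starProjection) = 0 := by
    refine planeDeriv_inr_eq_zero hF hx hπ fun v hv => ?_
    have : π.starProjection v = v := Submodule.starProjection_eq_self_iff.mpr hv
    simp only [sub_apply, ContinuousLinearMap.comp_apply, this,
      Submodule.starProjection_orthogonal_val, sub_sub_cancel]
    exact Submodule.starProjection_apply_mem π _
  symm
  rw [← sub_eq_zero, ← map_sub, Prod.mk_sub_mk, sub_zero, h2]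

lemma starProjection_comp_self (π : Submodule ℝ (Amb m n)) :
    π.starProjection ∘L π.starProjection = π.starProjection := by
  ext1 v
  exact Submodule.starProjection_eq_self_iff.mpr (π.starProjection_apply_mem v)

/-- Representing the plane derivative of F as Y ↦ tr (S Y) makes `bForm_dual` a trace pairing in Y,
from which the endomorphism is read off as F π^⊥ - π S π^⊥. -/
lemma exists_dualOp_eq (hF : IsC2Integrand F r₀ Λ) {x : Amb m n}
    (hx : x ∈ ball (0 : Amb m n) r₀) {π : Submodule ℝ (Amb m n)} (hπ : Module.finrank ℝ π = m) :
    ∃ S : Amb m n →L[ℝ] Amb m n,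
      (∀ Y, planeDeriv F x π (0, Y) = LinearMap.trace ℝ (Amb m n) (S ∘L Y).toLinearMap) ∧
      dualOp F x π = F x π • πᗮ.starProjection -
        π.starProjection ∘L S ∘L πᗮ.starProjection := by
  obtain ⟨S, hS⟩ := exists_trace_representation
    ((planeDeriv F x π).toLinearMap ∘ₗ LinearMap.inr ℝ (Amb m n) (Amb m n →L[ℝ] Amb m n))
  have hS' : ∀ Y, planeDeriv F x π (0, Y) =
      LinearMap.trace ℝ (Amb m n) (S ∘L Y).toLinearMap := hS
  refine ⟨S, hS', ?_⟩
  set σ := πᗮ.starProjection with hσ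
  set p := π.starProjection with hp
  set Q : Amb m n →L[ℝ] Amb m n := F x π • σ - p ∘L S ∘L σ with hQ
  have hQadj : ∀ Y : Amb m n →L[ℝ] Amb m n,
      LinearMap.trace ℝ (Amb m n) (Q.adjoint ∘L Y).toLinearMap =
        F x π * LinearMap.trace ℝ (Amb m n) (σ ∘L Y).toLinearMap -
          LinearMap.trace ℝ (Amb m n) (S ∘L σ ∘L Y.adjoint ∘L p).toLinearMap := by
    intro Y
    have e1 : LinearMap.trace ℝ (Amb m n) (Q.adjoint ∘L Y).toLinearMap =
        LinearMap.trace ℝ (Amb m n) (Y.adjoint ∘L Q).toLinearMap := by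
      rw [← trace_adjoint, ContinuousLinearMap.adjoint_comp, ContinuousLinearMap.adjoint_adjoint]
    have e2 : LinearMap.trace ℝ (Amb m n) (σ ∘L Y).toLinearMap =
        LinearMap.trace ℝ (Amb m n) (Y.adjoint ∘L σ).toLinearMap := by
      rw [← trace_adjoint, ContinuousLinearMap.adjoint_comp, hσ, adjoint_starProjection]
    have e3 : LinearMap.trace ℝ (Amb m n) (S ∘L σ ∘L Y.adjoint ∘L p).toLinearMap =
        LinearMap.trace ℝ (Amb m n) (Y.adjoint ∘L p ∘L S ∘L σ).toLinearMap :=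
      trace_comp_comm_clm (S ∘L σ) (Y.adjoint ∘L p)
    rw [e1, e2, e3, hQ, ContinuousLinearMap.comp_sub, ContinuousLinearMap.comp_smul,
      ContinuousLinearMap.toLinearMap_sub, ContinuousLinearMap.toLinearMap_smul, map_sub, map_smul,
      smul_eq_mul]
  have hB : ∀ i j, bMatrix (dualIntegrand F) x πᗮ i j = opMat Q i j := by
    intro i j
    have h1 : bMatrix (dualIntegrand F) x πᗮ i j = bForm (dualIntegrand F) x πᗮ (matUnit i j) := rfl
    rw [h1, bForm_dual hF hx hπ, hS', ← hQadj, trace_comp_matUnit]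
    simp only [opMat, Matrix.of_apply]
    have h2 : ∀ (z : Amb m n) k, z k = inner ℝ (EuclideanSpace.single k (1 : ℝ)) z := by
      intro z k; simp [EuclideanSpace.inner_single_left]
    rw [h2, h2, ContinuousLinearMap.adjoint_inner_right, real_inner_comm]
  have : bMatrix (dualIntegrand F) x πᗮ = opMat Q := by
    ext i j; exact hB i j
  rw [dualOp, this, matOp_opMat]

/-- Both terms F π^⊥ and π S π^⊥ end in π^⊥. For this reason the derivative of the test field
contains the full matrix B_{F*}, exactly as in the scalar atomic condition. -/
lemma dualOp_comp_starProjection (hF : IsC2Integrand F r₀ Λ) {x : Amb m n}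
    (hx : x ∈ ball (0 : Amb m n) r₀) {π : Submodule ℝ (Amb m n)} (hπ : Module.finrank ℝ π = m)
    (z : Amb m n) : dualOp F x π (πᗮ.starProjection z) = dualOp F x π z := by
  obtain ⟨S, -, hS⟩ := exists_dualOp_eq hF hx hπ
  have h : πᗮ.starProjection (πᗮ.starProjection z) = πᗮ.starProjection z :=
    Submodule.starProjection_eq_self_iff.mpr (πᗮ.starProjection_apply_mem z)
  rw [hS]
  simp only [sub_apply, smul_apply, ContinuousLinearMap.comp_apply, h]

/-- The cancellation behind the estimate. With D = F π^⊥ - π S π^⊥, the trace part of B_F : (D R) is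
-F tr (π S π^⊥ R). In the derivative part π S π^⊥ R maps into π and drops out, leaving F tr (π S π^⊥
R). -/
lemma bForm_dualOp_comp (hF : IsC2Integrand F r₀ Λ) {x : Amb m n}
    (hx : x ∈ ball (0 : Amb m n) r₀) {π : Submodule ℝ (Amb m n)} (hπ : Module.finrank ℝ π = m)
    (R : Amb m n →L[ℝ] Amb m n) : bForm F x π (dualOp F x π ∘L R) = 0 := by
  obtain ⟨S, hS, hD⟩ := exists_dualOp_eq hF hx hπ
  have hpσ : ∀ z, π.starProjection (πᗮ.starProjection z) = 0 := by
    intro z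
    have h : π.starProjection (π.starProjection z) = π.starProjection z :=
      Submodule.starProjection_eq_self_iff.mpr (π.starProjection_apply_mem z)
    rw [Submodule.starProjection_orthogonal_val, map_sub, h, sub_self]
  have hpp : ∀ z, π.starProjection (π.starProjection z) = π.starProjection z := fun z =>
      Submodule.starProjection_eq_self_iff.mpr (π.starProjection_apply_mem z)
  have e1 : π.starProjection ∘L dualOp F x π ∘L R =
      -(π.starProjection ∘L S ∘L πᗮ.starProjection ∘L R) := by
    rw [hD]
    ext1 z
    simp only [ContinuousLinearMap.comp_apply, sub_apply, smul_apply, neg_apply, map_sub, map_smul,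
      hpσ, hpp, smul_zero, zero_sub]
  have e2 : planeDeriv F x π (0, dualOp F x π ∘L R) =
      F x π * planeDeriv F x π (0, πᗮ.starProjection ∘L R) := by
    have h0 : planeDeriv F x π (0, π.starProjection ∘L S ∘L πᗮ.starProjection ∘L R) = 0 :=
      planeDeriv_inr_eq_zero hF hx hπ fun v _ => π.starProjection_apply_mem _
    have h1 : ((0 : Amb m n), dualOp F x π ∘L R) =
        F x π • ((0 : Amb m n), πᗮ.starProjection ∘L R) -
          (0, π.starProjection ∘L S ∘L πᗮ.starProjection ∘L R) := by
      rw [hD]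
      refine Prod.ext (by simp) ?_
      ext1 z
      simp only [ContinuousLinearMap.comp_apply, sub_apply, smul_apply, Prod.smul_snd,
        Prod.snd_sub]
    rw [h1, map_sub, map_smul, h0, sub_zero, smul_eq_mul]
  have e3 : planeDeriv F x π (0, πᗮ.starProjection ∘L R) =
      LinearMap.trace ℝ (Amb m n)
        (π.starProjection ∘L S ∘L πᗮ.starProjection ∘L R).toLinearMap := by
    have h1 : πᗮ.starProjection ∘L (πᗮ.starProjection ∘L R) ∘L π.starProjection =
        (πᗮ.starProjection ∘L R) ∘L π.starProjection := by
      rw [← ContinuousLinearMap.comp_assoc, ← ContinuousLinearMap.comp_assoc,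
        starProjection_comp_self]
    rw [← planeDeriv_inr_normal_tangent hF hx hπ, h1, hS, trace_comp_comm_clm π.starProjection]
    rfl
  rw [bForm_eq hF hx hπ, e1, e2, e3, ContinuousLinearMap.toLinearMap_neg, map_neg]
  ring

lemma norm_dualOp_le (hF : IsC2Integrand F r₀ Λ) {x : Amb m n}
    (hx : x ∈ ball (0 : Amb m n) r₀) {π : Submodule ℝ (Amb m n)} (hπ : Module.finrank ℝ π = m) :
    ‖dualOp F x π‖ ≤ (m + n) ^ 2 * ((m + n + 1) * Λ) := by
  have hΛ : 0 ≤ Λ := (abs_nonneg _).trans (abs_integrand_le hF hx hπ)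
  refine norm_matOp_le fun i j => ?_
  have h1 : bMatrix (dualIntegrand F) x πᗮ i j = bForm (dualIntegrand F) x πᗮ (matUnit i j) := rfl
  rw [h1, bForm_dual hF hx hπ]
  have h2 : |LinearMap.trace ℝ (Amb m n) (πᗮ.starProjection ∘L matUnit i j).toLinearMap| ≤ m + n := by
    refine (abs_trace_le _).trans ?_
    rw [finrank_amb]; push_cast
    exact mul_le_of_le_one_right (by positivity)
      ((norm_starProjection_comp_le _ _).trans (norm_matUnit_le i j))
  have h3 : |planeDeriv F x π (0, πᗮ.starProjection ∘L (matUnit i j).adjoint ∘L π.starProjection)|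
      ≤ Λ := by
    rw [planeDeriv_inr_normal_tangent hF hx hπ]
    refine (abs_planeDeriv_inr_le hF hx hπ _).trans (mul_le_of_le_one_right hΛ ?_)
    rw [LinearIsometryEquiv.norm_map]
    exact norm_matUnit_le i j
  have h4 := abs_integrand_le hF hx hπ
  refine (abs_sub _ _).trans ?_
  rw [abs_mul]
  have := mul_le_mul h4 h2 (abs_nonneg _) hΛ
  linarith

lemma contDiffAt_planeDeriv (hF : IsC2Integrand F r₀ Λ) {x : Amb m n}
    (hx : x ∈ ball (0 : Amb m n) r₀) {π : Submodule ℝ (Amb m n)} (hπ : Module.finrank ℝ π = m) :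
    ContDiffAt ℝ 1 (fun x => planeDeriv F x π) x := by
  have h1 : ContDiffAt ℝ 1 (fderiv ℝ (bundleChart F π)) (x, 0) :=
    (hF x hx π hπ).2.1.fderiv_right (by norm_num)
  exact h1.comp x (f := fun x => (x, (0 : Amb m n →L[ℝ] Amb m n)))
    (contDiffAt_id.prodMk contDiffAt_const)

lemma contDiffAt_integrand (hF : IsC2Integrand F r₀ Λ) {x : Amb m n}
    (hx : x ∈ ball (0 : Amb m n) r₀) {π : Submodule ℝ (Amb m n)} (hπ : Module.finrank ℝ π = m) :
    ContDiffAt ℝ 2 (fun x => F x π) x := by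
  simp_rw [← bundleChart_zero F]
  exact (hF x hx π hπ).2.1.comp x (f := fun x => (x, (0 : Amb m n →L[ℝ] Amb m n)))
    (contDiffAt_id.prodMk contDiffAt_const)

lemma contDiffAt_dualOp (hF : IsC2Integrand F r₀ Λ) {x : Amb m n}
    (hx : x ∈ ball (0 : Amb m n) r₀) {π : Submodule ℝ (Amb m n)} (hπ : Module.finrank ℝ π = m) :
    ContDiffAt ℝ 1 (fun x => dualOp F x π) x := by
  suffices h : ∀ i j, ContDiffAt ℝ 1 (fun x => bMatrix (dualIntegrand F) x πᗮ i j) x by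
    have e : (fun x => dualOp F x π) =
        fun x => ∑ i, ∑ j, bMatrix (dualIntegrand F) x πᗮ i j • matUnit i j := rfl
    rw [e]
    have hs : ∀ i j, ContDiffAt ℝ 1
        (fun x => bMatrix (dualIntegrand F) x πᗮ i j • (matUnit i j : Amb m n →L[ℝ] Amb m n)) x :=
      fun i j => (h i j).smul contDiffAt_const
    exact ContDiffAt.sum fun i _ => ContDiffAt.sum fun j _ => hs i j
  intro i j
  have h1 : (fun x => bMatrix (dualIntegrand F) x πᗮ i j) =ᶠ[𝓝 x] fun x =>
      F x π * LinearMap.trace ℝ (Amb m n) (πᗮ.starProjection ∘L matUnit i j).toLinearMap -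
        planeDeriv F x π (0, πᗮ.starProjection ∘L (matUnit i j).adjoint ∘L π.starProjection) := by
    filter_upwards [isOpen_ball.mem_nhds hx] with y hy
    exact bForm_dual hF hy hπ (matUnit i j)
  refine ContDiffAt.congr_of_eventuallyEq ?_ h1
  exact (((contDiffAt_integrand hF hx hπ).of_le (by norm_num)).mul contDiffAt_const).sub
    ((contDiffAt_planeDeriv hF hx hπ).clm_apply contDiffAt_const)

end

/-! ### Dependence of the integrand on the point -/

section

variable {F : Amb m n → Submodule ℝ (Amb m n) → ℝ} {r₀ Λ lam : ℝ}

lemma abs_bForm_sub_le (hv : VariationBound F r₀ lam) {x y : Amb m n}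
    (hx : x ∈ ball (0 : Amb m n) r₀) (hy : y ∈ ball (0 : Amb m n) r₀)
    {π : Submodule ℝ (Amb m n)} (hπ : Module.finrank ℝ π = m) (Y : Amb m n →L[ℝ] Amb m n) :
    |bForm F x π Y - bForm F y π Y| ≤ (m + n) * lam * ‖x - y‖ * ‖Y‖ := by
  have h1 : bForm F x π Y - bForm F y π Y = frob (bMatrix F x π - bMatrix F y π) (opMat Y) := by
    conv_lhs => rw [← matOp_opMat Y]
    rw [bForm_matOp, bForm_matOp]
    simp only [frob_eq_sum, Matrix.sub_apply, sub_mul, Finset.sum_sub_distrib]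
  rw [h1]
  refine (abs_frob_opMat_le _ Y).trans ?_
  refine (mul_le_mul_of_nonneg_right (hv x hx y hy π hπ) (by positivity)).trans (le_of_eq (by ring))

lemma bForm_id (hF : IsC2Integrand F r₀ Λ) {x : Amb m n}
    (hx : x ∈ ball (0 : Amb m n) r₀) {π : Submodule ℝ (Amb m n)} (hπ : Module.finrank ℝ π = m) :
    bForm F x π (ContinuousLinearMap.id ℝ (Amb m n)) = F x π * m := by
  have h0 : planeDeriv F x π (0, ContinuousLinearMap.id ℝ (Amb m n)) = 0 :=
    planeDeriv_inr_eq_zero hF hx hπ fun v hv => hv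
  rw [bForm_eq hF hx hπ, h0, add_zero,
    ← sum_inner_eq_trace_starProjection π (stdOrthonormalBasis ℝ π)]
  congr 1
  have : ∀ i, inner ℝ (stdOrthonormalBasis ℝ π i : Amb m n)
      (ContinuousLinearMap.id ℝ (Amb m n) (stdOrthonormalBasis ℝ π i : Amb m n)) = (1 : ℝ) := by
    intro i
    rw [ContinuousLinearMap.id_apply, real_inner_self_eq_norm_sq, ← Submodule.coe_norm,
      OrthonormalBasis.norm_eq_one, one_pow]
  simp only [this]
  simp [hπ]

/-- The integrand is recovered from its matrix, B_F : id = m F with m ≥ 1, so a Lipschitz constant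
of B_F also controls F. No bound other than λ is spent on the dependence on x. -/
lemma abs_integrand_sub_le (hm : 1 ≤ m) (hF : IsC2Integrand F r₀ Λ) (hv : VariationBound F r₀ lam)
    (hlam : 0 ≤ lam) {x y : Amb m n}
    (hx : x ∈ ball (0 : Amb m n) r₀) (hy : y ∈ ball (0 : Amb m n) r₀)
    {π : Submodule ℝ (Amb m n)} (hπ : Module.finrank ℝ π = m) :
    |F x π - F y π| ≤ (m + n) * lam * ‖x - y‖ := by
  have h1 := abs_bForm_sub_le hv hx hy hπ (ContinuousLinearMap.id ℝ (Amb m n))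
  rw [bForm_id hF hx hπ, bForm_id hF hy hπ, ← sub_mul, abs_mul, Nat.abs_cast] at h1
  have h2 : (m + n) * lam * ‖x - y‖ * ‖ContinuousLinearMap.id ℝ (Amb m n)‖ ≤
      (m + n) * lam * ‖x - y‖ :=
    mul_le_of_le_one_right (by positivity) ContinuousLinearMap.norm_id_le
  have h3 : |F x π - F y π| ≤ |F x π - F y π| * m :=
    le_mul_of_one_le_right (abs_nonneg _) (by exact_mod_cast hm)
  linarith

lemma abs_planeDeriv_inl_le (hm : 1 ≤ m) (hF : IsC2Integrand F r₀ Λ) (hv : VariationBound F r₀ lam)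
    (hlam : 0 ≤ lam) {x : Amb m n} (hx : x ∈ ball (0 : Amb m n) r₀)
    {π : Submodule ℝ (Amb m n)} (hπ : Module.finrank ℝ π = m) (v : Amb m n) :
    |planeDeriv F x π (v, 0)| ≤ (m + n) * lam * ‖v‖ := by
  have h1 : HasFDerivAt (fun y => bundleChart F π (y, 0))
      (planeDeriv F x π ∘L ContinuousLinearMap.inl ℝ (Amb m n) (Amb m n →L[ℝ] Amb m n)) x := by
    have h0 : HasFDerivAt (fun y : Amb m n => (y, (0 : Amb m n →L[ℝ] Amb m n)))
        (ContinuousLinearMap.inl ℝ (Amb m n) (Amb m n →L[ℝ] Amb m n)) x :=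
      hasFDerivAt_prodMk_left x 0
    exact (hasFDerivAt_bundleChart hF hx hπ).comp x h0
  have h2 : ‖planeDeriv F x π ∘L ContinuousLinearMap.inl ℝ (Amb m n)
      (Amb m n →L[ℝ] Amb m n)‖ ≤ (m + n) * lam := by
    refine h1.le_of_lip' (by positivity) ?_
    filter_upwards [isOpen_ball.mem_nhds hx] with y hy
    rw [bundleChart_zero, bundleChart_zero]
    exact abs_integrand_sub_le hm hF hv hlam hy hx hπ
  exact ((planeDeriv F x π ∘L ContinuousLinearMap.inl ℝ _ _).le_opNorm v).trans
    (mul_le_mul_of_nonneg_right h2 (norm_nonneg v))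

lemma trace_tangent_normal (π : Submodule ℝ (Amb m n)) (Y : Amb m n →L[ℝ] Amb m n) :
    LinearMap.trace ℝ (Amb m n) (π.starProjection ∘L πᗮ.starProjection ∘L Y).toLinearMap = 0 := by
  have : π.starProjection ∘L πᗮ.starProjection ∘L Y = 0 := by
    ext1 z
    have h : π.starProjection (π.starProjection (Y z)) = π.starProjection (Y z) :=
      Submodule.starProjection_eq_self_iff.mpr (π.starProjection_apply_mem _)
    simp only [ContinuousLinearMap.comp_apply, Submodule.starProjection_orthogonal_val, map_sub, h,
      sub_self, zero_apply]
  rw [this, ContinuousLinearMap.toLinearMap_zero, map_zero]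

/-- Each entry of B_{F*} is F times a fixed trace minus B_F paired with the fixed endomorphism Z =
π^⊥ Y^* π; the trace part of B_F : Z vanishes because π π^⊥ = 0. Both pieces have Lipschitz
constants proportional to λ. -/
lemma norm_dualOp_sub_le (hm : 1 ≤ m) (hF : IsC2Integrand F r₀ Λ) (hv : VariationBound F r₀ lam)
    (hlam : 0 ≤ lam) {x y : Amb m n}
    (hx : x ∈ ball (0 : Amb m n) r₀) (hy : y ∈ ball (0 : Amb m n) r₀)
    {π : Submodule ℝ (Amb m n)} (hπ : Module.finrank ℝ π = m) :
    ‖dualOp F x π - dualOp F y π‖ ≤ (m + n) ^ 2 * ((m + n + 1) * ((m + n) * lam * ‖x - y‖)) := by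
  rw [dualOp, dualOp, ← matOp_sub]
  refine norm_matOp_le fun i j => ?_
  set Y : Amb m n →L[ℝ] Amb m n := matUnit i j
  set Z : Amb m n →L[ℝ] Amb m n := πᗮ.starProjection ∘L Y.adjoint ∘L π.starProjection with hZ
  have hb : ∀ x ∈ ball (0 : Amb m n) r₀, bMatrix (dualIntegrand F) x πᗮ i j =
      F x π * LinearMap.trace ℝ (Amb m n) (πᗮ.starProjection ∘L Y).toLinearMap -
        bForm F x π Z := by
    intro x hx
    have h1 : bMatrix (dualIntegrand F) x πᗮ i j = bForm (dualIntegrand F) x πᗮ Y := rfl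
    rw [h1, bForm_dual hF hx hπ, bForm_eq hF hx hπ Z, hZ, trace_tangent_normal, mul_zero, zero_add]
  rw [Matrix.sub_apply, hb x hx, hb y hy]
  set t := LinearMap.trace ℝ (Amb m n) (πᗮ.starProjection ∘L Y).toLinearMap
  have ht : |t| ≤ m + n := by
    refine (abs_trace_le _).trans ?_
    rw [finrank_amb]; push_cast
    exact mul_le_of_le_one_right (by positivity)
      ((norm_starProjection_comp_le _ _).trans (norm_matUnit_le i j))
  have hZn : ‖Z‖ ≤ 1 := by
    refine (norm_starProjection_comp_le _ _).trans ((ContinuousLinearMap.opNorm_comp_le _ _).trans ?_)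
    refine mul_le_one₀ ?_ (norm_nonneg _) (Submodule.starProjection_norm_le _)
    rw [LinearIsometryEquiv.norm_map]
    exact norm_matUnit_le i j
  have h2 := abs_integrand_sub_le hm hF hv hlam hx hy hπ
  have h3 := (abs_bForm_sub_le hv hx hy hπ Z).trans
    (mul_le_of_le_one_right (by positivity) hZn)
  have e : F x π * t - bForm F x π Z - (F y π * t - bForm F y π Z) =
      (F x π - F y π) * t - (bForm F x π Z - bForm F y π Z) := by ring
  rw [e]
  refine (abs_sub _ _).trans ?_
  rw [abs_mul]
  have := mul_le_mul h2 ht (abs_nonneg _) (by positivity)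
  linarith

lemma norm_fderiv_dualOp_le (hm : 1 ≤ m) (hF : IsC2Integrand F r₀ Λ)
    (hv : VariationBound F r₀ lam) (hlam : 0 ≤ lam) {x : Amb m n}
    (hx : x ∈ ball (0 : Amb m n) r₀) {π : Submodule ℝ (Amb m n)} (hπ : Module.finrank ℝ π = m) :
    ‖fderiv ℝ (fun x => dualOp F x π) x‖ ≤ (m + n) ^ 2 * ((m + n + 1) * ((m + n) * lam)) := by
  have h1 := ((contDiffAt_dualOp hF hx hπ).differentiableAt (by simp)).hasFDerivAt
  refine h1.le_of_lip' (by positivity) ?_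
  filter_upwards [isOpen_ball.mem_nhds hx] with y hy
  refine (norm_dualOp_sub_le hm hF hv hlam hy hx hπ).trans (le_of_eq (by ring))

end

/-! ### The boundary as a graph over its tangent space -/

section Boundary

variable {Γ : Set (Amb m n)} {α r₀ κ : ℝ}

lemma rpow_two_mul_le {α ρ : ℝ} (h1 : α ≤ 1) (hρ : 0 ≤ ρ) :
    (2 * ρ) ^ α ≤ 2 * ρ ^ α := by
  rw [Real.mul_rpow zero_le_two hρ]
  refine mul_le_mul_of_nonneg_right ?_ (Real.rpow_nonneg hρ _)
  calc (2 : ℝ) ^ α ≤ 2 ^ (1 : ℝ) := Real.rpow_le_rpow_of_exponent_le one_le_two h1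
    _ = 2 := Real.rpow_one 2

/-- The component along N_0Γ is that along N_xΓ plus the effect of the tilt. As |x - y| < 2ρ and
(2ρ)^α ≤ 2 ρ^α, the secant bound contributes 2 and the tilt bound 1 to the factor 3. -/
lemma BoundaryAssumption.norm_normal_le (h : BoundaryAssumption Γ α r₀ κ) {ρ : ℝ}
    (hρ : ρ ≤ r₀) {x y : Amb m n} (hx : x ∈ Γ) (hxρ : ‖x‖ < ρ) (hy : y ∈ Γ) (hyρ : ‖y‖ < ρ) :
    ‖(tangentSpace Γ 0)ᗮ.starProjection (x - y)‖ ≤ 3 * κ * ρ ^ α * ‖x - y‖ := by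
  have hρ0 : 0 ≤ ρ := (norm_nonneg x).trans hxρ.le
  have hx' : x ∈ Γ ∩ ball 0 r₀ := ⟨hx, by simpa using hxρ.trans_le hρ⟩
  have hy' : y ∈ Γ ∩ ball 0 r₀ := ⟨hy, by simpa using hyρ.trans_le hρ⟩
  have h0' : (0 : Amb m n) ∈ Γ ∩ ball 0 r₀ := ⟨h.zero_mem, by simpa using h.r₀_pos⟩
  have h1 := h.secant x hx' y hy'
  have h2 := h.tilt 0 h0' x hx'
  have h3 := norm_starProjection_sub_apply_le (normalSpace Γ 0) (normalSpace Γ x) (x - y)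
  rw [zero_sub, norm_neg] at h2
  have h4 : ‖x - y‖ ^ (1 + α) = ‖x - y‖ * ‖x - y‖ ^ α := by
    rw [Real.rpow_add' (norm_nonneg _) (by linarith [h.α_pos]), Real.rpow_one]
  have h5 : ‖x - y‖ ^ α ≤ 2 * ρ ^ α := by
    refine (Real.rpow_le_rpow (norm_nonneg _) ?_ h.α_pos.le).trans
      (rpow_two_mul_le h.α_le hρ0)
    linarith [norm_sub_le x y]
  have h6 : ‖x‖ ^ α ≤ ρ ^ α := Real.rpow_le_rpow (norm_nonneg _) hxρ.le h.α_pos.le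
  have hκ := h.κ_nonneg
  change ‖(normalSpace Γ 0).starProjection (x - y)‖ ≤ _
  calc ‖(normalSpace Γ 0).starProjection (x - y)‖
      ≤ ‖(normalSpace Γ x).starProjection (x - y)‖ + planeDist (normalSpace Γ 0) (normalSpace Γ x) *
        ‖x - y‖ := by
        have := norm_sub_norm_le ((normalSpace Γ 0).starProjection (x - y))
          ((normalSpace Γ x).starProjection (x - y))
        linarith
    _ ≤ κ * (‖x - y‖ * (2 * ρ ^ α)) + κ * ρ ^ α * ‖x - y‖ := by
        refine add_le_add (h1.trans ?_) (mul_le_mul_of_nonneg_right (h2.trans ?_) (norm_nonneg _))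
        · rw [h4]; gcongr
        · gcongr
    _ = _ := by ring

lemma BoundaryAssumption.norm_normal_le_half (h : BoundaryAssumption Γ α r₀ κ) {x y : Amb m n}
    (hx : x ∈ Γ) (hxρ : ‖x‖ < r₀) (hy : y ∈ Γ) (hyρ : ‖y‖ < r₀) :
    ‖(tangentSpace Γ 0)ᗮ.starProjection (x - y)‖ ≤ 3 / 4 * ‖x - y‖ := by
  refine (h.norm_normal_le le_rfl hx hxρ hy hyρ).trans
    (mul_le_mul_of_nonneg_right ?_ (norm_nonneg _))
  linarith [h.small]

/-- Near the origin the deviation of `Γ` from its tangent space is a `C¹` map with a small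
Lipschitz constant. -/
lemma BoundaryAssumption.exists_deviation (h : BoundaryAssumption Γ α r₀ κ) :
    ∃ f : Amb m n → Amb m n, ContDiffOn ℝ 1 f (ball 0 (r₀ / 4)) ∧
      (∀ z ∈ Γ, ‖z‖ < r₀ / 4 → z - f z ∈ tangentSpace Γ 0) ∧
      ∀ ρ ≤ r₀ / 4, ∀ z ∈ ball (0 : Amb m n) ρ,
        ‖f z‖ ≤ 24 * κ * ρ ^ α * ρ ∧ ‖fderiv ℝ f z‖ ≤ 24 * κ * ρ ^ α := by
  have hg := h.graph
  have hN := fun ρ hρ x y hx hxρ hy hyρ => h.norm_normal_le (ρ := ρ) hρ (x := x) hx hxρ (y := y) hy hyρ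
  have hN' := fun x y hx hxρ hy hyρ => h.norm_normal_le_half (x := x) hx hxρ (y := y) hy hyρ
  have hS : ∀ z ∈ Γ ∩ ball 0 r₀, ‖(tangentSpace Γ 0)ᗮ.starProjection z‖ ≤ 1 / 4 * ‖z‖ := by
    intro z hz
    have h1 := h.secant 0 ⟨h.zero_mem, by simpa using h.r₀_pos⟩ z hz
    rw [zero_sub, norm_neg, map_neg, norm_neg, Real.rpow_add' (norm_nonneg _)
      (by linarith [h.α_pos]), Real.rpow_one] at h1
    have h2 : ‖z‖ ^ α ≤ r₀ ^ α :=
      Real.rpow_le_rpow (norm_nonneg _) (mem_ball_zero_iff.mp hz.2).le h.α_pos.le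
    have h3 : κ * (‖z‖ * ‖z‖ ^ α) ≤ κ * (‖z‖ * r₀ ^ α) := by
      have := h.κ_nonneg
      gcongr
    refine h1.trans (h3.trans ?_)
    have h4 := mul_le_mul_of_nonneg_right h.small.le (norm_nonneg z)
    linarith
  -- From here on the tangent space enters only through the graph property and the three estimates
  -- on its normal projection.
  generalize tangentSpace Γ 0 = W at hg hN hN' hS ⊢
  obtain ⟨D, γ, -, hD, hγ, -, hΓ⟩ := hg
  have hr₀ := h.r₀_pos
  let p : Amb m n →L[ℝ] W := W.orthogonalProjectionOnto
  have hpn : ∀ z, ‖p z‖ ≤ ‖z‖ := fun z => W.norm_orthogonalProjectionOnto_apply_le z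
  have hproj : ∀ (t : W) (v : Wᗮ), p ((t : Amb m n) + v) = t := by
    intro t v
    rw [map_add]
    simp [p]
  have hprojN : ∀ (t : W) (v : Wᗮ), Wᗮ.starProjection ((t : Amb m n) + v) = v := by
    intro t v
    have e1 : W.starProjection (t : Amb m n) = t := Submodule.starProjection_eq_self_iff.mpr t.2
    have e2 : Wᗮ.starProjection (v : Amb m n) = v := Submodule.starProjection_eq_self_iff.mpr v.2
    rw [map_add, e2, Submodule.starProjection_orthogonal_val, e1, sub_self, zero_add]
  have hmem : ∀ t ∈ D, (t : Amb m n) + γ t ∈ Γ ∩ ball 0 r₀ := by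
    intro t ht
    rw [hΓ]
    exact ⟨t, ht, by rw [zero_add]⟩
  have hlift : ∀ z ∈ Γ, ‖z‖ < r₀ → p z ∈ D ∧ z = (p z : Amb m n) + γ (p z) := by
    intro z hz hzr
    have : z ∈ Γ ∩ ball 0 r₀ := ⟨hz, by simpa using hzr⟩
    rw [hΓ] at this
    obtain ⟨t, ht, rfl⟩ := this
    rw [zero_add, hproj]
    exact ⟨ht, rfl⟩
  have h0 : (0 : W) ∈ D ∧ γ 0 = 0 := by
    have := hlift 0 h.zero_mem (by simpa using hr₀)
    rw [map_zero] at this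
    refine ⟨this.1, ?_⟩
    have e := this.2
    rw [Submodule.coe_zero, zero_add] at e
    exact Subtype.ext e.symm
  have hdiff : ∀ s ∈ D, ∀ t ∈ D, ((s : Amb m n) + γ s) - ((t : Amb m n) + γ t) =
      ((s - t : W) : Amb m n) + ((γ s - γ t : Wᗮ) : Amb m n) := by
    intro s _ t _
    push_cast
    abel
  -- The normal difference is at most 3/4 of the full difference; absorbing it leaves the Lipschitz
  -- constant 3.
  have hlip3 : ∀ s ∈ D, ∀ t ∈ D, ‖γ s - γ t‖ ≤ 3 * ‖s - t‖ := by
    intro s hs t ht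
    have h1 := hN' _ _ (hmem s hs).1 (by simpa using (hmem s hs).2)
      (hmem t ht).1 (by simpa using (hmem t ht).2)
    rw [hdiff s hs t ht, hprojN] at h1
    have h2 := norm_add_le ((s - t : W) : Amb m n) ((γ s - γ t : Wᗮ) : Amb m n)
    simp only [Submodule.norm_coe] at h1 h2
    linarith
  have hnorm : ∀ t ∈ D, ‖(t : Amb m n) + γ t‖ ≤ 2 * ‖t‖ := by
    intro t ht
    have hz := hS _ (hmem t ht)
    rw [hprojN] at hz
    have h2 := norm_add_le (t : Amb m n) (γ t : Amb m n)
    simp only [Submodule.norm_coe] at hz h2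
    linarith [norm_nonneg t]
  -- The domain D is only known to be open. It contains the ball because D is also relatively closed
  -- there: points of Γ over D ∩ ball lie in the compact set Γ ∩ closedBall 0 (r₀/2), whose
  -- projection is closed and contained in D.
  have hBD : ball (0 : W) (r₀ / 4) ⊆ D := by
    refine (convex_ball (0 : W) (r₀ / 4)).isPreconnected.subset_of_closure_inter_subset hD
      ⟨0, by simpa using hr₀, h0.1⟩ ?_
    set Z := p '' (Γ ∩ closedBall 0 (r₀ / 2)) with hZ
    have hZc : IsClosed Z := by
      refine IsCompact.isClosed (IsCompact.image ?_ p.continuous)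
      exact (isCompact_closedBall (0 : Amb m n) (r₀ / 2)).inter_left h.submanifold.1
    have hZD : Z ⊆ D := by
      rintro _ ⟨z, ⟨hz, hzr⟩, rfl⟩
      have : ‖z‖ ≤ r₀ / 2 := by simpa using hzr
      exact (hlift z hz (by linarith)).1
    have hDZ : D ∩ ball (0 : W) (r₀ / 4) ⊆ Z := by
      rintro t ⟨ht, htr⟩
      have htr' : ‖t‖ < r₀ / 4 := by simpa using htr
      refine ⟨(t : Amb m n) + γ t, ⟨(hmem t ht).1, ?_⟩, hproj t (γ t)⟩
      have := hnorm t ht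
      simp only [mem_closedBall, dist_zero_right]
      linarith
    rintro t ⟨htc, htr⟩
    refine hZD ((closure_minimal hDZ hZc) ?_)
    exact isOpen_ball.closure_inter ⟨htc, htr⟩
  let f : Amb m n → Amb m n := fun z => (γ (p z) : Amb m n)
  have hmaps : ∀ {ρ : ℝ} {z : Amb m n}, z ∈ ball (0 : Amb m n) ρ → ‖p z‖ < ρ := fun {ρ z} hz =>
    (hpn z).trans_lt (by simpa using hz)
  have hinD : ∀ {z : Amb m n}, z ∈ ball (0 : Amb m n) (r₀ / 4) → p z ∈ D := fun {z} hz =>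
    hBD (by simpa using hmaps hz)
  have hf : ContDiffOn ℝ 1 f (ball 0 (r₀ / 4)) := by
    have h1 : ContDiffOn ℝ 1 (fun z => γ (p z)) (ball 0 (r₀ / 4)) :=
      hγ.comp p.contDiff.contDiffOn fun z hz => hinD hz
    exact Wᗮ.subtypeL.contDiff.comp_contDiffOn h1
  -- The lifts have norm below 2ρ, and a difference of lifts is at most 1 + 3 = 4 times |z - w|.
  -- With (2ρ)^α ≤ 2 ρ^α the constant is 3 · 2 · 4 = 24.
  have hfl : ∀ ρ ≤ r₀ / 4, ∀ z ∈ ball (0 : Amb m n) ρ, ∀ w ∈ ball (0 : Amb m n) ρ,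
      ‖f z - f w‖ ≤ 24 * κ * ρ ^ α * ‖z - w‖ := by
    intro ρ hρ z hz w hw
    have hρ0 : 0 ≤ ρ := (norm_nonneg _).trans (hmaps hz).le
    have hzD := hinD (ball_subset_ball hρ hz)
    have hwD := hinD (ball_subset_ball hρ hw)
    have h1 := hN (2 * ρ) (by linarith) _ _ (hmem _ hzD).1
      ((hnorm _ hzD).trans_lt (by linarith [hmaps hz])) (hmem _ hwD).1
      ((hnorm _ hwD).trans_lt (by linarith [hmaps hw]))
    rw [hdiff _ hzD _ hwD, hprojN] at h1
    have h2 := norm_add_le ((p z - p w : W) : Amb m n) ((γ (p z) - γ (p w) : Wᗮ) : Amb m n)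
    have h3 := hlip3 _ hzD _ hwD
    have h4 : ‖p z - p w‖ ≤ ‖z - w‖ := by rw [← map_sub]; exact hpn _
    have e : ‖f z - f w‖ = ‖((γ (p z) - γ (p w) : Wᗮ) : Amb m n)‖ := rfl
    simp only [Submodule.norm_coe] at h1 h2 e
    have h5 : (2 * ρ) ^ α ≤ 2 * ρ ^ α := rpow_two_mul_le h.α_le hρ0
    rw [e]
    have hκ := h.κ_nonneg
    calc ‖γ (p z) - γ (p w)‖ ≤ 3 * κ * (2 * ρ) ^ α * (4 * ‖z - w‖) := by
          refine h1.trans (mul_le_mul_of_nonneg_left ?_ (by positivity))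
          linarith [norm_nonneg (z - w)]
      _ ≤ 3 * κ * (2 * ρ ^ α) * (4 * ‖z - w‖) := by gcongr
      _ = 24 * κ * ρ ^ α * ‖z - w‖ := by ring
  refine ⟨f, hf, ?_, ?_⟩
  · intro z hz hzr
    have := (hlift z hz (by linarith)).2
    have e : z - f z = p z := by
      rw [sub_eq_iff_eq_add]
      exact this
    rw [e]
    exact (p z).2
  · intro ρ hρ z hz
    have hzρ : ‖z‖ < ρ := by simpa using hz
    have hρ0 : 0 < ρ := (norm_nonneg z).trans_lt hzρ
    have hκ := h.κ_nonneg
    constructor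
    · have h1 := hfl ρ hρ z hz 0 (by simpa using hρ0)
      have e : f 0 = 0 := by
        simp only [f, map_zero, h0.2, Submodule.coe_zero]
      rw [e, sub_zero, sub_zero] at h1
      exact h1.trans (mul_le_mul_of_nonneg_left hzρ.le (by positivity))
    · have hd : DifferentiableAt ℝ f z :=
        (hf.contDiffAt (isOpen_ball.mem_nhds (ball_subset_ball hρ hz))).differentiableAt (by simp)
      refine hd.hasFDerivAt.le_of_lip' (by positivity) ?_
      filter_upwards [isOpen_ball.mem_nhds hz] with w hw
      exact hfl ρ hρ w hw z hz

end Boundary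

/-! ### Lipschitz graphs near a boundary point -/

section Density

variable {Γ : Set (Amb m n)} {α r₀ κ : ℝ} {ℓ : NNReal} {Ω : Set (EuclideanSpace ℝ (Fin m))}
  {u : EuclideanSpace ℝ (Fin m) → EuclideanSpace ℝ (Fin n)}

lemma norm_pair_sub_le (hu : LipschitzOnWith ℓ u Ω) {x y : EuclideanSpace ℝ (Fin m)} (hx : x ∈ Ω)
    (hy : y ∈ Ω) : ‖(pair x (u x) - pair y (u y) : Amb m n)‖ ≤ (1 + ℓ) * ‖x - y‖ := by
  rw [pair_sub_pair]
  refine (norm_pair_le _ _).trans ?_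
  have := hu.norm_sub_le hx hy
  linarith

lemma norm_sub_le_of_mem_closure_graphSet (hu : LipschitzOnWith ℓ u Ω) {a b : Amb m n}
    (ha : a ∈ closure (graphSet Ω u)) (hb : b ∈ closure (graphSet Ω u)) :
    ‖a - b‖ ≤ (1 + ℓ) * ‖base a - base b‖ := by
  have hbase : Continuous (base : Amb m n → _) := (baseL : Amb m n →L[ℝ] _).continuous
  have h1 : ∀ b ∈ graphSet Ω u, ∀ a ∈ closure (graphSet Ω u),
      ‖a - b‖ ≤ (1 + ℓ) * ‖base a - base b‖ := by
    rintro _ ⟨y, hy, rfl⟩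
    refine closure_minimal (t := {a : Amb m n | ‖a - pair y (u y)‖ ≤
      (1 + ℓ) * ‖base a - base (pair y (u y))‖}) ?_ ?_
    · rintro _ ⟨x, hx, rfl⟩
      simpa using norm_pair_sub_le hu hx hy
    · exact isClosed_le (by fun_prop) (by fun_prop)
  refine closure_minimal (s := graphSet Ω u) (t := {b : Amb m n | ‖a - b‖ ≤
    (1 + ℓ) * ‖base a - base b‖}) (fun b hb => h1 b hb a ha) ?_ hb
  exact isClosed_le (by fun_prop) (by fun_prop)

lemma norm_le_of_mem_closure_graphSet (hu : LipschitzOnWith ℓ u Ω)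
    (h0 : (0 : Amb m n) ∈ closure (graphSet Ω u)) {a : Amb m n}
    (ha : a ∈ closure (graphSet Ω u)) : ‖a‖ ≤ (1 + ℓ) * ‖base a‖ := by
  have h := norm_sub_le_of_mem_closure_graphSet hu ha h0
  have e : base (0 : Amb m n) = 0 := map_zero (baseL : Amb m n →L[ℝ] _)
  rwa [e, sub_zero, sub_zero] at h

/-- The closure of the graph is compact, so its projection to the base is closed and contains the
closure of Ω. -/
lemma exists_lift_of_mem_closure (hu : LipschitzOnWith ℓ u Ω) (hΩ : Ω ⊆ ball 0 r₀)
    (h0 : (0 : Amb m n) ∈ closure (graphSet Ω u)) {y : EuclideanSpace ℝ (Fin m)}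
    (hy : y ∈ closure Ω) : ∃ z ∈ closure (graphSet Ω u), base z = y := by
  have hbase : Continuous (base : Amb m n → _) := (baseL : Amb m n →L[ℝ] _).continuous
  have hbd : graphSet Ω u ⊆ closedBall 0 ((1 + ℓ) * r₀) := by
    intro z hz
    have h1 := norm_le_of_mem_closure_graphSet hu h0 (subset_closure hz)
    obtain ⟨x, hx, rfl⟩ := hz
    have hx' : ‖x‖ < r₀ := by simpa using hΩ hx
    rw [base_pair] at h1
    rw [mem_closedBall_zero_iff]
    exact h1.trans (mul_le_mul_of_nonneg_left hx'.le (by positivity))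
  have hc : IsCompact (closure (graphSet Ω u)) :=
    (isBounded_closedBall.subset hbd).isCompact_closure
  have hcl : IsClosed (base '' closure (graphSet Ω u)) := (hc.image hbase).isClosed
  have hsub : Ω ⊆ base '' closure (graphSet Ω u) := fun x hx =>
    ⟨pair x (u x), subset_closure ⟨x, hx, rfl⟩, base_pair _ _⟩
  exact closure_minimal hsub hcl hy

/-- The base projection of W has dimension at most m - 1, so some unit vector ν is orthogonal to it.
Pairing ν with the base of z then sees only the component of z normal to W. -/
lemma exists_unit_normal {W : Submodule ℝ (Amb m n)} (hW : Module.finrank ℝ W + 1 = m) :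
    ∃ ν : EuclideanSpace ℝ (Fin m), ‖ν‖ = 1 ∧
      ∀ z : Amb m n, |inner ℝ ν (base z)| ≤ ‖Wᗮ.starProjection z‖ := by
  set U := W.map (baseL : Amb m n →L[ℝ] EuclideanSpace ℝ (Fin m)).toLinearMap
  have hU : Uᗮ ≠ ⊥ := by
    intro h
    have h1 := Submodule.finrank_add_finrank_orthogonal U
    have h2 : Module.finrank ℝ U ≤ Module.finrank ℝ W := Submodule.finrank_map_le _ _
    rw [h, finrank_bot, finrank_euclideanSpace_fin] at h1
    omega
  obtain ⟨w, hw, hw0⟩ := Submodule.exists_mem_ne_zero_of_ne_bot hU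
  have hn : ‖w‖ ≠ 0 := norm_ne_zero_iff.mpr hw0
  refine ⟨(‖w‖)⁻¹ • w, ?_, fun z => ?_⟩
  · rw [norm_smul, norm_inv, norm_norm, inv_mul_cancel₀ hn]
  have h1 : ‖(‖w‖)⁻¹ • w‖ = 1 := by rw [norm_smul, norm_inv, norm_norm, inv_mul_cancel₀ hn]
  have hν : (‖w‖)⁻¹ • w ∈ Uᗮ := Uᗮ.smul_mem _ hw
  have h2 : base z = base (W.starProjection z) + base (Wᗮ.starProjection z) := by
    have h3 : z = W.starProjection z + Wᗮ.starProjection z := by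
      rw [Submodule.starProjection_orthogonal_val]; abel
    conv_lhs => rw [h3]
    exact map_add (baseL : Amb m n →L[ℝ] _) _ _
  have h3 : inner ℝ ((‖w‖)⁻¹ • w) (base (W.starProjection z)) = 0 :=
    Submodule.inner_left_of_mem_orthogonal
      (Submodule.mem_map_of_mem (W.starProjection_apply_mem z)) hν
  rw [h2, inner_add_right, h3, zero_add]
  refine (abs_real_inner_le_norm _ _).trans ?_
  rw [h1, one_mul]
  exact norm_base_le _

/-- Boundary points of Ω near 0 lift to Γ, so their differences make a small pairing with ν. Of the
two opposite cones around ν with vertex q in Ω, one therefore contains no boundary point in the ball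
of radius s; it is convex, meets Ω and hence lies in Ω. -/
lemma exists_ball_subset_domain (hΓ : BoundaryAssumption Γ α r₀ κ) (hΩo : IsOpen Ω)
    (hΩ : Ω ⊆ ball 0 r₀) (hu : LipschitzOnWith ℓ u Ω)
    (h0 : (0 : Amb m n) ∈ closure (graphSet Ω u))
    (hb : (closure (graphSet Ω u) \ graphSet Ω u) ∩ ball 0 r₀ ⊆ Γ) {s : ℝ} (hs : 0 < s)
    (hs₁ : (1 + ℓ) * s ≤ r₀) (hs₂ : 3 * κ * ((1 + ℓ) * s) ^ α * (1 + ℓ) ≤ 1 / 2) :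
    ∃ c, ball c (s / 16) ⊆ ball 0 s ∩ Ω := by
  have hbase : Continuous (base : Amb m n → _) := (baseL : Amb m n →L[ℝ] _).continuous
  obtain ⟨ν, hν, hνW⟩ := exists_unit_normal (hΓ.submanifold.2 0 hΓ.zero_mem).1
  obtain ⟨q, hq, hqs⟩ : ∃ q ∈ Ω, ‖q‖ < s / 4 := by
    have h1 : (0 : EuclideanSpace ℝ (Fin m)) ∈ closure Ω := by
      have h2 : base (0 : Amb m n) ∈ closure (base '' graphSet Ω u) :=
        image_closure_subset_closure_image hbase ⟨0, h0, rfl⟩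
      have h3 : base '' graphSet Ω u ⊆ Ω := by
        rintro _ ⟨_, ⟨x, hx, rfl⟩, rfl⟩
        simpa using hx
      have e : base (0 : Amb m n) = 0 := map_zero (baseL : Amb m n →L[ℝ] _)
      rw [e] at h2
      exact closure_mono h3 h2
    obtain ⟨q, hq, hqs⟩ := Metric.mem_closure_iff.mp h1 (s / 4) (by positivity)
    exact ⟨q, hq, by simpa using hqs⟩
  have hlift : ∀ y ∈ closure Ω \ Ω, ‖y‖ < s →
      ∃ z ∈ Γ, ‖z‖ < (1 + ℓ) * s ∧ z ∈ closure (graphSet Ω u) ∧ base z = y := by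
    rintro y ⟨hy, hyΩ⟩ hys
    obtain ⟨z, hz, rfl⟩ := exists_lift_of_mem_closure hu hΩ h0 hy
    have h1 : ‖z‖ < (1 + ℓ) * s := (norm_le_of_mem_closure_graphSet hu h0 hz).trans_lt
      (mul_lt_mul_of_pos_left hys (by positivity))
    refine ⟨z, hb ⟨⟨hz, ?_⟩, by simpa using h1.trans_le hs₁⟩, h1, hz, rfl⟩
    rintro ⟨x, hx, rfl⟩
    exact hyΩ (by simpa using hx)
  have hflat : ∀ a ∈ closure Ω \ Ω, ‖a‖ < s → ∀ b ∈ closure Ω \ Ω, ‖b‖ < s →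
      |inner ℝ ν (a - b)| ≤ 1 / 2 * ‖a - b‖ := by
    intro a ha has b hb hbs
    obtain ⟨x, hx, hxs, hxc, rfl⟩ := hlift a ha has
    obtain ⟨y, hy, hys, hyc, rfl⟩ := hlift b hb hbs
    have e : base x - base y = base (x - y) := (map_sub (baseL : Amb m n →L[ℝ] _) x y).symm
    have h1 := hΓ.norm_normal_le hs₁ hx hxs hy hys
    have h2 := norm_sub_le_of_mem_closure_graphSet hu hxc hyc
    have h3 := hνW (x - y)
    rw [← e] at h3
    have hκ := hΓ.κ_nonneg
    have h4 : 3 * κ * ((1 + ℓ) * s) ^ α * ‖x - y‖ ≤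
        3 * κ * ((1 + ℓ) * s) ^ α * ((1 + ℓ) * ‖base x - base y‖) :=
      mul_le_mul_of_nonneg_left h2 (by positivity)
    have h5 := mul_le_mul_of_nonneg_right hs₂ (norm_nonneg (base x - base y))
    linarith
  -- Boundary points a and b in the two opposite cones would give ⟨ν, a - b⟩ > (|a - q| + |b - q|) /
  -- 2 ≥ |a - b| / 2, against `hflat`.
  have hcone : ∃ ε : ℝ, |ε| = 1 ∧ ∀ a ∈ closure Ω \ Ω, ‖a‖ < s →
      ¬ (1 / 2 * ‖a - q‖ < ε * inner ℝ ν (a - q)) := by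
    by_contra hcon
    push Not at hcon
    obtain ⟨a, ha, has, haq⟩ := hcon 1 (by simp)
    obtain ⟨b, hb, hbs, hbq⟩ := hcon (-1) (by simp)
    have h1 := (le_abs_self _).trans (hflat a ha has b hb hbs)
    have e : a - b = (a - q) - (b - q) := by abel
    have h2 : inner ℝ ν (a - b) = inner ℝ ν (a - q) - inner ℝ ν (b - q) := by
      rw [e, inner_sub_right]
    have h3 : ‖a - b‖ ≤ ‖a - q‖ + ‖b - q‖ := by
      rw [e]; exact norm_sub_le _ _
    linarith
  obtain ⟨ε, hε, hcone⟩ := hcone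
  have hεε : ε * ε = 1 := by rw [← abs_mul_abs_self, hε, one_mul]
  set Q : Set (EuclideanSpace ℝ (Fin m)) :=
    ball 0 s ∩ {y | 1 / 2 * ‖y - q‖ < ε * inner ℝ ν (y - q)} with hQ
  have hQc : Convex ℝ Q := by
    refine (convex_ball 0 s).inter ?_
    intro x hx y hy a b ha hb hab
    simp only [mem_ofPred_eq] at hx hy ⊢
    have e : a • x + b • y - q = a • (x - q) + b • (y - q) := by
      have : q = (a + b) • q := by rw [hab, one_smul]
      conv_lhs => rw [this]
      module
    have h1 : ‖a • x + b • y - q‖ ≤ a * ‖x - q‖ + b * ‖y - q‖ := by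
      rw [e]
      refine (norm_add_le _ _).trans ?_
      rw [norm_smul, norm_smul, Real.norm_of_nonneg ha, Real.norm_of_nonneg hb]
    have h2 : inner ℝ ν (a • x + b • y - q) = a * inner ℝ ν (x - q) + b * inner ℝ ν (y - q) := by
      rw [e, inner_add_right, inner_smul_right, inner_smul_right]
    rw [h2]
    rcases ha.eq_or_lt with rfl | ha'
    · have hb1 : b = 1 := by linarith
      subst hb1
      linarith
    · have h3 := mul_lt_mul_of_pos_left hx ha'
      have h4 := mul_le_mul_of_nonneg_left hy.le hb
      linarith
  -- For |w| ≤ t/8 the cone condition holds because (t + t/8) / 2 < t - t/8. The choice t = s/2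
  -- below gives a ball of radius s/16, inside the ball of radius s because |q| < s/4.
  have hdir : ∀ t : ℝ, 0 < t → ∀ w : EuclideanSpace ℝ (Fin m), ‖w‖ ≤ t / 8 → ‖q‖ + t + ‖w‖ < s →
      q + (t * ε) • ν + w ∈ Q := by
    intro t ht w hw hts
    have hn : ‖(t * ε) • ν‖ = t := by
      rw [norm_smul, hν, mul_one, norm_mul, Real.norm_eq_abs, Real.norm_eq_abs, hε, mul_one,
        abs_of_pos ht]
    have e : q + (t * ε) • ν + w - q = (t * ε) • ν + w := by abel
    refine ⟨?_, ?_⟩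
    · rw [mem_ball_zero_iff]
      refine lt_of_le_of_lt ((norm_add_le _ _).trans (add_le_add_left (norm_add_le _ _) _)) ?_
      rwa [hn]
    · simp only [mem_ofPred_eq]
      rw [e, inner_add_right, inner_smul_right, real_inner_self_eq_norm_sq, hν, mul_add]
      have h1 : ε * (t * ε * 1 ^ 2) = t := by
        calc ε * (t * ε * 1 ^ 2) = t * (ε * ε) := by ring
          _ = t := by rw [hεε, mul_one]
      have h2 : ‖(t * ε) • ν + w‖ ≤ t + ‖w‖ := (norm_add_le _ _).trans (by rw [hn])
      have h3 : |ε * inner ℝ ν w| ≤ ‖w‖ := by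
        rw [abs_mul, hε, one_mul]
        simpa [hν] using abs_real_inner_le_norm ν w
      have h4 := neg_abs_le (ε * inner ℝ ν w)
      rw [h1]
      linarith
  -- Connectedness: Q meets the open set Ω close to the vertex q and contains no point of its
  -- boundary.
  have hQΩ : Q ⊆ Ω := by
    refine hQc.isPreconnected.subset_of_closure_inter_subset hΩo ?_ ?_
    · obtain ⟨δ, hδ, hδΩ⟩ := Metric.isOpen_iff.mp hΩo q hq
      set t := min (δ / 2) (s / 2) with ht
      have ht0 : 0 < t := by positivity
      have h1 := hdir t ht0 0 (by rw [norm_zero]; positivity)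
        (by rw [norm_zero]; linarith [min_le_right (δ / 2) (s / 2)])
      refine ⟨_, h1, hδΩ ?_⟩
      rw [add_zero, mem_ball, dist_eq_norm, add_sub_cancel_left, norm_smul, hν, mul_one, norm_mul,
        Real.norm_eq_abs, Real.norm_eq_abs, hε, mul_one, abs_of_pos ht0]
      linarith [min_le_left (δ / 2) (s / 2)]
    · rintro y ⟨hyc, hyQ⟩
      by_contra hyΩ
      exact hcone y ⟨hyc, hyΩ⟩ (by simpa using hyQ.1) hyQ.2
  refine ⟨q + (s / 2 * ε) • ν, fun y hy => ?_⟩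
  have hy' : ‖y - (q + (s / 2 * ε) • ν)‖ < s / 16 := by
    rwa [mem_ball, dist_eq_norm] at hy
  have h1 := hdir (s / 2) (by positivity) (y - (q + (s / 2 * ε) • ν)) (by linarith) (by linarith)
  rw [add_sub_cancel] at h1
  exact ⟨h1.1, hQΩ h1⟩

lemma volume_real_ball (c : EuclideanSpace ℝ (Fin m)) {s : ℝ} (hs : 0 < s) :
    volume.real (ball c s) = s ^ m * volume.real (ball (0 : EuclideanSpace ℝ (Fin m)) 1) := by
  rw [Measure.real, Measure.addHaar_ball_of_pos _ _ hs, ENNReal.toReal_mul,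
    ENNReal.toReal_ofReal (by positivity), finrank_euclideanSpace_fin, Measure.real]

/-- The domain of the graph is not thin near the origin. -/
lemma exists_volume_ratio (hα : 0 < α) (hr₀ : 0 < r₀) (κ : ℝ) (ℓ : NNReal) :
    ∃ C : ℝ, 0 < C ∧ ∀ (Γ : Set (Amb m n)) (Ω : Set (EuclideanSpace ℝ (Fin m)))
      (u : EuclideanSpace ℝ (Fin m) → EuclideanSpace ℝ (Fin n)),
      BoundaryAssumption Γ α r₀ κ → IsOpen Ω → Ω ⊆ ball 0 r₀ → LipschitzOnWith ℓ u Ω →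
      (0 : Amb m n) ∈ closure (graphSet Ω u) →
      (closure (graphSet Ω u) \ graphSet Ω u) ∩ ball 0 r₀ ⊆ Γ →
      ∀ r : ℝ, 0 < r → 4 * ((2 + 2 * ℓ) * r) < r₀ →
        0 < volume.real (ball 0 r ∩ Ω) ∧
        volume.real (ball 0 ((2 + 2 * ℓ) * r) ∩ Ω) ≤ C * volume.real (ball 0 r ∩ Ω) := by
  have hcont : ContinuousAt (fun s : ℝ => 3 * κ * ((1 + ℓ) * s) ^ α * (1 + ℓ)) 0 := by
    have h1 : ContinuousAt (fun s : ℝ => ((1 + ℓ) * s) ^ α) 0 :=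
      ContinuousAt.rpow_const (by fun_prop) (Or.inr hα.le)
    exact (h1.const_mul _).mul_const _
  have h1 : ∀ᶠ s : ℝ in 𝓝 0, 3 * κ * ((1 + ℓ) * s) ^ α * (1 + ℓ) < 1 / 2 :=
    hcont.eventually_lt continuousAt_const (by simp [Real.zero_rpow hα.ne'])
  have h2 : ∀ᶠ s : ℝ in 𝓝 0, (1 + ℓ) * s < r₀ :=
    ContinuousAt.eventually_lt (by fun_prop) continuousAt_const (by simpa using hr₀)
  obtain ⟨δ, hδ, hδ'⟩ := Metric.eventually_nhds_iff.mp (h1.and h2)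
  refine ⟨(16 * (2 + 2 * ℓ) * (1 + 2 * r₀ / δ)) ^ m, by positivity, ?_⟩
  intro Γ Ω u hΓ hΩo hΩ hu h0 hb r hr hrr
  -- The ball is found only at scales below δ. Since r < r₀, the loss for larger r is the bounded
  -- factor 1 + 2 r₀ / δ, which enters the constant.
  set s := min r (δ / 2) with hs
  have hs0 : 0 < s := by positivity
  have hsδ : dist s 0 < δ := by
    rw [Real.dist_eq, sub_zero, abs_of_pos hs0]
    linarith [min_le_right r (δ / 2)]
  obtain ⟨hs1, hs2⟩ := hδ' hsδ
  obtain ⟨c, hc⟩ := exists_ball_subset_domain hΓ hΩo hΩ hu h0 hb hs0 hs2.le hs1.le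
  set ω := volume.real (ball (0 : EuclideanSpace ℝ (Fin m)) 1) with hω
  have hω0 : 0 < ω := by
    rw [hω, Measure.real, ENNReal.toReal_pos_iff]
    exact ⟨measure_ball_pos _ _ one_pos, measure_ball_lt_top⟩
  have hfin : ∀ ρ, volume (ball (0 : EuclideanSpace ℝ (Fin m)) ρ ∩ Ω) ≠ ⊤ := fun ρ =>
    ((measure_mono inter_subset_left).trans_lt measure_ball_lt_top).ne
  have hlow : (s / 16) ^ m * ω ≤ volume.real (ball 0 r ∩ Ω) := by
    rw [← volume_real_ball c (by positivity)]
    refine measureReal_mono (hc.trans (inter_subset_inter_left _ ?_)) (hfin r)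
    exact ball_subset_ball (min_le_left _ _)
  refine ⟨lt_of_lt_of_le (by positivity) hlow, ?_⟩
  have hup : volume.real (ball 0 ((2 + 2 * ℓ) * r) ∩ Ω) ≤ ((2 + 2 * ℓ) * r) ^ m * ω := by
    rw [← volume_real_ball 0 (by positivity)]
    exact measureReal_mono inter_subset_left measure_ball_lt_top.ne
  have hrs : r ≤ (1 + 2 * r₀ / δ) * s := by
    rcases min_cases r (δ / 2) with ⟨h, -⟩ | ⟨h, -⟩
    · rw [hs, h]
      have : 0 ≤ 2 * r₀ / δ * r := by positivity
      linarith
    · rw [hs, h]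
      have e : (1 + 2 * r₀ / δ) * (δ / 2) = δ / 2 + r₀ := by field_simp
      rw [e]
      have : r ≤ (2 + 2 * ℓ) * r := by
        have : 0 ≤ (ℓ : ℝ) * r := by positivity
        linarith
      linarith
  calc _ ≤ ((2 + 2 * ℓ) * r) ^ m * ω := hup
    _ ≤ ((2 + 2 * ℓ) * ((1 + 2 * r₀ / δ) * s)) ^ m * ω := by gcongr
    _ = (16 * (2 + 2 * ℓ) * (1 + 2 * r₀ / δ)) ^ m * ((s / 16) ^ m * ω) := by
        rw [← mul_assoc ((16 * (2 + 2 * (ℓ : ℝ)) * (1 + 2 * r₀ / δ)) ^ m), ← mul_pow]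
        congr 2
        ring
    _ ≤ _ := mul_le_mul_of_nonneg_left hlow (by positivity)

end Density

/-! ### The weight measure of a Lipschitz graph -/

section Weight

variable {r₀ : ℝ} {ℓ : NNReal} {Ω : Set (EuclideanSpace ℝ (Fin m))}
  {u : EuclideanSpace ℝ (Fin m) → EuclideanSpace ℝ (Fin n)}

/-- The part of the domain over which the graph lies in the ball of radius `r₀`. -/
def graphDomain (Ω : Set (EuclideanSpace ℝ (Fin m)))
    (u : EuclideanSpace ℝ (Fin m) → EuclideanSpace ℝ (Fin n)) (r₀ : ℝ) :
    Set (EuclideanSpace ℝ (Fin m)) :=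
  Ω ∩ (fun y => (pair y (u y) : Amb m n)) ⁻¹' ball 0 r₀

lemma lipschitzOnWith_pair (hu : LipschitzOnWith ℓ u Ω) :
    LipschitzOnWith (1 + ℓ) (fun y => (pair y (u y) : Amb m n)) Ω :=
  LipschitzOnWith.of_dist_le_mul fun x hx y hy => by
    rw [dist_eq_norm, dist_eq_norm]
    exact_mod_cast norm_pair_sub_le hu hx hy

lemma lipschitzWith_base : LipschitzWith 1 (base : Amb m n → EuclideanSpace ℝ (Fin m)) :=
  LipschitzWith.of_dist_le_mul fun x y => by
    have e : base x - base y = base (x - y) := (map_sub (baseL : Amb m n →L[ℝ] _) x y).symm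
    rw [dist_eq_norm, dist_eq_norm, e, NNReal.coe_one, one_mul]
    exact norm_base_le _

lemma isOpen_graphDomain (hΩ : IsOpen Ω) (hu : LipschitzOnWith ℓ u Ω) (r₀ : ℝ) :
    IsOpen (graphDomain (n := n) Ω u r₀) :=
  (lipschitzOnWith_pair hu).continuousOn.isOpen_inter_preimage hΩ isOpen_ball

lemma measurableSet_graphSet (hΩ : IsOpen Ω) (hu : LipschitzOnWith ℓ u Ω) :
    MeasurableSet (graphSet Ω u) :=
  hΩ.measurableSet.image_of_continuousOn_injOn (lipschitzOnWith_pair hu).continuousOn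
    fun x _ y _ hxy => by simpa using congrArg base hxy

lemma ae_graphWeight (hΩ : IsOpen Ω) (hu : LipschitzOnWith ℓ u Ω) (r₀ : ℝ) :
    ∀ᵐ z ∂graphWeight Ω u r₀, z ∈ graphSet Ω u ∩ ball 0 r₀ :=
  ae_restrict_mem ((measurableSet_graphSet hΩ hu).inter measurableSet_ball)

lemma euclideanHausdorffMeasure_image_le {X Y : Type*} [MetricSpace X] [MeasurableSpace X]
    [BorelSpace X] [MetricSpace Y] [MeasurableSpace Y] [BorelSpace Y] {f : X → Y} {s : Set X}
    {c : NNReal} (hf : LipschitzOnWith c f s) (d : ℕ) :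
    (μHE[d] : Measure Y) (f '' s) ≤ (c : ENNReal) ^ d * (μHE[d] : Measure X) s := by
  have h := hf.hausdorffMeasure_image_le (d := d) (by positivity)
  rw [ENNReal.rpow_natCast] at h
  rw [Measure.euclideanHausdorffMeasure_def, Measure.euclideanHausdorffMeasure_def,
    Measure.smul_apply, Measure.smul_apply, ENNReal.smul_def, ENNReal.smul_def, smul_eq_mul,
    smul_eq_mul, mul_left_comm]
  gcongr

lemma aemeasurable_pair (hΩ : IsOpen Ω) (hu : LipschitzOnWith ℓ u Ω) (r₀ : ℝ) :
    AEMeasurable (fun y => (pair y (u y) : Amb m n))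
      (volume.restrict (graphDomain (n := n) Ω u r₀)) :=
  ((lipschitzOnWith_pair hu).continuousOn.mono inter_subset_left).aemeasurable
    (isOpen_graphDomain hΩ hu r₀).measurableSet

lemma map_pair_apply (hΩ : IsOpen Ω) (hu : LipschitzOnWith ℓ u Ω) (r₀ : ℝ) {s : Set (Amb m n)}
    (hs : MeasurableSet s) :
    (volume.restrict (graphDomain Ω u r₀)).map (fun y => (pair y (u y) : Amb m n)) s =
      volume (graphDomain Ω u r₀ ∩ (fun y => (pair y (u y) : Amb m n)) ⁻¹' s) := by
  rw [Measure.map_apply_of_aemeasurable (aemeasurable_pair hΩ hu r₀) hs,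
    Measure.restrict_apply' (isOpen_graphDomain hΩ hu r₀).measurableSet, inter_comm]

lemma image_graphDomain (s : Set (Amb m n)) :
    (fun y => (pair y (u y) : Amb m n)) ''
      (graphDomain Ω u r₀ ∩ (fun y => (pair y (u y) : Amb m n)) ⁻¹' s) =
      s ∩ (graphSet Ω u ∩ ball 0 r₀) := by
  ext z
  constructor
  · rintro ⟨y, ⟨⟨hy, hyb⟩, hys⟩, rfl⟩
    exact ⟨hys, ⟨y, hy, rfl⟩, hyb⟩
  · rintro ⟨hz, ⟨y, hy, rfl⟩, hb⟩
    exact ⟨y, ⟨⟨hy, hb⟩, hz⟩, rfl⟩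

/-- The base projection does not increase Hausdorff measure. Together with the converse bound from
the (1 + ℓ)-Lipschitz graph map, this replaces the area formula for nonnegative integrands. -/
lemma map_pair_le_graphWeight (hΩ : IsOpen Ω) (hu : LipschitzOnWith ℓ u Ω) (r₀ : ℝ) :
    (volume.restrict (graphDomain Ω u r₀)).map (fun y => (pair y (u y) : Amb m n)) ≤
      graphWeight Ω u r₀ := by
  refine Measure.le_iff.mpr fun s hs => ?_
  rw [map_pair_apply hΩ hu r₀ hs, graphWeight, Measure.restrict_apply hs, ← image_graphDomain]
  set A := graphDomain Ω u r₀ ∩ (fun y => (pair y (u y) : Amb m n)) ⁻¹' s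
  have h := euclideanHausdorffMeasure_image_le ((lipschitzWith_base (m := m) (n := n)).lipschitzOnWith
    (s := (fun y => (pair y (u y) : Amb m n)) '' A)) m
  have e : base '' ((fun y => (pair y (u y) : Amb m n)) '' A) = A := by
    rw [image_image]
    simp
  rwa [e, EuclideanSpace.euclideanHausdorffMeasure_eq_volume, ENNReal.coe_one, one_pow,
    one_mul] at h

lemma graphWeight_le_map_pair (hΩ : IsOpen Ω) (hu : LipschitzOnWith ℓ u Ω) (r₀ : ℝ) :
    graphWeight Ω u r₀ ≤ (((1 + ℓ) ^ m : NNReal) : ENNReal) •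
      (volume.restrict (graphDomain Ω u r₀)).map (fun y => (pair y (u y) : Amb m n)) := by
  refine Measure.le_iff.mpr fun s hs => ?_
  rw [Measure.smul_apply, map_pair_apply hΩ hu r₀ hs, graphWeight, Measure.restrict_apply hs,
    ← image_graphDomain, smul_eq_mul]
  have h := euclideanHausdorffMeasure_image_le ((lipschitzOnWith_pair (n := n) hu).mono
    (inter_subset_left.trans inter_subset_left :
      graphDomain Ω u r₀ ∩ (fun y => (pair y (u y) : Amb m n)) ⁻¹' s ⊆ Ω)) m
  rwa [EuclideanSpace.euclideanHausdorffMeasure_eq_volume, ← ENNReal.coe_pow] at h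

lemma isFiniteMeasure_graphWeight (hΩ : IsOpen Ω) (hΩr : Ω ⊆ ball 0 r₀)
    (hu : LipschitzOnWith ℓ u Ω) : IsFiniteMeasure (graphWeight Ω u r₀) := by
  have : IsFiniteMeasure (volume.restrict (graphDomain (n := n) Ω u r₀)) :=
    ⟨by
      rw [Measure.restrict_apply_univ]
      exact (measure_mono (inter_subset_left.trans hΩr)).trans_lt measure_ball_lt_top⟩
  refine ⟨lt_of_le_of_lt (graphWeight_le_map_pair hΩ hu r₀ univ) ?_⟩
  rw [Measure.smul_apply, smul_eq_mul]
  exact ENNReal.mul_lt_top ENNReal.coe_lt_top (measure_lt_top _ _)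

lemma integral_graphWeight (hΩ : IsOpen Ω) (hu : LipschitzOnWith ℓ u Ω) {r₀ : ℝ}
    {f : Amb m n → ℝ} (hf : Integrable f (graphWeight Ω u r₀)) (hf₀ : ∀ z, 0 ≤ f z) :
    IntegrableOn (fun y => f (pair y (u y))) (graphDomain Ω u r₀) ∧
    ∫ y in graphDomain Ω u r₀, f (pair y (u y)) ≤ ∫ z, f z ∂graphWeight Ω u r₀ ∧
    ∫ z, f z ∂graphWeight Ω u r₀ ≤ (1 + ℓ) ^ m * ∫ y in graphDomain Ω u r₀, f (pair y (u y)) := by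
  have h₁ := map_pair_le_graphWeight (n := n) hΩ hu r₀
  have h₂ := graphWeight_le_map_pair (n := n) hΩ hu r₀
  have hm := aemeasurable_pair (n := n) hΩ hu r₀
  have hf₁ := hf.mono_measure h₁
  refine ⟨(integrable_map_measure hf₁.aestronglyMeasurable hm).mp hf₁, ?_, ?_⟩
  · rw [← integral_map hm hf₁.aestronglyMeasurable]
    exact integral_mono_measure h₁ (ae_of_all _ hf₀) hf
  · rw [← integral_map hm hf₁.aestronglyMeasurable]
    refine (integral_mono_measure h₂ (ae_of_all _ hf₀)
      (hf₁.smul_measure ENNReal.coe_ne_top)).trans_eq ?_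
    rw [integral_smul_measure, ENNReal.coe_toReal, smul_eq_mul]
    push_cast
    rfl

lemma zero_mem_closure_graphSet (h : (0 : Amb m n) ∈ (graphWeight Ω u r₀).support) :
    (0 : Amb m n) ∈ closure (graphSet Ω u) := by
  rw [mem_closure_iff_nhds]
  intro U hU
  have h1 := (Measure.mem_support_iff_forall _).mp h _ (interior_mem_nhds.mpr hU)
  rw [graphWeight, Measure.restrict_apply isOpen_interior.measurableSet] at h1
  obtain ⟨z, hz, hzg, -⟩ := nonempty_of_measure_ne_zero h1.ne'
  exact ⟨z, interior_subset hz, hzg⟩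

end Weight

/-! ### The test field -/

lemma abs_bForm_le {F : Amb m n → Submodule ℝ (Amb m n) → ℝ} {r₀ Λ : ℝ}
    (hF : IsC2Integrand F r₀ Λ) {x : Amb m n} (hx : x ∈ ball (0 : Amb m n) r₀)
    {π : Submodule ℝ (Amb m n)} (hπ : Module.finrank ℝ π = m) (Y : Amb m n →L[ℝ] Amb m n) :
    |bForm F x π Y| ≤ (m + n + 1) * Λ * ‖Y‖ := by
  rw [bForm_eq hF hx hπ]
  have h1 := abs_integrand_le hF hx hπ
  have hΛ : 0 ≤ Λ := (abs_nonneg _).trans h1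
  have h2 := abs_trace_le (π.starProjection ∘L Y)
  rw [finrank_amb] at h2
  have h3 := abs_planeDeriv_inr_le hF hx hπ Y
  have h4 : ‖π.starProjection ∘L Y‖ ≤ ‖Y‖ := by
    refine (ContinuousLinearMap.opNorm_comp_le _ _).trans ?_
    exact mul_le_of_le_one_left (norm_nonneg _) (π.starProjection_norm_le)
  refine (abs_add_le _ _).trans ?_
  rw [abs_mul]
  rw [Nat.cast_add] at h2
  have h5 := mul_le_mul h1 (h2.trans (mul_le_mul_of_nonneg_left h4 (by positivity)))
    (abs_nonneg _) hΛ
  linarith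

/-- The form vanishes at A = L by `bForm_dualOp_comp`, so its Lipschitz dependence on the slope
produces the factor ‖A - L‖ that permits absorption. -/
lemma abs_bForm_dualOp_comp_le {F : Amb m n → Submodule ℝ (Amb m n) → ℝ} {r₀ Λ : ℝ}
    (hF : IsC2Integrand F r₀ Λ) {x : Amb m n} (hx : x ∈ ball (0 : Amb m n) r₀)
    (A L : EuclideanSpace ℝ (Fin m) →L[ℝ] EuclideanSpace ℝ (Fin n))
    (R : Amb m n →L[ℝ] Amb m n) :
    |bForm F x (graphPlane A) (dualOp F x (graphPlane L) ∘L R)| ≤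
      (3 * (m + n) + 2) * Λ * ((m + n) ^ 2 * ((m + n + 1) * Λ)) * ‖A - L‖ * ‖R‖ := by
  have h := abs_bForm_graphPlane_sub_le hF hx A L (dualOp F x (graphPlane L) ∘L R)
  rw [bForm_dualOp_comp hF hx (finrank_graphPlane L), sub_zero] at h
  have hΛ : 0 ≤ Λ := (abs_nonneg _).trans (abs_integrand_le hF hx (finrank_graphPlane L))
  have h1 := (ContinuousLinearMap.opNorm_comp_le (dualOp F x (graphPlane L)) R).trans
    (mul_le_mul_of_nonneg_right (norm_dualOp_le hF hx (finrank_graphPlane L)) (norm_nonneg R))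
  refine h.trans ((mul_le_mul_of_nonneg_left h1 (by positivity)).trans_eq ?_)
  ring

/-- The constant in front of the tilt in the first variation of the test field. -/
def tiltConst (m n : ℕ) (Λ : ℝ) : ℝ :=
  (3 * (m + n) + 2) * Λ * ((m + n) ^ 2 * ((m + n + 1) * Λ))

/-- The constant in front of the spatial variation of the integrand in the first variation of the
test field. -/
def spatialConst (m n : ℕ) (Λ : ℝ) : ℝ :=
  (m + n) * ((m + n) ^ 2 * ((m + n + 1) * Λ)) +
    (m + n + 1) * Λ * ((m + n) ^ 2 * ((m + n + 1) * (m + n)))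

/-- The terms are those of the derivative of the test field with p = φ, q = Dφ, R = Df and v = π^⊥(z
- f(z)). The scalar atomic condition gives the positive term, the terms with R and q gain a tilt
factor, and the two terms with a derivative in x are bounded by λ ‖v‖. -/
lemma le_variationDensity (hm : 1 ≤ m) {F : Amb m n → Submodule ℝ (Amb m n) → ℝ}
    {r₀ Λ K lam : ℝ} (hF : IsC2Integrand F r₀ Λ) (hU : USAC F r₀ K)
    (hv : VariationBound F r₀ lam) (hlam : 0 ≤ lam) {x : Amb m n}
    (hx : x ∈ ball (0 : Amb m n) r₀)
    (A L : EuclideanSpace ℝ (Fin m) →L[ℝ] EuclideanSpace ℝ (Fin n)) {p : ℝ} (hp : 0 ≤ p)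
    (hp₁ : p ≤ 1) (q : Amb m n →L[ℝ] ℝ) (R : Amb m n →L[ℝ] Amb m n) (v : Amb m n) :
    p ^ 2 * (K * planeDistSq (graphPlane A) (graphPlane L)) -
      p ^ 2 * (tiltConst m n Λ * ‖A - L‖ * ‖R‖) -
      2 * p * (tiltConst m n Λ * ‖A - L‖ * (‖q‖ * ‖v‖)) - spatialConst m n Λ * lam * ‖v‖ ≤
    variationDensity F x (graphPlane A) (p ^ 2 • dualOp F x (graphPlane L) v)
      (p ^ 2 • ((dualOp F x (graphPlane L) +
        (-1 : ℝ) • dualOp F x (graphPlane L) ∘L R) +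
        (fderiv ℝ (fun z => dualOp F z (graphPlane L)) x).flip v) +
        (2 * p) • dualOp F x (graphPlane L) ∘L q.smulRight v) := by
  set D := dualOp F x (graphPlane L)
  set D' := fderiv ℝ (fun z => dualOp F z (graphPlane L)) x
  have hL := finrank_graphPlane (n := n) L
  have hA := finrank_graphPlane (n := n) A
  have hΛ : 0 ≤ Λ := (abs_nonneg _).trans (abs_integrand_le hF hx hL)
  have hp2 : p ^ 2 ≤ 1 := pow_le_one₀ hp hp₁
  have h1 := hU.le_bForm hx hA hL
  have h2 := abs_bForm_dualOp_comp_le hF hx A L R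
  have h3 := abs_bForm_dualOp_comp_le hF hx A L (q.smulRight v)
  rw [ContinuousLinearMap.norm_smulRight_apply] at h3
  have h4 : |bForm F x (graphPlane A) (D'.flip v)| ≤
      (m + n + 1) * Λ * ((m + n) ^ 2 * ((m + n + 1) * (m + n))) * lam * ‖v‖ := by
    refine (abs_bForm_le hF hx hA _).trans ?_
    have h5 : ‖D'.flip v‖ ≤ (m + n) ^ 2 * ((m + n + 1) * ((m + n) * lam)) * ‖v‖ := by
      refine (D'.flip.le_opNorm v).trans ?_
      rw [ContinuousLinearMap.opNorm_flip]
      exact mul_le_mul_of_nonneg_right (norm_fderiv_dualOp_le hm hF hv hlam hx hL) (norm_nonneg _)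
    refine (mul_le_mul_of_nonneg_left h5 (by positivity)).trans_eq ?_
    ring
  have h5 : |planeDeriv F x (graphPlane A) (p ^ 2 • D v, 0)| ≤
      (m + n) * ((m + n) ^ 2 * ((m + n + 1) * Λ)) * lam * ‖v‖ := by
    refine (abs_planeDeriv_inl_le hm hF hv hlam hx hA _).trans ?_
    have h6 : ‖p ^ 2 • D v‖ ≤ (m + n) ^ 2 * ((m + n + 1) * Λ) * ‖v‖ := by
      rw [norm_smul, Real.norm_of_nonneg (by positivity)]
      refine (mul_le_of_le_one_left (norm_nonneg _) hp2).trans ?_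
      exact (D.le_opNorm v).trans
        (mul_le_mul_of_nonneg_right (norm_dualOp_le hF hx hL) (norm_nonneg _))
    refine (mul_le_mul_of_nonneg_left h6 (by positivity)).trans_eq ?_
    ring
  rw [variationDensity, bForm_add, bForm_smul, bForm_smul, bForm_add, bForm_add, bForm_smul]
  have h2' := mul_le_mul_of_nonneg_left (abs_le.mp h2).2 (sq_nonneg p)
  have h1' := mul_le_mul_of_nonneg_left h1 (sq_nonneg p)
  have h3' := mul_le_mul_of_nonneg_left (abs_le.mp h3).1 (by positivity : 0 ≤ 2 * p)
  have h5' := (abs_le.mp h5).1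
  have h4' : -((m + n + 1) * Λ * ((m + n) ^ 2 * ((m + n + 1) * (m + n))) * lam * ‖v‖) ≤
      p ^ 2 * bForm F x (graphPlane A) (D'.flip v) := by
    refine (abs_le.mp (le_trans ?_ h4)).1
    rw [abs_mul, abs_of_nonneg (sq_nonneg p)]
    exact mul_le_of_le_one_left (abs_nonneg _) hp2
  unfold tiltConst spatialConst
  linarith

/-- All cutoffs are rescalings of one bump function, which makes C independent of r. -/
lemma exists_cutoff (V : Type*) [NormedAddCommGroup V] [InnerProductSpace ℝ V]
    [FiniteDimensional ℝ V] : ∃ C : ℝ, 0 ≤ C ∧ ∀ r : ℝ, 0 < r → ∃ φ : V → ℝ,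
      ContDiff ℝ 1 φ ∧ (∀ z, 0 ≤ φ z ∧ φ z ≤ 1) ∧ (∀ z, ‖z‖ ≤ r → φ z = 1) ∧
      tsupport φ ⊆ closedBall 0 (3 / 2 * r) ∧ ∀ z, ‖fderiv ℝ φ z‖ ≤ C / r := by
  let f : ContDiffBump (0 : V) := ⟨1, 3 / 2, one_pos, by norm_num⟩
  have hf : ContDiff ℝ 1 (f : V → ℝ) := f.contDiff
  obtain ⟨C, hC⟩ := (f.hasCompactSupport.fderiv (𝕜 := ℝ)).exists_bound_of_continuous
    (hf.continuous_fderiv one_ne_zero)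
  refine ⟨C, (norm_nonneg _).trans (hC 0), fun r hr => ⟨fun z => f (r⁻¹ • z), ?_, ?_, ?_, ?_, ?_⟩⟩
  · exact hf.comp (contDiff_const_smul r⁻¹)
  · exact fun z => ⟨f.nonneg, f.le_one⟩
  · intro z hz
    refine f.one_of_mem_closedBall ?_
    rw [mem_closedBall_zero_iff, norm_smul, Real.norm_of_nonneg (by positivity)]
    rw [inv_mul_le_iff₀ hr]
    simpa [f] using hz
  · refine closure_minimal ?_ isClosed_closedBall
    intro z hz
    have h1 : r⁻¹ • z ∈ tsupport f := subset_tsupport _ hz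
    rw [f.tsupport_eq, mem_closedBall_zero_iff, norm_smul, Real.norm_of_nonneg (by positivity),
      inv_mul_le_iff₀ hr] at h1
    rw [mem_closedBall_zero_iff, mul_comm]
    exact h1
  · intro z
    have h1 : HasFDerivAt (fun z : V => f (r⁻¹ • z))
        ((fderiv ℝ f (r⁻¹ • z)).comp (r⁻¹ • ContinuousLinearMap.id ℝ V)) z :=
      HasFDerivAt.comp (g := f) (f := fun z : V => r⁻¹ • z) z ((hf.differentiable one_ne_zero) _).hasFDerivAt
        ((hasFDerivAt_id z).const_smul r⁻¹)
    rw [h1.fderiv, ContinuousLinearMap.comp_smul, norm_smul, ContinuousLinearMap.comp_id,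
      Real.norm_of_nonneg (by positivity), div_eq_inv_mul]
    exact mul_le_mul_of_nonneg_left (hC _) (by positivity)

lemma contDiff_sq_smul {V W : Type*} [NormedAddCommGroup V] [NormedSpace ℝ V]
    [NormedAddCommGroup W] [NormedSpace ℝ W] {φ : V → ℝ} {h : V → W} (hφ : ContDiff ℝ 1 φ)
    (hh : ∀ z ∈ tsupport φ, ContDiffAt ℝ 1 h z) : ContDiff ℝ 1 fun z => φ z ^ 2 • h z := by
  rw [contDiff_iff_contDiffAt]
  intro z
  by_cases hz : z ∈ tsupport φ
  · exact (hφ.contDiffAt.pow 2).smul (hh z hz)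
  · have h1 : (fun z => φ z ^ 2 • h z) =ᶠ[𝓝 z] fun _ => 0 := by
      filter_upwards [notMem_tsupport_iff_eventuallyEq.mp hz] with y hy
      simp [hy]
    exact contDiffAt_const.congr_of_eventuallyEq h1

lemma tsupport_sq_smul_subset {V W : Type*} [NormedAddCommGroup V]
    [NormedAddCommGroup W] [NormedSpace ℝ W] (φ : V → ℝ) (h : V → W) :
    tsupport (fun z => φ z ^ 2 • h z) ⊆ tsupport φ := by
  refine closure_mono fun z hz => ?_
  contrapose! hz
  have h1 : φ z = 0 := by simpa using hz
  simp [h1]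

/-- The constant in `tilt_absorption`. -/
def absorptionConst (k c₁ c₅ c₆ c₇ c₈ : ℝ) : ℝ :=
  c₁ ^ 2 * c₆ ^ 2 / k + (4 * (c₁ * c₈) ^ 2 / k + c₅) * (2 + 2 * c₇ ^ 2) + c₅

/-- In the application p = φ, τ = ‖A - L‖, d = ‖Df‖, q = ‖Dφ‖, v = |π^⊥(z - f(z))|, σ = |π^⊥ z| and
e = κ r^α. Each of the two terms linear in τ consumes a quarter of k (p τ)², which leaves half of
it. -/
lemma tilt_absorption {k c₁ c₅ c₆ c₇ c₈ p τ d q v e r σ lam S : ℝ} (hk : 0 < k) (hc₁ : 0 ≤ c₁)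
    (hc₅ : 0 ≤ c₅) (hp : 0 ≤ p) (hp₁ : p ≤ 1) (hτ : 0 ≤ τ) (hd₀ : 0 ≤ d)
    (hv₀ : 0 ≤ v) (hr : 0 < r) (hd : d ≤ c₆ * e) (hq : q ≤ c₈ / r)
    (hv : v ≤ σ + c₇ * e * r) (hS : k * τ ^ 2 ≤ S) :
    k / 2 * (p * τ) ^ 2 - absorptionConst k c₁ c₅ c₆ c₇ c₈ *
        ((σ / r) ^ 2 + e ^ 2 + (lam * r) ^ 2) ≤
      p ^ 2 * S - p ^ 2 * (c₁ * τ * d) - 2 * p * (c₁ * τ * (q * v)) - c₅ * lam * v := by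
  unfold absorptionConst
  obtain ⟨t, ht⟩ : ∃ t, t = v / r := ⟨_, rfl⟩
  have ht₀ : 0 ≤ t := by rw [ht]; positivity
  have hvt : v = t * r := by rw [ht]; field_simp
  have ht₁ : t ≤ σ / r + c₇ * e := by
    rw [ht, div_le_iff₀ hr, add_mul, div_mul_cancel₀ _ hr.ne']
    exact hv
  obtain ⟨x, hx⟩ : ∃ x, x = σ / r := ⟨_, rfl⟩
  rw [← hx] at ht₁ ⊢
  have ht₂ : t ^ 2 ≤ 2 * x ^ 2 + 2 * c₇ ^ 2 * e ^ 2 := by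
    have h1 : t ^ 2 ≤ (x + c₇ * e) ^ 2 := pow_le_pow_left₀ ht₀ ht₁ 2
    linarith [sq_nonneg (x - c₇ * e)]
  have ht₃ : t ^ 2 ≤ (2 + 2 * c₇ ^ 2) * (x ^ 2 + e ^ 2 + (lam * r) ^ 2) := by
    have : 0 ≤ c₇ ^ 2 * x ^ 2 + e ^ 2 + (1 + c₇ ^ 2) * (lam * r) ^ 2 := by positivity
    linarith
  have hd₂ : d ^ 2 ≤ c₆ ^ 2 * e ^ 2 := by
    rw [← mul_pow]; exact pow_le_pow_left₀ hd₀ hd 2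
  have hp2 : p ^ 2 ≤ 1 := pow_le_one₀ hp hp₁
  have h1 : p ^ 2 * (c₁ * τ * d) ≤ k / 4 * (p * τ) ^ 2 + c₁ ^ 2 / k * (c₆ ^ 2 * e ^ 2) := by
    have e1 : k / 4 * τ ^ 2 + c₁ ^ 2 / k * d ^ 2 - c₁ * τ * d = (k / 2 * τ - c₁ * d) ^ 2 / k := by
      field_simp; ring
    have e2 : 0 ≤ (k / 2 * τ - c₁ * d) ^ 2 / k := by positivity
    have e3 := mul_le_mul_of_nonneg_left (show c₁ * τ * d ≤ k / 4 * τ ^ 2 + c₁ ^ 2 / k * d ^ 2 by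
      linarith) (sq_nonneg p)
    have e4 : p ^ 2 * (c₁ ^ 2 / k * d ^ 2) ≤ c₁ ^ 2 / k * (c₆ ^ 2 * e ^ 2) :=
      (mul_le_of_le_one_left (by positivity) hp2).trans
        (mul_le_mul_of_nonneg_left hd₂ (by positivity))
    linarith
  have h2 : 2 * p * (c₁ * τ * (q * v)) ≤ k / 4 * (p * τ) ^ 2 + 4 * (c₁ * c₈) ^ 2 / k * t ^ 2 := by
    have e0 : q * v ≤ c₈ * t := by
      refine (mul_le_mul_of_nonneg_right hq hv₀).trans_eq ?_
      rw [ht]; ring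
    have e1 : k / 4 * (p * τ) ^ 2 + 4 * (c₁ * c₈) ^ 2 / k * t ^ 2 - 2 * p * (c₁ * τ * (c₈ * t)) =
        (k / 2 * (p * τ) - 2 * (c₁ * c₈) * t) ^ 2 / k := by
      field_simp; ring
    have e2 : 0 ≤ (k / 2 * (p * τ) - 2 * (c₁ * c₈) * t) ^ 2 / k := by positivity
    have e3 : 2 * p * (c₁ * τ * (q * v)) ≤ 2 * p * (c₁ * τ * (c₈ * t)) := by gcongr
    linarith
  -- There is no tilt factor here; the two scale-invariant quantities λ r and t = v / r are
  -- separated directly.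
  have h3 : c₅ * lam * v ≤ c₅ * ((lam * r) ^ 2 + t ^ 2) := by
    have e1 : c₅ * lam * v = c₅ * ((lam * r) * t) := by rw [hvt]; ring
    rw [e1]
    refine mul_le_mul_of_nonneg_left ?_ hc₅
    nlinarith [sq_nonneg (lam * r - t), sq_nonneg (lam * r), sq_nonneg t]
  have h4 := mul_le_mul_of_nonneg_left hS (sq_nonneg p)
  have h5 : (4 * (c₁ * c₈) ^ 2 / k + c₅) * t ^ 2 ≤ (4 * (c₁ * c₈) ^ 2 / k + c₅) *
      ((2 + 2 * c₇ ^ 2) * (x ^ 2 + e ^ 2 + (lam * r) ^ 2)) :=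
    mul_le_mul_of_nonneg_left ht₃ (by positivity)
  have h6 : 0 ≤ c₁ ^ 2 * c₆ ^ 2 / k * (x ^ 2 + (lam * r) ^ 2) + c₅ * (x ^ 2 + e ^ 2) := by
    positivity
  have h7 : c₁ ^ 2 / k * (c₆ ^ 2 * e ^ 2) = c₁ ^ 2 * c₆ ^ 2 / k * e ^ 2 := by ring
  linarith

lemma planeDistSq_eq (π σ : Submodule ℝ (Amb m n)) : planeDistSq π σ = planeDist π σ ^ 2 := by
  rw [planeDist, Real.sq_sqrt]
  exact Finset.sum_nonneg fun i _ => Finset.sum_nonneg fun j _ => sq_nonneg _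

/-- The test field in the Caccioppoli inequality: `z - f z` is the position corrected by the
deviation of the boundary from its tangent space, and `φ` is a cutoff function. -/
def testField (F : Amb m n → Submodule ℝ (Amb m n) → ℝ) (π : Submodule ℝ (Amb m n))
    (φ : Amb m n → ℝ) (f : Amb m n → Amb m n) (z : Amb m n) : Amb m n :=
  φ z ^ 2 • dualOp F z π (πᗮ.starProjection (z - f z))

section TestField

variable {F : Amb m n → Submodule ℝ (Amb m n) → ℝ} {r₀ Λ : ℝ} {π : Submodule ℝ (Amb m n)}
  {φ : Amb m n → ℝ} {f : Amb m n → Amb m n}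

lemma contDiff_testField (hF : IsC2Integrand F r₀ Λ) (hπ : Module.finrank ℝ π = m)
    (hφ : ContDiff ℝ 1 φ) {ρ : ℝ} (hρ : ρ ≤ r₀) (hφs : tsupport φ ⊆ ball 0 ρ)
    (hf : ContDiffOn ℝ 1 f (ball 0 ρ)) : ContDiff ℝ 1 (testField F π φ f) := by
  refine contDiff_sq_smul hφ fun z hz => ?_
  have h1 := contDiffAt_dualOp hF (ball_subset_ball hρ (hφs hz)) hπ
  have h2 : ContDiffAt ℝ 1 f z := hf.contDiffAt (isOpen_ball.mem_nhds (hφs hz))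
  exact h1.clm_apply ((πᗮ.starProjection.contDiff.contDiffAt).comp z (contDiffAt_id.sub h2))

lemma hasFDerivAt_sq_smul_clm_apply {V : Type*} [NormedAddCommGroup V] [NormedSpace ℝ V]
    {φ : V → ℝ} {φ' : V →L[ℝ] ℝ} {D : V → V →L[ℝ] V} {D' : V →L[ℝ] V →L[ℝ] V} {f : V → V}
    {f' : V →L[ℝ] V} (s : V →L[ℝ] V) {z : V} (hφ : HasFDerivAt φ φ' z) (hD : HasFDerivAt D D' z)
    (hf : HasFDerivAt f f' z) (hs : ∀ w, D z (s w) = D z w) :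
    HasFDerivAt (fun z => φ z ^ 2 • D z (s (z - f z)))
      (φ z ^ 2 • ((D z + (-1 : ℝ) • D z ∘L f') + D'.flip (s (z - f z))) +
        (2 * φ z) • D z ∘L φ'.smulRight (s (z - f z))) z := by
  have h1 : HasFDerivAt (fun z => s (z - f z)) (s ∘L (ContinuousLinearMap.id ℝ V - f')) z :=
    s.hasFDerivAt.comp z ((hasFDerivAt_id z).sub hf)
  have h2 := (hφ.pow 2).smul (hD.clm_apply h1)
  refine h2.congr_fderiv ?_
  ext w
  simp [hs, map_sub, smul_smul]
  module

lemma fderiv_testField (hF : IsC2Integrand F r₀ Λ) (hπ : Module.finrank ℝ π = m)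
    (hφ : ContDiff ℝ 1 φ) {ρ : ℝ} (hρ : ρ ≤ r₀) (hf : ContDiffOn ℝ 1 f (ball 0 ρ)) {z : Amb m n}
    (hz : z ∈ ball 0 ρ) :
    fderiv ℝ (testField F π φ f) z =
      φ z ^ 2 • ((dualOp F z π + (-1 : ℝ) • dualOp F z π ∘L fderiv ℝ f z) +
        (fderiv ℝ (fun z => dualOp F z π) z).flip (πᗮ.starProjection (z - f z))) +
        (2 * φ z) • dualOp F z π ∘L
          (fderiv ℝ φ z).smulRight (πᗮ.starProjection (z - f z)) := by
  have hz' : z ∈ ball 0 r₀ := ball_subset_ball hρ hz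
  refine (hasFDerivAt_sq_smul_clm_apply πᗮ.starProjection
    ((hφ.differentiable one_ne_zero) z).hasFDerivAt
    ((contDiffAt_dualOp hF hz' hπ).differentiableAt one_ne_zero).hasFDerivAt
    ((hf.contDiffAt (isOpen_ball.mem_nhds hz)).differentiableAt one_ne_zero).hasFDerivAt
    fun w => dualOp_comp_starProjection hF hz' hπ w).fderiv

lemma norm_testField_le (hF : IsC2Integrand F r₀ Λ) (hπ : Module.finrank ℝ π = m)
    {z : Amb m n} (hz : z ∈ ball 0 r₀) (hφ : 0 ≤ φ z) (hφ₁ : φ z ≤ 1) :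
    ‖testField F π φ f z‖ ≤
      (m + n) ^ 2 * ((m + n + 1) * Λ) * ‖πᗮ.starProjection (z - f z)‖ := by
  rw [testField, norm_smul, Real.norm_of_nonneg (by positivity)]
  refine (mul_le_of_le_one_left (norm_nonneg _) (pow_le_one₀ hφ hφ₁)).trans ?_
  exact (ContinuousLinearMap.le_opNorm _ _).trans
    (mul_le_mul_of_nonneg_right (norm_dualOp_le hF hz hπ) (norm_nonneg _))

end TestField

/-! ### The pointwise lower bound for the first variation -/

section Pointwise

variable {F : Amb m n → Submodule ℝ (Amb m n) → ℝ} {r₀ Λ K lam : ℝ} {ℓ : NNReal}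
  {φ : Amb m n → ℝ} {f : Amb m n → Amb m n}
  {A L : EuclideanSpace ℝ (Fin m) →L[ℝ] EuclideanSpace ℝ (Fin n)}

/-- The bounds on both slopes convert the coercivity in the distance of planes into coercivity in ‖A
- L‖. -/
lemma mul_sq_le_planeDistSq (hK : 0 ≤ K) (hA : ‖A‖ ≤ ℓ) (hL : ‖L‖ ≤ 2 * ℓ) :
    K / ((1 + 2 * ℓ) * (1 + ℓ)) ^ 2 * ‖A - L‖ ^ 2 ≤
      K * planeDistSq (graphPlane A) (graphPlane L) := by
  have h1 := norm_sub_le_planeDist A L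
  have h0 : 0 ≤ planeDist (graphPlane A) (graphPlane L) := Real.sqrt_nonneg _
  have h2 : ‖A - L‖ ≤ ((1 + 2 * ℓ) * (1 + ℓ)) * planeDist (graphPlane A) (graphPlane L) := by
    refine h1.trans ?_
    gcongr
  have h3 : ‖A - L‖ ^ 2 ≤
      ((1 + 2 * ℓ) * (1 + ℓ)) ^ 2 * planeDist (graphPlane A) (graphPlane L) ^ 2 := by
    rw [← mul_pow]
    exact pow_le_pow_left₀ (norm_nonneg _) h2 2
  rw [planeDistSq_eq, div_mul_eq_mul_div, div_le_iff₀ (by positivity)]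
  calc _ ≤ K * (((1 + 2 * ℓ) * (1 + ℓ)) ^ 2 * planeDist (graphPlane A) (graphPlane L) ^ 2) :=
        mul_le_mul_of_nonneg_left h3 hK
    _ = _ := by ring

/-- The scale-invariant error terms of the Caccioppoli inequality, except for the curvature. -/
def errorDensity (P : Submodule ℝ (Amb m n)) (r e lam : ℝ) (z : Amb m n) : ℝ :=
  (‖Pᗮ.starProjection z‖ / r) ^ 2 + e ^ 2 + (lam * r) ^ 2

lemma tilt_le_variationDensity (hm : 1 ≤ m) (hK : 0 < K) (hF : IsC2Integrand F r₀ Λ)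
    (hU : USAC F r₀ K) (hv : VariationBound F r₀ lam) (hlam : 0 ≤ lam) (hΛ : 0 ≤ Λ)
    (hA : ‖A‖ ≤ ℓ) (hL : ‖L‖ ≤ 2 * ℓ) {ρ r e c₆ c₇ c₈ : ℝ} (hr : 0 < r) (hρ : ρ ≤ r₀)
    (hφ : ContDiff ℝ 1 φ) (hφ₀ : ∀ z, 0 ≤ φ z ∧ φ z ≤ 1) (hφs : tsupport φ ⊆ ball 0 ρ)
    (hφ' : ∀ z, ‖fderiv ℝ φ z‖ ≤ c₈ / r) (hf : ContDiffOn ℝ 1 f (ball 0 ρ))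
    (hfb : ∀ z ∈ ball 0 ρ, ‖f z‖ ≤ c₇ * e * r ∧ ‖fderiv ℝ f z‖ ≤ c₆ * e)
    (z : Amb m n) :
    K / ((1 + 2 * ℓ) * (1 + ℓ)) ^ 2 / 2 * (φ z * ‖A - L‖) ^ 2 ≤
      variationDensity F z (graphPlane A) (testField F (graphPlane L) φ f z)
        (fderiv ℝ (testField F (graphPlane L) φ f) z) +
      absorptionConst (K / ((1 + 2 * ℓ) * (1 + ℓ)) ^ 2) (tiltConst m n Λ) (spatialConst m n Λ)
        c₆ c₇ c₈ * (ball 0 ρ).indicator (errorDensity (graphPlane L) r e lam) z := by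
  by_cases hz : z ∈ ball 0 ρ
  · have hπ := finrank_graphPlane (n := n) L
    rw [indicator_of_mem hz, fderiv_testField hF hπ hφ hρ hf hz, testField]
    have h1 := le_variationDensity hm hF hU hv hlam (ball_subset_ball hρ hz) A L (hφ₀ z).1
      (hφ₀ z).2 (fderiv ℝ φ z) (fderiv ℝ f z) ((graphPlane L)ᗮ.starProjection (z - f z))
    have h2 : ‖(graphPlane L)ᗮ.starProjection (z - f z)‖ ≤
        ‖(graphPlane L)ᗮ.starProjection z‖ + c₇ * e * r := by
      rw [map_sub]
      exact (norm_sub_le _ _).trans (add_le_add_right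
        ((norm_starProjection_apply_le' _ _).trans (hfb z hz).1) _)
    have h3 := tilt_absorption (k := K / ((1 + 2 * ℓ) * (1 + ℓ)) ^ 2) (c₁ := tiltConst m n Λ)
      (c₅ := spatialConst m n Λ) (lam := lam) (by positivity) (by unfold tiltConst; positivity)
      (by unfold spatialConst; positivity) (hφ₀ z).1 (hφ₀ z).2 (norm_nonneg (A - L))
      (norm_nonneg (fderiv ℝ f z)) (norm_nonneg _) hr (hfb z hz).2 (hφ' z) h2
      (mul_sq_le_planeDistSq hK.le hA hL)
    unfold errorDensity
    linarith
  -- Away from the support of φ the field and its derivative vanish, so both sides are zero.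
  · have h0 : z ∉ tsupport φ := fun h => hz (hφs h)
    have h1 : φ z = 0 := image_eq_zero_of_notMem_tsupport h0
    have h2 : fderiv ℝ (testField F (graphPlane L) φ f) z = 0 :=
      fderiv_of_notMem_tsupport ℝ fun h => h0 (tsupport_sq_smul_subset _ _ h)
    rw [indicator_of_notMem hz, h2, testField, h1, variationDensity]
    have h3 : bForm F z (graphPlane A) 0 = 0 := by
      have := bForm_smul F z (graphPlane A) 0 0
      have e0 : (0 : ℝ) • (0 : Amb m n →L[ℝ] Amb m n) = 0 := by ext; simp
      rwa [e0, zero_mul] at this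
    rw [h3]
    have h4 : ((0 : ℝ) ^ 2 • dualOp F z (graphPlane L)
        ((graphPlane L)ᗮ.starProjection (z - f z)), (0 : Amb m n →L[ℝ] Amb m n)) = 0 := by
      rw [zero_pow two_ne_zero, zero_smul]; rfl
    rw [h4, map_zero]
    simp

end Pointwise

/-! ### Integrability of the error terms on the base -/

section Integrability

variable {r₀ : ℝ} {ℓ : NNReal} {Ω : Set (EuclideanSpace ℝ (Fin m))}
  {u : EuclideanSpace ℝ (Fin m) → EuclideanSpace ℝ (Fin n)} {H : Amb m n → Amb m n}

lemma integrableOn_sq_curvatureAlong (hΩ : IsOpen Ω) (hu : LipschitzOnWith ℓ u Ω)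
    (hH : MemLp H 2 (graphWeight Ω u r₀)) :
    IntegrableOn (fun y => ‖curvatureAlong u r₀ H y‖ ^ 2) Ω := by
  have h1 : Integrable (fun z => ‖H z‖ ^ 2) (graphWeight Ω u r₀) :=
    hH.integrable_norm_pow two_ne_zero
  have h2 := (integral_graphWeight hΩ hu h1 fun z => by positivity).1
  have h3 := (integrable_indicator_iff (isOpen_graphDomain hΩ hu r₀).measurableSet).mpr h2
  refine h3.integrableOn.congr_fun (fun y hy => ?_) hΩ.measurableSet
  by_cases h : (pair y (u y) : Amb m n) ∈ ball 0 r₀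
  · rw [indicator_of_mem (show y ∈ graphDomain Ω u r₀ from ⟨hy, h⟩), curvatureAlong,
      indicator_of_mem h]
  · rw [indicator_of_notMem (fun h' => h h'.2), curvatureAlong, indicator_of_notMem h]
    simp

lemma norm_pair_le_of_zero_mem_closure (hu : LipschitzOnWith ℓ u Ω)
    (h0 : (0 : Amb m n) ∈ closure (graphSet Ω u)) {y : EuclideanSpace ℝ (Fin m)} (hy : y ∈ Ω) :
    ‖(pair y (u y) : Amb m n)‖ ≤ (1 + ℓ) * ‖y‖ := by
  have h := norm_le_of_mem_closure_graphSet hu h0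
    (subset_closure ⟨y, hy, rfl⟩ : (pair y (u y) : Amb m n) ∈ closure (graphSet Ω u))
  rwa [base_pair] at h

lemma integrableOn_sq_sub (hΩ : IsOpen Ω) (hΩr : Ω ⊆ ball 0 r₀) (hu : LipschitzOnWith ℓ u Ω)
    (h0 : (0 : Amb m n) ∈ closure (graphSet Ω u))
    (L : EuclideanSpace ℝ (Fin m) →L[ℝ] EuclideanSpace ℝ (Fin n)) :
    IntegrableOn (fun y => ‖u y - L y‖ ^ 2) Ω := by
  have : IsFiniteMeasure (volume.restrict Ω) :=
    ⟨by
      rw [Measure.restrict_apply_univ]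
      exact (measure_mono hΩr).trans_lt measure_ball_lt_top⟩
  have hc : ContinuousOn (fun y => ‖u y - L y‖ ^ 2) Ω :=
    ((hu.continuousOn.sub L.continuous.continuousOn).norm).pow 2
  refine Integrable.of_bound (hc.aestronglyMeasurable hΩ.measurableSet)
    (((1 + ℓ) * r₀ + ‖L‖ * r₀) ^ 2) ?_
  filter_upwards [ae_restrict_mem hΩ.measurableSet] with y hy
  have hy' : ‖y‖ ≤ r₀ := by simpa using (mem_ball.mp (hΩr hy)).le
  have h1 : ‖u y‖ ≤ (1 + ℓ) * r₀ := by
    have h2 : ‖u y‖ ≤ ‖(pair y (u y) : Amb m n)‖ := by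
      have := norm_pair_sq y (u y)
      exact abs_le_of_sq_le_sq' (by nlinarith [sq_nonneg ‖y‖]) (norm_nonneg _) |>.2
    exact (h2.trans (norm_pair_le_of_zero_mem_closure hu h0 hy)).trans
      (mul_le_mul_of_nonneg_left hy' (by positivity))
  have h3 : ‖L y‖ ≤ ‖L‖ * r₀ :=
    (L.le_opNorm y).trans (mul_le_mul_of_nonneg_left hy' (norm_nonneg _))
  rw [Real.norm_of_nonneg (by positivity)]
  exact pow_le_pow_left₀ (norm_nonneg _) ((norm_sub_le _ _).trans (add_le_add h1 h3)) 2

end Integrability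

/-! ### Testing the first variation on the graph -/

section Core

variable {F : Amb m n → Submodule ℝ (Amb m n) → ℝ} {Γ : Set (Amb m n)} {α r₀ κ Λ K lam : ℝ}
  {ℓ : NNReal} {Ω : Set (EuclideanSpace ℝ (Fin m))}
  {u : EuclideanSpace ℝ (Fin m) → EuclideanSpace ℝ (Fin n)} {H : Amb m n → Amb m n}
  {L : EuclideanSpace ℝ (Fin m) →L[ℝ] EuclideanSpace ℝ (Fin n)}
  {φ : Amb m n → ℝ} {f : Amb m n → Amb m n}

/-- The field has size at most a constant times r (|π^⊥ z| / r + c₇ e), so pairing it with H gives r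
|H| times a scale-invariant quantity, and the product is split into squares. -/
lemma abs_inner_testField_le (hF : IsC2Integrand F r₀ Λ) (hΛ : 0 ≤ Λ) {ρ r e c₇ : ℝ}
    (hr : 0 < r) (hρ : ρ ≤ r₀) (hφ₀ : ∀ z, 0 ≤ φ z ∧ φ z ≤ 1) (hφs : tsupport φ ⊆ ball 0 ρ)
    (hfb : ∀ z ∈ ball 0 ρ, ‖f z‖ ≤ c₇ * e * r) (lam : ℝ) (H : Amb m n → Amb m n) (z : Amb m n) :
    ‖inner ℝ (H z) (testField F (graphPlane L) φ f z)‖ ≤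
      (m + n) ^ 2 * ((m + n + 1) * Λ) * (2 + 2 * c₇ ^ 2) *
        (ball 0 ρ).indicator
          (fun z => errorDensity (graphPlane L) r e lam z + (r * ‖H z‖) ^ 2) z := by
  by_cases hz : z ∈ ball 0 ρ
  · rw [indicator_of_mem hz]
    have hN := norm_testField_le (f := f) hF (finrank_graphPlane L) (ball_subset_ball hρ hz)
      (hφ₀ z).1 (hφ₀ z).2
    set σ := ‖(graphPlane L)ᗮ.starProjection z‖ with hσ
    have h2 : ‖(graphPlane L)ᗮ.starProjection (z - f z)‖ ≤ σ + c₇ * e * r := by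
      rw [map_sub]
      exact (norm_sub_le _ _).trans (add_le_add_right
        ((norm_starProjection_apply_le' _ _).trans (hfb z hz)) _)
    have h3 : σ + c₇ * e * r = r * (σ / r + c₇ * e) := by field_simp
    rw [h3] at h2
    set x := σ / r
    set N : ℝ := (m + n) ^ 2 * ((m + n + 1) * Λ) with hNdef
    have hN0 : 0 ≤ N := by positivity
    refine (norm_inner_le_norm _ _).trans ?_
    calc ‖H z‖ * ‖testField F (graphPlane L) φ f z‖
        ≤ ‖H z‖ * (N * (r * (x + c₇ * e))) := by
          gcongr
          exact hN.trans (mul_le_mul_of_nonneg_left h2 hN0)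
      _ = N * ((r * ‖H z‖) * (x + c₇ * e)) := by ring
      _ ≤ N * ((2 + 2 * c₇ ^ 2) *
          (errorDensity (graphPlane L) r e lam z + (r * ‖H z‖) ^ 2)) := by
          refine mul_le_mul_of_nonneg_left ?_ hN0
          have e1 : errorDensity (graphPlane L) r e lam z = x ^ 2 + e ^ 2 + (lam * r) ^ 2 := rfl
          rw [e1]
          set h := r * ‖H z‖
          have e2 : 0 ≤ c₇ ^ 2 * x ^ 2 + e ^ 2 + (1 + c₇ ^ 2) * (lam * r) ^ 2 +
            c₇ ^ 2 * h ^ 2 := by positivity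
          linarith [sq_nonneg (h - (x + c₇ * e)), sq_nonneg (x - c₇ * e), sq_nonneg h,
            sq_nonneg (x + c₇ * e), sq_nonneg (lam * r), mul_nonneg (sq_nonneg c₇) (sq_nonneg h)]
      _ = _ := by ring
  · have h1 : φ z = 0 := image_eq_zero_of_notMem_tsupport fun h => hz (hφs h)
    rw [indicator_of_notMem hz, testField, h1, zero_pow two_ne_zero, zero_smul]
    simp

lemma errorDensity_nonneg (P : Submodule ℝ (Amb m n)) (r e lam : ℝ) (z : Amb m n) :
    0 ≤ errorDensity P r e lam z := by
  unfold errorDensity; positivity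

lemma continuous_errorDensity (P : Submodule ℝ (Amb m n)) (r e lam : ℝ) :
    Continuous (errorDensity P r e lam) := by
  unfold errorDensity; fun_prop

lemma integrable_errorDensity {μ : Measure (Amb m n)} [IsFiniteMeasure μ]
    (P : Submodule ℝ (Amb m n)) (ρ r e lam : ℝ) :
    Integrable ((ball 0 ρ).indicator (errorDensity P r e lam)) μ := by
  rw [integrable_indicator_iff measurableSet_ball]
  obtain ⟨C, hC⟩ := (isCompact_closedBall (0 : Amb m n) ρ).exists_bound_of_continuousOn
    (continuous_errorDensity P r e lam).continuousOn
  refine Integrable.of_bound (continuous_errorDensity P r e lam).aestronglyMeasurable C ?_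
  filter_upwards [ae_restrict_mem measurableSet_ball] with z hz
  exact hC z (ball_subset_closedBall hz)

/-- The pointwise lower bound is integrated over the graph. The integral of the first variation
density equals minus that of ⟨H, g⟩, since g vanishes on Γ, and is bounded by the same error terms
together with r² |H|². -/
lemma integral_tilt_le (hm : 1 ≤ m) (hK : 0 < K) (hΛ : 0 ≤ Λ) (hF : IsC2Integrand F r₀ Λ)
    (hU : USAC F r₀ K) (hlam : 0 ≤ lam) (hv : VariationBound F r₀ lam)
    (hG : GraphAssumption F Γ r₀ ℓ Ω u H) (hL : ‖L‖ ≤ 2 * ℓ) {ρ r e c₆ c₇ c₈ : ℝ} (hr : 0 < r)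
    (hρ : ρ ≤ r₀) (hφ : ContDiff ℝ 1 φ) (hφ₀ : ∀ z, 0 ≤ φ z ∧ φ z ≤ 1)
    (hφs : tsupport φ ⊆ ball 0 ρ) (hφ' : ∀ z, ‖fderiv ℝ φ z‖ ≤ c₈ / r)
    (hf : ContDiffOn ℝ 1 f (ball 0 ρ))
    (hfΓ : ∀ z ∈ Γ, z ∈ ball 0 ρ → z - f z ∈ graphPlane L)
    (hfb : ∀ z ∈ ball 0 ρ, ‖f z‖ ≤ c₇ * e * r ∧ ‖fderiv ℝ f z‖ ≤ c₆ * e) :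
    Integrable (fun z => (φ z * ‖fderiv ℝ u (base z) - L‖) ^ 2) (graphWeight Ω u r₀) ∧
    Integrable ((ball 0 ρ).indicator
      fun z => errorDensity (graphPlane L) r e lam z + (r * ‖H z‖) ^ 2) (graphWeight Ω u r₀) ∧
    K / ((1 + 2 * ℓ) * (1 + ℓ)) ^ 2 / 2 *
      ∫ z, (φ z * ‖fderiv ℝ u (base z) - L‖) ^ 2 ∂graphWeight Ω u r₀ ≤
      (absorptionConst (K / ((1 + 2 * ℓ) * (1 + ℓ)) ^ 2) (tiltConst m n Λ) (spatialConst m n Λ)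
        c₆ c₇ c₈ + (m + n) ^ 2 * ((m + n + 1) * Λ) * (2 + 2 * c₇ ^ 2)) *
      ∫ z, (ball 0 ρ).indicator
        (fun z => errorDensity (graphPlane L) r e lam z + (r * ‖H z‖) ^ 2) z
          ∂graphWeight Ω u r₀ := by
  set μ := graphWeight Ω u r₀ with hμ
  have := isFiniteMeasure_graphWeight (n := n) (r₀ := r₀) hG.isOpen hG.subset_ball hG.lipschitz
  have hae := ae_graphWeight (n := n) hG.isOpen hG.lipschitz r₀
  have hAm : Measurable fun z : Amb m n => fderiv ℝ u (base z) :=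
    (measurable_fderiv ℝ u).comp (baseL : Amb m n →L[ℝ] _).continuous.measurable
  have hAℓ : ∀ᵐ z ∂μ, ‖fderiv ℝ u (base z)‖ ≤ ℓ := by
    filter_upwards [hae] with z hz
    obtain ⟨⟨y, hy, rfl⟩, -⟩ := hz
    dsimp only
    rw [base_pair]
    exact norm_fderiv_le_of_lipschitzOn ℝ (hG.isOpen.mem_nhds hy) hG.lipschitz
  set g := testField F (graphPlane L) φ f with hg
  have hg1 : ContDiff ℝ 1 g := contDiff_testField hF (finrank_graphPlane L) hφ hρ hφs hf
  have hgs : tsupport g ⊆ tsupport φ := tsupport_sq_smul_subset _ _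
  have hgc : HasCompactSupport g :=
    (isCompact_closedBall (0 : Amb m n) ρ).of_isClosed_subset (isClosed_tsupport g)
      ((hgs.trans hφs).trans ball_subset_closedBall)
  have hgr : tsupport g ⊆ ball 0 r₀ := (hgs.trans hφs).trans (ball_subset_ball hρ)
  have hgΓ : ∀ z ∈ Γ, g z = 0 := by
    intro z hz
    by_cases hzρ : z ∈ ball 0 ρ
    · have h1 : (graphPlane L)ᗮ.starProjection (z - f z) = 0 := by
        rw [Submodule.starProjection_apply_eq_zero_iff, Submodule.orthogonal_orthogonal]
        exact hfΓ z hz hzρ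
      rw [hg, testField, h1, map_zero, smul_zero]
    · exact image_eq_zero_of_notMem_tsupport fun h => hzρ (hφs (hgs h))
  obtain ⟨hI, hV⟩ := hasFirstVariation hF (μ := μ) (hae.mono fun z hz => hz.2) hAm hAℓ hg1 hgc hgr
  -- Uniqueness of the derivative at t = 0 identifies the explicit first variation with the
  -- curvature integral.
  have hIeq := HasDerivAt.unique hV (hG.meanCurvature g hg1 hgc hgr hgΓ)
  have hW := integrable_errorDensity (μ := μ) (graphPlane L) ρ r e lam
  have hHi : Integrable ((ball 0 ρ).indicator fun z => (r * ‖H z‖) ^ 2) μ := by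
    refine Integrable.indicator ?_ measurableSet_ball
    simp_rw [mul_pow]
    exact (hG.memLp.integrable_norm_pow two_ne_zero).const_mul _
  have hJ : Integrable ((ball 0 ρ).indicator
      fun z => errorDensity (graphPlane L) r e lam z + (r * ‖H z‖) ^ 2) μ := by
    have := hW.add hHi
    rw [← indicator_add'] at this
    exact this
  have hJ0 : ∀ z, 0 ≤ (ball 0 ρ).indicator
      (fun z => errorDensity (graphPlane L) r e lam z + (r * ‖H z‖) ^ 2) z := fun z =>
    indicator_nonneg (fun z _ => add_nonneg (errorDensity_nonneg _ _ _ _ _) (sq_nonneg _)) z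
  have hτ : Integrable (fun z => (φ z * ‖fderiv ℝ u (base z) - L‖) ^ 2) μ := by
    have hmeas : Measurable fun z : Amb m n => (φ z * ‖fderiv ℝ u (base z) - L‖) ^ 2 :=
      (hφ.continuous.measurable.mul (hAm.sub_const L).norm).pow_const 2
    refine Integrable.of_bound hmeas.aestronglyMeasurable ((ℓ + ‖L‖) ^ 2) ?_
    filter_upwards [hAℓ] with z hz
    rw [Real.norm_of_nonneg (by positivity)]
    have h1 : ‖fderiv ℝ u (base z) - L‖ ≤ ℓ + ‖L‖ :=
      (norm_sub_le _ _).trans (add_le_add_left hz _)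
    refine pow_le_pow_left₀ (mul_nonneg (hφ₀ z).1 (norm_nonneg _)) ?_ 2
    exact (mul_le_of_le_one_left (norm_nonneg _) (hφ₀ z).2).trans h1
  refine ⟨hτ, hJ, ?_⟩
  set k := K / ((1 + 2 * (ℓ : ℝ)) * (1 + ℓ)) ^ 2 with hk
  have hk0 : 0 < k := by positivity
  set C₁ := absorptionConst k (tiltConst m n Λ) (spatialConst m n Λ) c₆ c₇ c₈ with hC₁
  have hC₁0 : 0 ≤ C₁ := by
    have h1 : 0 ≤ spatialConst m n Λ := by unfold spatialConst; positivity
    rw [hC₁]; unfold absorptionConst; positivity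
  set C₂ : ℝ := (m + n) ^ 2 * ((m + n + 1) * Λ) * (2 + 2 * c₇ ^ 2) with hC₂
  have hbound : ∫ z, variationDensity F z (graphPlane (fderiv ℝ u (base z))) (g z)
      (fderiv ℝ g z) ∂μ ≤ C₂ * ∫ z, (ball 0 ρ).indicator
        (fun z => errorDensity (graphPlane L) r e lam z + (r * ‖H z‖) ^ 2) z ∂μ := by
    rw [hIeq, ← integral_const_mul]
    refine (neg_le_abs _).trans ?_
    refine (norm_integral_le_of_norm_le (hJ.const_mul C₂).integrableOn
      (ae_of_all _ fun z => abs_inner_testField_le hF hΛ hr hρ hφ₀ hφs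
        (fun z hz => (hfb z hz).1) lam H z)).trans ?_
    refine setIntegral_le_integral (hJ.const_mul C₂) (ae_of_all _ fun z => ?_)
    exact mul_nonneg (by positivity) (hJ0 z)
  calc k / 2 * ∫ z, (φ z * ‖fderiv ℝ u (base z) - L‖) ^ 2 ∂μ
      = ∫ z, k / 2 * (φ z * ‖fderiv ℝ u (base z) - L‖) ^ 2 ∂μ := (integral_const_mul _ _).symm
    _ ≤ ∫ z, (variationDensity F z (graphPlane (fderiv ℝ u (base z))) (g z) (fderiv ℝ g z) +
          C₁ * (ball 0 ρ).indicator (errorDensity (graphPlane L) r e lam) z) ∂μ := by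
        refine integral_mono_ae (hτ.const_mul _) (hI.add (hW.const_mul _)) ?_
        filter_upwards [hAℓ] with z hz
        exact tilt_le_variationDensity hm hK hF hU hv hlam hΛ hz hL hr hρ hφ hφ₀ hφs hφ' hf hfb z
    _ = ∫ z, variationDensity F z (graphPlane (fderiv ℝ u (base z))) (g z) (fderiv ℝ g z) ∂μ +
          C₁ * ∫ z, (ball 0 ρ).indicator (errorDensity (graphPlane L) r e lam) z ∂μ := by
        rw [integral_add hI (hW.const_mul _), integral_const_mul]
    _ ≤ C₂ * (∫ z, (ball 0 ρ).indicator
          (fun z => errorDensity (graphPlane L) r e lam z + (r * ‖H z‖) ^ 2) z ∂μ) +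
        C₁ * ∫ z, (ball 0 ρ).indicator
          (fun z => errorDensity (graphPlane L) r e lam z + (r * ‖H z‖) ^ 2) z ∂μ := by
        refine add_le_add hbound (mul_le_mul_of_nonneg_left (integral_mono hW hJ fun z => ?_) hC₁0)
        exact indicator_le_indicator (le_add_of_nonneg_right (sq_nonneg _))
    _ = _ := by ring

end Core

/-! ### Passage from the graph to the base -/

section Base

variable {F : Amb m n → Submodule ℝ (Amb m n) → ℝ} {Γ : Set (Amb m n)} {α r₀ κ Λ K : ℝ}
  {ℓ : NNReal} {Ω : Set (EuclideanSpace ℝ (Fin m))}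
  {u : EuclideanSpace ℝ (Fin m) → EuclideanSpace ℝ (Fin n)} {H : Amb m n → Amb m n}

lemma range_graphProj_le (L : EuclideanSpace ℝ (Fin m) →L[ℝ] EuclideanSpace ℝ (Fin n)) :
    LinearMap.range (graphProj L).toLinearMap ≤ graphPlane L := by
  rintro _ ⟨z, rfl⟩
  exact ⟨_, rfl⟩

/-- The error terms of the Caccioppoli inequality as a function on the base. -/
def baseErrorDensity (u : EuclideanSpace ℝ (Fin m) → EuclideanSpace ℝ (Fin n)) (r₀ : ℝ)
    (H : Amb m n → Amb m n) (L : EuclideanSpace ℝ (Fin m) →L[ℝ] EuclideanSpace ℝ (Fin n))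
    (r e lam : ℝ) (y : EuclideanSpace ℝ (Fin m)) : ℝ :=
  1 / r ^ 2 * ‖u y - L y‖ ^ 2 + r ^ 2 * ‖curvatureAlong u r₀ H y‖ ^ 2 +
    (e ^ 2 + lam ^ 2 * r ^ 2)

lemma baseErrorDensity_nonneg (L : EuclideanSpace ℝ (Fin m) →L[ℝ] EuclideanSpace ℝ (Fin n))
    (r e lam : ℝ) (y : EuclideanSpace ℝ (Fin m)) : 0 ≤ baseErrorDensity u r₀ H L r e lam y := by
  unfold baseErrorDensity; positivity

lemma norm_starProjection_graphPlane_pair_le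
    (L : EuclideanSpace ℝ (Fin m) →L[ℝ] EuclideanSpace ℝ (Fin n))
    (x : EuclideanSpace ℝ (Fin m)) (y : EuclideanSpace ℝ (Fin n)) :
    ‖(graphPlane L)ᗮ.starProjection (pair x y)‖ ≤ ‖y - L x‖ := by
  have h := norm_starProjection_orthogonal_le (U := graphPlane L) (w := graphMap L x) ⟨x, rfl⟩
    (pair x y)
  rwa [graphMap_apply, pair_sub_pair, sub_self, norm_pair_zero] at h

lemma integrableOn_baseErrorDensity (hG : GraphAssumption F Γ r₀ ℓ Ω u H)
    (L : EuclideanSpace ℝ (Fin m) →L[ℝ] EuclideanSpace ℝ (Fin n)) (r e lam ρ : ℝ) :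
    IntegrableOn (fun y => ‖u y - L y‖ ^ 2) (ball 0 ρ ∩ Ω) ∧
    IntegrableOn (fun y => ‖curvatureAlong u r₀ H y‖ ^ 2) (ball 0 ρ ∩ Ω) ∧
    IntegrableOn (fun _ => e ^ 2 + lam ^ 2 * r ^ 2) (ball (0 : EuclideanSpace ℝ (Fin m)) ρ ∩ Ω) :=
  ⟨(integrableOn_sq_sub hG.isOpen hG.subset_ball hG.lipschitz
      (zero_mem_closure_graphSet hG.zero_mem_support) L).mono_set inter_subset_right,
    (integrableOn_sq_curvatureAlong hG.isOpen hG.lipschitz hG.memLp).mono_set inter_subset_right,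
    integrableOn_const (measure_ne_top_of_subset inter_subset_left measure_ball_lt_top.ne)⟩

/-- A graph point in the ball of radius ρ has its base in the ball of radius ρ, and its distance to
the plane of L is at most the vertical distance |u(y) - L y|. -/
lemma integral_errorDensity_le (hG : GraphAssumption F Γ r₀ ℓ Ω u H)
    (L : EuclideanSpace ℝ (Fin m) →L[ℝ] EuclideanSpace ℝ (Fin n)) {ρ r e lam : ℝ} (hr : 0 < r)
    (hJ : Integrable ((ball 0 ρ).indicator
      fun z => errorDensity (graphPlane L) r e lam z + (r * ‖H z‖) ^ 2) (graphWeight Ω u r₀)) :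
    ∫ z, (ball 0 ρ).indicator
        (fun z => errorDensity (graphPlane L) r e lam z + (r * ‖H z‖) ^ 2) z
          ∂graphWeight Ω u r₀ ≤
      (1 + ℓ) ^ m * ∫ y in ball 0 ρ ∩ Ω, baseErrorDensity u r₀ H L r e lam y := by
  have hm := (isOpen_graphDomain (n := n) hG.isOpen hG.lipschitz r₀).measurableSet
  obtain ⟨h1, -, h3⟩ := integral_graphWeight hG.isOpen hG.lipschitz hJ fun z =>
    indicator_nonneg (fun z _ => add_nonneg (errorDensity_nonneg _ _ _ _ _) (sq_nonneg _)) z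
  obtain ⟨i1, i2, i3⟩ := integrableOn_baseErrorDensity hG L r e lam ρ
  have hQ : IntegrableOn (baseErrorDensity u r₀ H L r e lam) (ball 0 ρ ∩ Ω) :=
    ((i1.const_mul _).add (i2.const_mul _)).add i3
  refine h3.trans (mul_le_mul_of_nonneg_left ?_ (by positivity))
  have hQi : IntegrableOn ((ball 0 ρ).indicator (baseErrorDensity u r₀ H L r e lam))
      (graphDomain (n := n) Ω u r₀) := by
    rw [IntegrableOn, integrable_indicator_iff measurableSet_ball, IntegrableOn,
      Measure.restrict_restrict measurableSet_ball]
    exact hQ.mono_set (inter_subset_inter_right _ inter_subset_left)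
  refine (setIntegral_mono_on h1 hQi hm fun y hy => ?_).trans ?_
  · by_cases h : (pair y (u y) : Amb m n) ∈ ball 0 ρ
    · have hyρ : y ∈ ball (0 : EuclideanSpace ℝ (Fin m)) ρ := by
        rw [mem_ball_zero_iff] at h ⊢
        exact (norm_le_norm_pair_left _ _).trans_lt h
      rw [indicator_of_mem h, indicator_of_mem hyρ, baseErrorDensity, errorDensity,
        curvatureAlong,
        indicator_of_mem (show (pair y (u y) : Amb m n) ∈ ball 0 r₀ from hy.2)]
      have h4 := div_le_div_of_nonneg_right
        (norm_starProjection_graphPlane_pair_le L y (u y)) hr.le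
      have h5 := pow_le_pow_left₀ (by positivity) h4 2
      rw [div_pow ‖u y - L y‖, div_eq_inv_mul (‖u y - L y‖ ^ 2), ← one_div] at h5
      rw [mul_pow, mul_pow]
      linarith
    · rw [indicator_of_notMem h]
      exact indicator_nonneg (fun y _ => baseErrorDensity_nonneg _ _ _ _ y) y
  · rw [setIntegral_indicator measurableSet_ball]
    refine setIntegral_mono_set hQ (ae_of_all _ fun y => baseErrorDensity_nonneg _ _ _ _ y)
      (LE.le.eventuallyLE ?_)
    exact fun y hy => ⟨hy.2, hy.1.1⟩

/-- Because 0 lies in the closure of the graph, the graph over the ball of radius r stays within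
radius (1 + ℓ) r, where φ = 1. -/
lemma setIntegral_tilt_le (hG : GraphAssumption F Γ r₀ ℓ Ω u H)
    (L : EuclideanSpace ℝ (Fin m) →L[ℝ] EuclideanSpace ℝ (Fin n)) {r : ℝ}
    (hr : (1 + ℓ) * r ≤ r₀) {φ : Amb m n → ℝ} (hφ : ∀ z, ‖z‖ ≤ (1 + ℓ) * r → φ z = 1)
    (hτ : Integrable (fun z => (φ z * ‖fderiv ℝ u (base z) - L‖) ^ 2) (graphWeight Ω u r₀)) :
    ∫ y in ball 0 r ∩ Ω, ‖fderiv ℝ u y - L‖ ^ 2 ≤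
      ∫ z, (φ z * ‖fderiv ℝ u (base z) - L‖) ^ 2 ∂graphWeight Ω u r₀ := by
  obtain ⟨h1, h2, -⟩ := integral_graphWeight hG.isOpen hG.lipschitz hτ fun z => by positivity
  have hle : ∀ y ∈ ball 0 r ∩ Ω, ‖(pair y (u y) : Amb m n)‖ < (1 + ℓ) * r := fun y hy =>
    (norm_pair_le_of_zero_mem_closure hG.lipschitz
      (zero_mem_closure_graphSet hG.zero_mem_support) hy.2).trans_lt
      (mul_lt_mul_of_pos_left (by simpa using hy.1) (by positivity))
  refine le_trans ?_ h2
  have e : ∫ y in ball 0 r ∩ Ω, ‖fderiv ℝ u y - L‖ ^ 2 =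
      ∫ y in ball 0 r ∩ Ω, (φ (pair y (u y)) * ‖fderiv ℝ u (base (pair y (u y) : Amb m n)) - L‖) ^ 2 := by
    refine setIntegral_congr_fun (measurableSet_ball.inter hG.isOpen.measurableSet) fun y hy => ?_
    rw [hφ _ (hle y hy).le, one_mul, base_pair]
  rw [e]
  refine setIntegral_mono_set h1 (ae_of_all _ fun y => sq_nonneg _)
    (LE.le.eventuallyLE fun y hy => ⟨hy.2, ?_⟩)
  exact mem_ball_zero_iff.mpr ((hle y hy).trans_le hr)

/-- The Caccioppoli inequality before averaging. -/
lemma exists_setIntegral_tilt_le (hm : 1 ≤ m) (hΓ : BoundaryAssumption Γ α r₀ κ) (hΛ : 0 ≤ Λ)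
    (hK : 0 < K) (ℓ : NNReal) :
    ∃ C : ℝ, 0 < C ∧ ∀ (F : Amb m n → Submodule ℝ (Amb m n) → ℝ) (lam : ℝ),
      IsC2Integrand F r₀ Λ → USAC F r₀ K → 0 ≤ lam → VariationBound F r₀ lam →
      ∀ (Ω : Set (EuclideanSpace ℝ (Fin m)))
        (u : EuclideanSpace ℝ (Fin m) → EuclideanSpace ℝ (Fin n)) (H : Amb m n → Amb m n),
        GraphAssumption F Γ r₀ ℓ Ω u H →
      ∀ L : EuclideanSpace ℝ (Fin m) →L[ℝ] EuclideanSpace ℝ (Fin n),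
        tangentSpace Γ 0 ≤ graphPlane L → ‖L‖ ≤ 2 * ℓ →
      ∀ r : ℝ, 0 < r → 4 * ((2 + 2 * ℓ) * r) < r₀ →
        ∫ y in ball 0 r ∩ Ω, ‖fderiv ℝ u y - L‖ ^ 2 ≤
          C * ∫ y in ball 0 ((2 + 2 * ℓ) * r) ∩ Ω,
            baseErrorDensity u r₀ H L r (κ * r ^ α) lam y := by
  obtain ⟨f, hf, hfΓ, hfb⟩ := hΓ.exists_deviation
  obtain ⟨c₈, hc₈, hcut⟩ := exists_cutoff (Amb m n)
  -- With ρ = (2 + 2ℓ) r and e = κ r^α, the bound 24 κ ρ^α on Df becomes c₆ e; the bound on f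
  -- carries one more factor ρ, hence c₇ = c₆ (2 + 2ℓ).
  set c₆ : ℝ := 24 * (2 + 2 * ℓ) ^ α
  set c₇ : ℝ := c₆ * (2 + 2 * ℓ)
  set k : ℝ := K / ((1 + 2 * ℓ) * (1 + ℓ)) ^ 2
  have hk : 0 < k := by positivity
  set M : ℝ := absorptionConst k (tiltConst m n Λ) (spatialConst m n Λ) c₆ c₇ c₈ +
    (m + n) ^ 2 * ((m + n + 1) * Λ) * (2 + 2 * c₇ ^ 2) with hM
  have hM0 : 0 ≤ M := by
    have h1 : 0 ≤ spatialConst m n Λ := by unfold spatialConst; positivity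
    rw [hM]; unfold absorptionConst; positivity
  refine ⟨2 / k * ((M + 1) * (1 + ℓ) ^ m), by positivity, ?_⟩
  intro F lam hF hU hlam hv Ω u H hG L hΓL hL r hr hrr
  set ρ := (2 + 2 * ℓ) * r with hρ
  have hκ := hΓ.κ_nonneg
  have hρ0 : 0 < ρ := by positivity
  have hρ4 : ρ ≤ r₀ / 4 := by linarith
  have hρr : ρ ≤ r₀ := by linarith
  have hr' : 0 < (1 + ℓ) * r := by positivity
  obtain ⟨φ, hφ, hφ₀, hφ₁, hφs, hφ'⟩ := hcut _ hr'
  -- The cutoff equals 1 up to (1 + ℓ) r and is supported within 3/2 of this radius, strictly below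
  -- ρ = 2 (1 + ℓ) r.
  have hφs' : tsupport φ ⊆ ball 0 ρ :=
    hφs.trans (closedBall_subset_ball (by rw [hρ]; linarith))
  have hφ'' : ∀ z, ‖fderiv ℝ φ z‖ ≤ c₈ / r := fun z => (hφ' z).trans (by
    gcongr
    exact le_mul_of_one_le_left hr.le (by simp))
  have e : ρ ^ α = (2 + 2 * ℓ) ^ α * r ^ α := Real.mul_rpow (by positivity) hr.le
  obtain ⟨h1, h2, h3⟩ := integral_tilt_le (e := κ * r ^ α) (c₆ := c₆) (c₇ := c₇) hm hK hΛ hF hU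
    hlam hv hG hL hr hρr hφ hφ₀ hφs' hφ'' (hf.mono (ball_subset_ball hρ4))
    (fun z hz hzρ => hΓL (hfΓ z hz ((mem_ball_zero_iff.mp hzρ).trans_le hρ4)))
    (fun z hz => by
      obtain ⟨b1, b2⟩ := hfb ρ hρ4 z hz
      rw [e] at b1 b2
      exact ⟨b1.trans_eq (by rw [hρ]; ring), b2.trans_eq (by ring)⟩)
  have h4 := integral_errorDensity_le hG L hr h2
  have h5 := setIntegral_tilt_le hG L (by linarith) hφ₁ h1
  have hQ : 0 ≤ ∫ y in ball 0 ρ ∩ Ω, baseErrorDensity u r₀ H L r (κ * r ^ α) lam y :=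
    integral_nonneg fun y => baseErrorDensity_nonneg _ _ _ _ y
  set Q := ∫ y in ball 0 ρ ∩ Ω, baseErrorDensity u r₀ H L r (κ * r ^ α) lam y
  have h6 : k / 2 * ∫ y in ball 0 r ∩ Ω, ‖fderiv ℝ u y - L‖ ^ 2 ≤
      (M + 1) * ((1 + ℓ) ^ m * Q) := by
    refine (mul_le_mul_of_nonneg_left h5 (by positivity)).trans (h3.trans ?_)
    refine (mul_le_mul_of_nonneg_left h4 hM0).trans ?_
    exact mul_le_mul_of_nonneg_right (by linarith) (by positivity)
  calc _ = 2 / k * (k / 2 * ∫ y in ball 0 r ∩ Ω, ‖fderiv ℝ u y - L‖ ^ 2) := by field_simp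
    _ ≤ 2 / k * ((M + 1) * ((1 + ℓ) ^ m * Q)) := mul_le_mul_of_nonneg_left h6 (by positivity)
    _ = _ := by ring

lemma average_baseErrorDensity (hG : GraphAssumption F Γ r₀ ℓ Ω u H)
    (L : EuclideanSpace ℝ (Fin m) →L[ℝ] EuclideanSpace ℝ (Fin n)) (r e lam : ℝ) {ρ : ℝ}
    (hρ : 0 < volume.real (ball 0 ρ ∩ Ω)) :
    ⨍ y in ball 0 ρ ∩ Ω, baseErrorDensity u r₀ H L r e lam y =
      1 / r ^ 2 * (⨍ y in ball 0 ρ ∩ Ω, ‖u y - L y‖ ^ 2) +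
      r ^ 2 * (⨍ y in ball 0 ρ ∩ Ω, ‖curvatureAlong u r₀ H y‖ ^ 2) +
      (e ^ 2 + lam ^ 2 * r ^ 2) := by
  obtain ⟨i1, i2, i3⟩ := integrableOn_baseErrorDensity hG L r e lam ρ
  simp only [setAverage_eq, smul_eq_mul, baseErrorDensity]
  have i12 : IntegrableOn (fun y => 1 / r ^ 2 * ‖u y - L y‖ ^ 2 +
    r ^ 2 * ‖curvatureAlong u r₀ H y‖ ^ 2) (ball 0 ρ ∩ Ω) := (i1.const_mul _).add (i2.const_mul _)
  rw [integral_add i12 i3, integral_add (i1.const_mul _) (i2.const_mul _), integral_const_mul, integral_const_mul,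
    setIntegral_const, smul_eq_mul]
  field_simp

end Base

end AnisoGraph

end

/-! ### Averaging over the two domains -/

theorem mainTheorem4 (m n : ℕ) (hm : 1 ≤ m) (hn : 1 ≤ n)
    (Γ : Set (AnisoGraph.Amb m n)) (α r₀ κ : ℝ)
    (hΓ : AnisoGraph.BoundaryAssumption Γ α r₀ κ)
    (Λ K : ℝ) (hK : 0 < K) (ℓ : NNReal) :
    ∃ C : ℝ, 0 < C ∧
      ∀ (F : AnisoGraph.Amb m n → Submodule ℝ (AnisoGraph.Amb m n) → ℝ) (lam : ℝ),
        AnisoGraph.IsC2Integrand F r₀ Λ →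
        AnisoGraph.USAC F r₀ K →
        0 ≤ lam → AnisoGraph.VariationBound F r₀ lam →
      ∀ (Ω : Set (EuclideanSpace ℝ (Fin m)))
        (u : EuclideanSpace ℝ (Fin m) → EuclideanSpace ℝ (Fin n))
        (H : AnisoGraph.Amb m n → AnisoGraph.Amb m n),
        AnisoGraph.GraphAssumption F Γ r₀ ℓ Ω u H →
      ∀ L : EuclideanSpace ℝ (Fin m) →L[ℝ] EuclideanSpace ℝ (Fin n),
        AnisoGraph.tangentSpace Γ 0 ≤
          LinearMap.range (AnisoGraph.graphProj L).toLinearMap →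
        ‖L‖ ≤ 2 * ℓ →
      ∀ r : ℝ, 0 < r → 4 * ((2 + 2 * ℓ) * r) < r₀ →
        C * ⨍ y in ball 0 r ∩ Ω, ‖fderiv ℝ u y - L‖ ^ 2 ≤
          1 / r ^ 2 * (⨍ y in ball 0 ((2 + 2 * ℓ) * r) ∩ Ω, ‖u y - L y‖ ^ 2) +
          r ^ 2 * (⨍ y in ball 0 ((2 + 2 * ℓ) * r) ∩ Ω,
            ‖AnisoGraph.curvatureAlong u r₀ H y‖ ^ 2) +
          κ ^ 2 * r ^ (2 * α) + lam ^ 2 * r ^ 2 := by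
  by_cases hΛ : 0 ≤ Λ
  swap
  -- For Λ < 0 there is no admissible integrand, because |F| ≤ Λ at the origin.
  · refine ⟨1, one_pos, fun F lam hF => absurd ?_ hΛ⟩
    exact (abs_nonneg _).trans (AnisoGraph.abs_integrand_le hF (mem_ball_self hΓ.r₀_pos)
      (AnisoGraph.finrank_graphPlane 0))
  obtain ⟨M, hM, hmain⟩ := AnisoGraph.exists_setIntegral_tilt_le hm hΓ hΛ hK ℓ
  obtain ⟨D, hD, hvol⟩ :=
    AnisoGraph.exists_volume_ratio (m := m) (n := n) hΓ.α_pos hΓ.r₀_pos κ ℓ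
  -- M comes from the inequality before averaging, D from comparing the volume of the larger domain
  -- with that of the smaller one.
  refine ⟨(M * D)⁻¹, by positivity, ?_⟩
  intro F lam hF hU hlam hv Ω u H hG L hL hLℓ r hr hrr
  have h1 := hmain F lam hF hU hlam hv Ω u H hG L
    (hL.trans (AnisoGraph.range_graphProj_le L)) hLℓ r hr hrr
  obtain ⟨h2, h3⟩ := hvol Γ Ω u hΓ hG.isOpen hG.subset_ball hG.lipschitz
    (AnisoGraph.zero_mem_closure_graphSet hG.zero_mem_support) hG.boundary r hr hrr
  have h4 : 0 < volume.real (ball 0 ((2 + 2 * ℓ) * r) ∩ Ω) := by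
    refine h2.trans_le (measureReal_mono (inter_subset_inter_left _ (ball_subset_ball ?_))
      (measure_ne_top_of_subset inter_subset_left measure_ball_lt_top.ne))
    have : 0 ≤ (ℓ : ℝ) * r := by positivity
    linarith
  have h5 := AnisoGraph.average_baseErrorDensity hG L r (κ * r ^ α) lam h4
  have e : (κ * r ^ α) ^ 2 = κ ^ 2 * r ^ (2 * α) := by
    rw [mul_pow, ← Real.rpow_natCast (r ^ α), ← Real.rpow_mul hr.le]
    congr 2
    push_cast
    ring
  rw [e] at h5
  rw [add_assoc, ← h5, inv_mul_le_iff₀ (by positivity), setAverage_eq, setAverage_eq, smul_eq_mul,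
    smul_eq_mul]
  set Q := ∫ y in ball 0 ((2 + 2 * ℓ) * r) ∩ Ω,
    AnisoGraph.baseErrorDensity u r₀ H L r (κ * r ^ α) lam y
  have hQ : 0 ≤ Q := integral_nonneg fun y => AnisoGraph.baseErrorDensity_nonneg _ _ _ _ y
  rw [inv_mul_le_iff₀ h2]
  refine h1.trans ?_
  set v := volume.real (ball 0 r ∩ Ω)
  set V := volume.real (ball 0 ((2 + 2 * ℓ) * r) ∩ Ω)
  calc M * Q = M * (V⁻¹ * Q) * V := by field_simp
    _ ≤ M * (V⁻¹ * Q) * (D * v) := mul_le_mul_of_nonneg_left h3 (by positivity)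
    _ = _ := by ring
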